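/- **Setting.** Let $X=\mathbb C^n$ with coordinates divided into (possibly empty) blocks $z=(z^{(0)},z^{(1)},\dots,z^{(m)})$, with the maximum norm $|\cdot|$ on each block, and write $|z^{(*)}|=(|z^{(1)}|,\dots,|z^{(m)}|)$. Let $A=(a_{jk})$ be an $\ell\times m$ matrix of non-negative rational numbers of rank $L$, none of whose rows is zero, and whose leading $L\times L$ submatrix is invertible. Let $\sigma>0$ be the rational number for which the $\sigma a_{jk}$ are integers without a common divisor $>1$. For $\lambda\in(\mathbb R^+)^\ell$ put $\varphi_k(\lambda)=\prod_j\lambda_j^{a_{jk}}$ and $$\mu(z,\lambda)=(z^{(0)},\varphi_1(\lambda)z^{(1)},\dots,\varphi_m(\lambda)z^{(m)}),\qquad \mu_j(z,t)=(z^{(0)},t^{a_{j1}}z^{(1)},\dots,t^{a_{jm}}z^{(m)}).$$ Let $K_j=\{k:a_{jk}\ne0\}$, and for $\emptyset\ne J\subseteq\{1,\dots,\ell\}$ let $K_J=\bigcup_{j\in J}K_j$, $Z_J=\{z:z^{(k)}=0\ (k\in K_J)\}$, and let $\pi_J:X\to Z_J$ be the projection that replaces the coordinates $z^{(k)}$,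 $k\in K_J$, by $0$. Let $p=(0;\zeta)$ be a point with $\zeta=(\zeta^{(1)},\dots,\zeta^{(m)})$, such that $\zeta^{(k)}=0$ if the $k$-th column of $A$ is zero. Assume that $p$ is outside the fixed points, i.e. there is no $a\in\mathbb R^\ell$ for which the action $t\mapsto\mu(\cdot,(t^{a_1},\dots,t^{a_\ell}))$ of $\mathbb R^+$ is not the identity but fixes $p$; and assume that $\zeta^{(k)}\neq0$ for $1\le k\le L$. **The semigroup.** Write $\tau=(\tau',\tau'')$, $\lambda=(\lambda',\lambda'')$ with $\tau'=(\tau_1,\dots,\tau_L)$ and $\lambda'=(\lambda_1,\dots,\lambda_L)$. Let $\varphi^{-1}_i(\tau',\lambda'')$, $1\le i\le L$, be the monomials with rational exponents that solve $\tau_k=\varphi_k(\lambda)$, $1\le k\le L$, for $\lambda'$, and let $\psi_k=\tau_k/\varphi_k(\varphi^{-1}(\tau',\lambda''),\lambda'')$, $L<k\le m$; by the rank condition $\psi_k$ does not contain $\lambda''$. Consider pairs $(f,v)$ of a monomial $f$ in $\tau,\lambda$ with rational exponents and a number $v\ge0$, with componentwise multiplication. Let $$G_0=\{(\varphi_i^{-1},0)\}_{i\le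 L}\cup\{(\psi_k,\psi_k(|\zeta^{(1)}|,\dots,|\zeta^{(m)}|))\}_{L<k\le m}\cup\{(\lambda_j,0)\}_{L<j\le\ell},$$ $G=G_0\cup\{(f^{-1},v^{-1}):(f,v)\in G_0,\ v\ne0\}$, and let $\mathcal G$ be the semigroup (with unit) of those products of elements of $G$ whose monomial contains no variable $\lambda_j$. Let $H$ be a finite set of pairs $(f,v)$ with $f$ containing no $\lambda_j$, such that the semigroup (with unit) $[H]$ generated by $H$ is equivalent to $\mathcal G$: for some positive integers $N_1,N_2$, $\{h^{N_1}:h\in[H]\}\subseteq\{g^{N_2}:g\in\mathcal G\}\subseteq[H]$. **Multicones.** A multicone $S=S_H(V,\{\epsilon\})$ at $p$ is given by $V=\mathbb C^{n_0}\times V_1\times\dots\times V_m$, where $V_k\ne\mathbb C^{n_k}$ is an open convex cone containing $\zeta^{(k)}$ if $\zeta^{(k)}\neq0$ and $V_k=\mathbb C^{n_k}$ if $\zeta^{(k)}=0$, and by positive numbers $\epsilon_0$, $\epsilon_{f,\pm}$ ($(f,v)\in H$): $$S=\{z\in V: |z^{(0)}|<\epsilon_0,\ v-\epsilon_{f,-}<f(|z^{(*)}|)<v+\epsilon_{f,+}\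 \text{ for all } (f,v)\in H\}.$$ $S'=S_H(V',\{\epsilon'\})$ is properly contained in $S$ if $\overline{V'_k}\setminus\{0\}\subseteq V_k$ for $1\le k\le m$ and all the numbers $\epsilon'$ are strictly smaller than the corresponding $\epsilon$. Put $S_J=\pi_J(S)$, a relatively open subset of $Z_J$. **Generalized level functions.** For a set $B$ of pairs let $\mathcal L_j(B)$ consist of the pairs in $B$ whose monomial does not contain $\lambda_j$ and of the pairs $(f^ag^b,v^aw^b)$ with $(f,v),(g,w)\in B$ such that the exponent $x$ of $\lambda_j$ in $f$ is positive and the exponent $y$ of $\lambda_j$ in $g$ is negative, where $a,b$ are the coprime positive integers with $a|x|=b|y|$. Put $F^{0,L}=G$ and $F^{0,j}=\mathcal L_j(F^{0,j-1})$ for $L<j\le\ell$. For a monomial $f$ in which $\lambda_j$ has exponent $-x<0$ let $\mathrm{sol}_j(f)=\lambda_jf^{1/x}$. For $L<j\le\ell$ let $\rho_j$ be the maximum of $\mathrm{sol}_j(f)$ over all $(f,v)\in F^{0,j-1}$ in which $\lambda_j$ has a negative exponent, and $\rho_j=1$ if there are none; $\rho_j$ is a function of $\tau'$ and $\lambda_{j+1},\dots,\lambda_\ell$.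 Solving $\lambda_j=\rho_j(\tau',\lambda_{j+1},\dots,\lambda_\ell)$ successively for $j=\ell,\ell-1,\dots,L+1$ gives functions $\lambda_j=\rho_{\Lambda,j}(\tau')$, $L<j\le\ell$; put $\rho_{\Lambda,i}(\tau')=\varphi_i^{-1}(\tau',\rho_{\Lambda,L+1}(\tau'),\dots,\rho_{\Lambda,\ell}(\tau'))$ for $i\le L$. Let $\Theta_\mu$ be the set of permutations $\theta$ of $\{1,\dots,\ell\}$ for which the rows $\theta(1),\dots,\theta(L)$ of $A$ are linearly independent, let $\rho^\theta_\Lambda$ be constructed in the same way from the matrix with the rows in the order $\theta(1),\dots,\theta(\ell)$, and put $$\hat\rho_{\Lambda,j}(z)=\min_{\theta\in\Theta_\mu}\rho^\theta_{\Lambda,\theta^{-1}(j)}(|z^{(*)}|),\qquad 1\le j\le\ell .$$ **Asymptotic expansions.** A total family of coefficients on $S$ is a family $F=\{F_J\}_{\emptyset\ne J\subseteq\{1,\dots,\ell\}}$, $F_J=\{f_{J,\alpha}\}_\alpha$, where $\alpha$ runs through the multi-indices $\alpha\in\mathbb Z_{\ge0}^n$ with $\alpha^{(k)}=0$ for $k\notin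 K_J$, and $f_{J,\alpha}$ is a holomorphic function on $S_J$. For $N=(n_1,\dots,n_\ell)\in\mathbb Z_{\ge0}^\ell$ let $A_J(N)$ be the set of these $\alpha$ with $\sum_ka_{jk}|\alpha^{(k)}|<n_j/\sigma$ for all $j\in J$, and $$T_J^{<N}(F;z)=\sum_{\alpha\in A_J(N)}f_{J,\alpha}(\pi_J(z))\frac{z^\alpha}{\alpha!},\qquad \mathrm{App}^{<N}(F;z)=\sum_{J\ne\emptyset}(-1)^{\#J+1}T_J^{<N}(F;z).$$ A holomorphic function $f$ on $S$ is multi-asymptotically developable to $F$ on $S$ with level functions $\hat\rho_\Lambda$ if for every multicone $S'=S_H(V',\{\epsilon'\})$ properly contained in $S$ and every $N\in\mathbb Z_{\ge0}^\ell$ there is a constant $C_{S',N}$ with $$|f(z)-\mathrm{App}^{<N}(F;z)|\le C_{S',N}\prod_{j=1}^\ell\hat\rho_{\Lambda,j}(z)^{n_j/\sigma}\qquad(z\in S').$$ **Theorem.** Let $F=\{f_{J,\alpha}\}$ be a total family of coefficients on $S$, and let $f$ be a holomorphic function on $S$ that is multi-asymptotically developable to $F$ on $S$ with the level functions $\hat\rho_\Lambda$.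 Then: 1. Every $\mu_j$ is strict with respect to $\hat\rho_\Lambda$: $\lim_{t\to0+}\hat\rho_{\Lambda,j}(\mu_j(z,t))=0$ for $1\le j\le\ell$ and all $z\in S$. 2. For every $J\neq\emptyset$ and every $\alpha$ with $\alpha^{(k)}=0$ for $k\notin K_J$, $$f_{J,\alpha}=\left.\frac{\partial^\alpha f}{\partial z^\alpha}\right|_{Z_J}\quad\text{on }S_J,$$ that is, for every multicone $S'$ properly contained in $S$, $\pi_J(S')\subseteq\overline{S'}$, the function $\partial^\alpha f/\partial z^\alpha|_{S'}$ extends continuously to $\overline{S'}$, and the extension is equal to $f_{J,\alpha}$ on $\pi_J(S')$. In particular $F$ is uniquely determined by $f$: if $f$ is also multi-asymptotically developable to a total family $F'=\{f'_{J,\alpha}\}$ on $S$ with the level functions $\hat\rho_\Lambda$, then $f'_{J,\alpha}=f_{J,\alpha}$ on $S_J$ for all $J,\alpha$. 3. $F$ is consistent: for every $S'$ properly contained in $S$, every $J\ne\emptyset$ and every $\alpha$ with $\alpha^{(k)}=0$ for $k\notin K_J$, all derivatives $\partial^\beta f_{J,\alpha}/\partial z^\beta$ along $Z_J$ (i.e.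 with $\beta^{(k)}=0$ for $k\in K_J$) are bounded on $\pi_J(S')$; and if moreover $J\subseteq R\subseteq\{1,\dots,\ell\}$ and $\beta^{(k)}=0$ for $k\notin K_R\setminus K_J$, then $$f_{R,\alpha+\beta}=\left.\frac{\partial^\beta f_{J,\alpha}}{\partial z^\beta}\right|_{Z_R}\quad\text{on }S_R,$$ in the sense that $\pi_R(S')\subseteq\overline{\pi_J(S')}$ and $\partial^\beta f_{J,\alpha}/\partial z^\beta|_{\pi_J(S')}$ extends continuously to $\overline{\pi_J(S')}$, with values $f_{R,\alpha+\beta}$ on $\pi_R(S')$. -/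

import Mathlib

open Filter Topology
open scoped NNReal

noncomputable section

namespace MultiAsymp

/-! ### Monomials with rational exponents -/

/-- Exponent vectors of the monomials `τ₁^α₁ ⋯ τ_m^α_m λ₁^β₁ ⋯ λ_ℓ^β_ℓ` with rational exponents.
Products of monomials are sums of exponent vectors, rational powers are scalar multiples. -/
abbrev Expo (m ℓ : ℕ) : Type := (Fin m → ℚ) × (Fin ℓ → ℚ)

/-- Pairs `(f, v)` of a monomial `f` in `τ, λ` and a number `v ≥ 0`, with the componentwise
product `(f, v) (g, w) = (f g, v w)`. -/
abbrev Weighted (m ℓ : ℕ) : Type := Multiplicative (Expo m ℓ) × ℝ≥0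

variable {m ℓ : ℕ}

/-- The value of a monomial. -/
def Expo.eval (e : Expo m ℓ) (τ : Fin m → ℝ) (lam : Fin ℓ → ℝ) : ℝ :=
  (∏ k, τ k ^ (e.1 k : ℝ)) * ∏ j, lam j ^ (e.2 j : ℝ)

/-- The monomial `τ_k`. -/
def tauE (k : Fin m) : Expo m ℓ := (Pi.single k 1, 0)

/-- The monomial `λ_j`. -/
def lamE (j : Fin ℓ) : Expo m ℓ := (0, Pi.single j 1)

/-- The exponents of `λ` in the monomial `f` of a pair `(f, v)`. -/
def lamExp (p : Weighted m ℓ) : Fin ℓ → ℚ := (Multiplicative.toAdd p.1).2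

/-- The pair `(f, v)` as an element, given the exponents of `f`. -/
def mkPair (e : Expo m ℓ) (v : ℝ≥0) : Weighted m ℓ := (Multiplicative.ofAdd e, v)

/-- `A ∪ {(f⁻¹, v⁻¹) ; (f, v) ∈ A, v ≠ 0}`. -/
def fraction (B : Set (Weighted m ℓ)) : Set (Weighted m ℓ) :=
  B ∪ {p | ∃ q ∈ B, q.2 ≠ 0 ∧ p = q⁻¹}

/-- Equivalence of two semigroups of pairs: `⟨B⟩_{N₁} ⊆ ⟨C⟩_{N₂} ⊆ B` for some positive integers
`N₁, N₂`, where `⟨B⟩_N` is the set of `N`-th powers of elements of `B`. -/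
def EquivSemigroup (B C : Set (Weighted m ℓ)) : Prop :=
  ∃ N₁ N₂ : ℕ, 0 < N₁ ∧ 0 < N₂ ∧
    (fun p => p ^ N₁) '' B ⊆ (fun p => p ^ N₂) '' C ∧ (fun p => p ^ N₂) '' C ⊆ B

/-- Elimination of the variable `λ_j` from a set of pairs: keep the pairs not containing `λ_j`,
and add `(f^a g^b, v^a w^b)` for `(f, v), (g, w)` in which `λ_j` has a positive, respectively a
negative exponent, with coprime `a, b` chosen such that `λ_j` cancels. -/
def elimLam (j : Fin ℓ) (B : Set (Weighted m ℓ)) : Set (Weighted m ℓ) :=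
  {p | p ∈ B ∧ lamExp p j = 0} ∪
  {p | ∃ f ∈ B, ∃ g ∈ B, ∃ a b : ℕ, 0 < lamExp f j ∧ lamExp g j < 0 ∧ Nat.Coprime a b ∧
    (a : ℚ) * |lamExp f j| = (b : ℚ) * |lamExp g j| ∧ p = f ^ a * g ^ b}

/-- For a monomial `f` whose exponent `a` of `λ_j` is negative: `sol_j(f) = λ_j f^{1/|a|}`, the
solution `λ_j` of the equation `f = 1`. -/
def solE (j : Fin ℓ) (p : Weighted m ℓ) : Expo m ℓ :=
  lamE j + (1 / |lamExp p j|) • Multiplicative.toAdd p.1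

/-! ### The multicone semigroup and the level functions of a matrix

`A` is an `ℓ × m` matrix with `ℓ = L + r`, `m = L + s`, where `L` is its rank. The first `L`
variables are `τ'`, `λ'`, the remaining ones are `τ''`, `λ''`. -/

variable {L r s : ℕ}

/-- The leading `L × L` submatrix. -/
def leading (A : Matrix (Fin (L + r)) (Fin (L + s)) ℚ) : Matrix (Fin L) (Fin L) ℚ :=
  A.submatrix (Fin.castAdd r) (Fin.castAdd s)

/-- The monomials `φ_i⁻¹(τ', λ'')`, `1 ≤ i ≤ L`: the solution `λ'` of the system
`τ_k = φ_k(λ) = ∏_j λ_j ^ a_{jk}`, `1 ≤ k ≤ L`. -/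
def phiInv (A : Matrix (Fin (L + r)) (Fin (L + s)) ℚ) (i : Fin L) : Expo (L + s) (L + r) :=
  ∑ k : Fin L, (leading A)⁻¹ k i •
    (tauE (Fin.castAdd s k) -
      ∑ t : Fin r, A (Fin.natAdd L t) (Fin.castAdd s k) • lamE (Fin.natAdd L t))

/-- The monomials `ψ_k = τ_k / φ_k(φ⁻¹(τ', λ''), λ'')`, `L < k ≤ m`. -/
def psi (A : Matrix (Fin (L + r)) (Fin (L + s)) ℚ) (k : Fin s) : Expo (L + s) (L + r) :=
  tauE (Fin.natAdd L k) -
    (∑ i : Fin L, A (Fin.castAdd r i) (Fin.natAdd L k) • phiInv A i +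
      ∑ t : Fin r, A (Fin.natAdd L t) (Fin.natAdd L k) • lamE (Fin.natAdd L t))

/-- The generating set `G`. Here `w = (|ζ⁽¹⁾|, …, |ζ⁽ᵐ⁾|)`, where the first `L` entries are assumed
to be non-zero. -/
def genG (A : Matrix (Fin (L + r)) (Fin (L + s)) ℚ) (w : Fin (L + s) → ℝ) :
    Set (Weighted (L + s) (L + r)) :=
  fraction
    (Set.range (fun i : Fin L => mkPair (phiInv A i) 0) ∪
      Set.range (fun k : Fin s =>
        mkPair (psi A k) (Real.toNNReal ((psi A k).eval w (fun _ => 1)))) ∪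
      Set.range (fun t : Fin r => mkPair (lamE (Fin.natAdd L t)) 0))

/-- The semigroup `𝒢`: the elements of the semigroup generated by `G` whose monomials do not
contain the variables `λ`. (As the first `L` blocks of `ζ` are non-zero, there is no further sign
condition on the exponents.) -/
def semiG (A : Matrix (Fin (L + r)) (Fin (L + s)) ℚ) (w : Fin (L + s) → ℝ) :
    Set (Weighted (L + s) (L + r)) :=
  {p | p ∈ Submonoid.closure (genG A w) ∧ lamExp p = 0}

/-- The finite sets `F^{0, L + t}`: the variables `λ_{L+1}, …, λ_{L+t}` are successively
eliminated from `G`. -/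
def elimSeq (A : Matrix (Fin (L + r)) (Fin (L + s)) ℚ) (w : Fin (L + s) → ℝ) :
    ℕ → Set (Weighted (L + s) (L + r))
  | 0 => genG A w
  | t + 1 =>
      if h : t < r then elimLam (Fin.natAdd L ⟨t, h⟩) (elimSeq A w t) else elimSeq A w t

open Classical in
/-- The functions `ρ_j(τ', λ'')` for `L < j ≤ ℓ` (with `j = L + 1 + t`): the maximum of `sol_j(f)`
over the finitely many `(f, v) ∈ F^{0, j-1}` in which `λ_j` has a negative exponent (and `1` if
there are none). -/
def rho (A : Matrix (Fin (L + r)) (Fin (L + s)) ℚ) (w : Fin (L + s) → ℝ) (t : Fin r)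
    (τ : Fin (L + s) → ℝ) (lam : Fin (L + r) → ℝ) : ℝ :=
  if ∃ p ∈ elimSeq A w t, lamExp p (Fin.natAdd L t) < 0 then
    sSup ((fun p => (solE (Fin.natAdd L t) p).eval τ lam) ''
      {p | p ∈ elimSeq A w t ∧ lamExp p (Fin.natAdd L t) < 0})
  else 1

/-- `ρ_{Λ,j}(τ')` for `L < j ≤ ℓ`: as `ρ_j` contains only `τ'` and the variables `λ_i` with
`i > j`, the equations `λ_j = ρ_j(τ', λ_{j+1}, …, λ_ℓ)` are solved successively for
`j = ℓ, ℓ - 1, …, L + 1`. (The variables that do not occur in `ρ_j` are given the value `1`.) -/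
def rhoLower (A : Matrix (Fin (L + r)) (Fin (L + s)) ℚ) (w : Fin (L + s) → ℝ)
    (τ : Fin (L + s) → ℝ) (t : Fin r) : ℝ :=
  rho A w t τ (Fin.addCases (fun _ => 1)
    (fun u : Fin r => if _h : t < u then rhoLower A w τ u else 1))
termination_by r - (t : ℕ)

/-- The family of level functions `ρ_Λ = (ρ_{Λ,1}, …, ρ_{Λ,ℓ})`. -/
def rhoLevel (A : Matrix (Fin (L + r)) (Fin (L + s)) ℚ) (w : Fin (L + s) → ℝ)
    (τ : Fin (L + s) → ℝ) : Fin (L + r) → ℝ :=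
  Fin.addCases
    (fun i : Fin L => (phiInv A i).eval τ (Fin.addCases (fun _ => 1) (rhoLower A w τ)))
    (rhoLower A w τ)

/-- The admissible orderings of the actions: the rows of `A` belonging to the first `L` of the
reordered actions are linearly independent. -/
def Admissible (A : Matrix (Fin (L + r)) (Fin (L + s)) ℚ) (θ : Equiv.Perm (Fin (L + r))) : Prop :=
  LinearIndependent ℚ (fun i : Fin L => A (θ (Fin.castAdd r i)))

/-- The generalized level functions: `ρ̂_j` is the minimum over the admissible orderings `θ` of the
level function with index `θ⁻¹(j)` that is constructed from the actions in the order `θ`. -/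
def rhoHat (A : Matrix (Fin (L + r)) (Fin (L + s)) ℚ) (w : Fin (L + s) → ℝ)
    (τ : Fin (L + s) → ℝ) (j : Fin (L + r)) : ℝ :=
  ⨅ θ : {θ : Equiv.Perm (Fin (L + r)) // Admissible A θ},
    rhoLevel (A.submatrix θ.1 id) w τ (θ.1.symm j)

/-! ### Coordinate blocks and actions

The coordinates of `X = ℂⁿ` are divided into blocks by a map `blk` to `{0, 1, …, m}`; the block of
index `k.succ` belongs to the column `k` of `A`. The norm on `ℂⁿ` is the maximum norm. -/

variable {n : ℕ}

/-- The block `z⁽ᵏ⁾` of coordinates of `z`. -/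
def blockPart (blk : Fin n → Fin (m + 1)) (z : Fin n → ℂ) (k : Fin (m + 1)) :
    {i // blk i = k} → ℂ := fun i => z i

/-- `|z⁽*⁾| = (|z⁽¹⁾|, …, |z⁽ᵐ⁾|)`. -/
def blockNorms (blk : Fin n → Fin (m + 1)) (z : Fin n → ℂ) : Fin m → ℝ :=
  fun k => ‖blockPart blk z k.succ‖

/-- The action `μ(z, λ) = (z⁽⁰⁾, φ₁(λ) z⁽¹⁾, …, φ_m(λ) z⁽ᵐ⁾)`, `φ_k(λ) = ∏_j λ_j ^ a_{jk}`. -/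
def mu (A : Matrix (Fin ℓ) (Fin m) ℚ) (blk : Fin n → Fin (m + 1)) (z : Fin n → ℂ)
    (lam : Fin ℓ → ℝ) : Fin n → ℂ := fun i =>
  Fin.cases (z i) (fun k => ((∏ j, lam j ^ (A j k : ℝ) : ℝ) : ℂ) * z i) (blk i)

/-- The action `μ_j(z, t) = (z⁽⁰⁾, t^{a_{j1}} z⁽¹⁾, …, t^{a_{jm}} z⁽ᵐ⁾)`. -/
def muSingle (A : Matrix (Fin ℓ) (Fin m) ℚ) (blk : Fin n → Fin (m + 1)) (j : Fin ℓ)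
    (z : Fin n → ℂ) (t : ℝ) : Fin n → ℂ := fun i =>
  Fin.cases (z i) (fun k => ((t ^ (A j k : ℝ) : ℝ) : ℂ) * z i) (blk i)

/-- `p` is a fixed point: for some `a ∈ ℝ^ℓ` the action `μ^a(p, t) = μ(p, t^{a_1}, …, t^{a_ℓ})` is
not the identity and fixes `p`. -/
def IsFixedPt (A : Matrix (Fin ℓ) (Fin m) ℚ) (blk : Fin n → Fin (m + 1)) (p : Fin n → ℂ) : Prop :=
  ∃ a : Fin ℓ → ℝ,
    (∃ t : ℝ, 0 < t ∧ ∃ q : Fin n → ℂ, mu A blk q (fun j => t ^ a j) ≠ q) ∧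
    ∀ t : ℝ, 0 < t → mu A blk p (fun j => t ^ a j) = p

/-- The coordinate `z_i` belongs to a block `z⁽ᵏ⁾` with `k ∈ K_J = ⋃_{j ∈ J} K_j`, where
`K_j = {k ; a_{jk} ≠ 0}`; i.e. `z_i = 0` on `Z_J = ⋂_{j ∈ J} Z_j`. -/
def InK (A : Matrix (Fin ℓ) (Fin m) ℚ) (blk : Fin n → Fin (m + 1)) (J : Finset (Fin ℓ))
    (i : Fin n) : Prop :=
  ∃ k : Fin m, blk i = k.succ ∧ ∃ j ∈ J, A j k ≠ 0

open Classical in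
/-- The projection `π_J : X → Z_J ⊆ X`. -/
def proj (A : Matrix (Fin ℓ) (Fin m) ℚ) (blk : Fin n → Fin (m + 1)) (J : Finset (Fin ℓ))
    (z : Fin n → ℂ) : Fin n → ℂ := fun i => if InK A blk J i then 0 else z i

/-- `σ` is the positive rational number for which the `σ a_{jk}` are integers without a common
divisor. -/
def IsScale (A : Matrix (Fin ℓ) (Fin m) ℚ) (σ : ℚ) : Prop :=
  0 < σ ∧ ∃ e : Fin ℓ → Fin m → ℕ, (∀ j k, (e j k : ℚ) = σ * A j k) ∧
    ∀ d : ℕ, (∀ j k, d ∣ e j k) → d = 1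

/-! ### Multicones -/

/-- The multicones `S_H(V, {ε})` at the point `p = (0; ζ)`: the data `V = ℂ^{n₀} × V₁ × ⋯ × V_m` and
the positive numbers `ε₀`, `ε_{f,+}`, `ε_{f,-}` for `(f, v) ∈ H`. -/
structure Multicone (blk : Fin n → Fin (m + 1)) (p : Fin n → ℂ)
    (H : Finset (Weighted m ℓ)) where
  V : ∀ k : Fin m, Set ({i // blk i = k.succ} → ℂ)
  eps0 : ℝ
  epsPlus : Weighted m ℓ → ℝ
  epsMinus : Weighted m ℓ → ℝ
  /-- if `ζ⁽ᵏ⁾ ≠ 0`, then `V_k` is an open convex proper cone containing `ζ⁽ᵏ⁾` -/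
  cone : ∀ k, blockPart blk p k.succ ≠ 0 →
    IsOpen (V k) ∧ Convex ℝ (V k) ∧ (∀ t : ℝ, 0 < t → ∀ x ∈ V k, t • x ∈ V k) ∧
      V k ≠ Set.univ ∧ blockPart blk p k.succ ∈ V k
  whole : ∀ k, blockPart blk p k.succ = 0 → V k = Set.univ
  eps0_pos : 0 < eps0
  epsPlus_pos : ∀ h ∈ H, 0 < epsPlus h
  epsMinus_pos : ∀ h ∈ H, 0 < epsMinus h

variable {blk : Fin n → Fin (m + 1)} {p : Fin n → ℂ} {H : Finset (Weighted m ℓ)}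

/-- The underlying set of a multicone. The elements of `H` do not contain the variables `λ`, to
which an arbitrary value is given. -/
def Multicone.carrier (S : Multicone blk p H) : Set (Fin n → ℂ) :=
  {z | (∀ k, blockPart blk z k.succ ∈ S.V k) ∧ ‖blockPart blk z 0‖ < S.eps0 ∧
    ∀ h ∈ H, (h.2 : ℝ) - S.epsMinus h <
        Expo.eval (Multiplicative.toAdd h.1) (blockNorms blk z) (fun _ => 1) ∧
      Expo.eval (Multiplicative.toAdd h.1) (blockNorms blk z) (fun _ => 1) <
        (h.2 : ℝ) + S.epsPlus h}

/-- `S'` is properly contained in `S`. -/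
def Multicone.ProperIn (S' S : Multicone blk p H) : Prop :=
  (∀ k, closure (S'.V k) \ {0} ⊆ S.V k) ∧ S'.eps0 < S.eps0 ∧
    ∀ h ∈ H, S'.epsMinus h < S.epsMinus h ∧ S'.epsPlus h < S.epsPlus h

/-! ### Derivatives and boundary values -/

/-- The complex partial derivative `∂/∂z_i`. -/
def pderiv (i : Fin n) (g : (Fin n → ℂ) → ℂ) : (Fin n → ℂ) → ℂ :=
  fun z => lineDeriv ℂ g z (Pi.single i 1)

/-- The iterated partial derivative `∂^α/∂z^α`. For a function on a relatively open subset of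
`Z_J` only the derivatives in the directions of `Z_J` make sense. -/
def iterPDeriv (α : Fin n → ℕ) (g : (Fin n → ℂ) → ℂ) : (Fin n → ℂ) → ℂ :=
  (List.finRange n).foldr (fun i h => (pderiv i)^[α i] h) g

/-- The function `g` on `T` extends to a continuous function on the closure of `T` whose
restriction to `B ⊆ closure T` is `b`. -/
def HasRestriction (g : (Fin n → ℂ) → ℂ) (T : Set (Fin n → ℂ)) (b : (Fin n → ℂ) → ℂ)
    (B : Set (Fin n → ℂ)) : Prop :=
  B ⊆ closure T ∧ ∃ G : (Fin n → ℂ) → ℂ,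
    ContinuousOn G (closure T) ∧ Set.EqOn G g T ∧ Set.EqOn G b B

/-! ### Multi-asymptotic expansions -/

/-- The multi-indices `α` with `α⁽ᵏ⁾ = 0` for `k ∉ K_J`. -/
def Normal (A : Matrix (Fin ℓ) (Fin m) ℚ) (blk : Fin n → Fin (m + 1)) (J : Finset (Fin ℓ))
    (α : Fin n → ℕ) : Prop := ∀ i, ¬ InK A blk J i → α i = 0

/-- The multi-indices `β` with `β⁽ᵏ⁾ = 0` for `k ∈ K_J`. -/
def Tangential (A : Matrix (Fin ℓ) (Fin m) ℚ) (blk : Fin n → Fin (m + 1)) (J : Finset (Fin ℓ))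
    (β : Fin n → ℕ) : Prop := ∀ i, InK A blk J i → β i = 0

/-- The length `|α⁽ᵏ⁾|` of an index block. -/
def blockLen (blk : Fin n → Fin (m + 1)) (α : Fin n → ℕ) (k : Fin (m + 1)) : ℕ :=
  ∑ i with blk i = k, α i

/-- The finite set `A_J(N)` of the multi-indices `α`, with `α⁽ᵏ⁾ = 0` for `k ∉ K_J`, such that
`∑_k a_{jk} |α⁽ᵏ⁾| < n_j / σ` for all `j ∈ J`. -/
def indexSet (A : Matrix (Fin ℓ) (Fin m) ℚ) (blk : Fin n → Fin (m + 1)) (σ : ℚ)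
    (J : Finset (Fin ℓ)) (N : Fin ℓ → ℕ) : Set (Fin n → ℕ) :=
  {α | Normal A blk J α ∧ ∀ j ∈ J, ∑ k, A j k * (blockLen blk α k.succ : ℚ) < (N j : ℚ) / σ}

/-- A family `F_J = {f_{J,α}}`. Only the `f_{J,α}` with `J ≠ ∅` and `α⁽ᵏ⁾ = 0` for `k ∉ K_J`, and
only their values on `Z_J`, are of interest. -/
abbrev CoeffFamily (n ℓ : ℕ) : Type := Finset (Fin ℓ) → (Fin n → ℕ) → (Fin n → ℂ) → ℂ

/-- `T_J^{<N}(F; z) = ∑_{α ∈ A_J(N)} f_{J,α}(π_J(z)) z^α / α!`. -/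
def taylorPart (A : Matrix (Fin ℓ) (Fin m) ℚ) (blk : Fin n → Fin (m + 1)) (σ : ℚ)
    (F : CoeffFamily n ℓ) (J : Finset (Fin ℓ)) (N : Fin ℓ → ℕ) (z : Fin n → ℂ) : ℂ :=
  ∑ᶠ α ∈ indexSet A blk σ J N,
    F J α (proj A blk J z) / ((∏ i, (α i).factorial : ℕ) : ℂ) * ∏ i, z i ^ α i

open Classical in
/-- `App^{<N}(F; z) = ∑_{∅ ≠ J} (-1)^{#J + 1} T_J^{<N}(F; z)`. -/
def app (A : Matrix (Fin ℓ) (Fin m) ℚ) (blk : Fin n → Fin (m + 1)) (σ : ℚ)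
    (F : CoeffFamily n ℓ) (N : Fin ℓ → ℕ) (z : Fin n → ℂ) : ℂ :=
  ∑ J : Finset (Fin ℓ) with J.Nonempty, (-1) ^ (J.card + 1) * taylorPart A blk σ F J N z

/-- `F` is a total family of coefficients on `S`: each `f_{J,α}` is a holomorphic function on the
relatively open subset `S_J = π_J(S)` of `Z_J`. -/
def IsTotalFamily (A : Matrix (Fin ℓ) (Fin m) ℚ) (S : Multicone blk p H)
    (F : CoeffFamily n ℓ) : Prop :=
  ∀ J : Finset (Fin ℓ), J.Nonempty → ∀ α, Normal A blk J α →
    DifferentiableOn ℂ (F J α) (proj A blk J '' S.carrier)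

/-- `f` is multi-asymptotically developable to `F` on `S` with the level functions
`ρ_j(|z⁽*⁾|)`. -/
def IsDevelopable (A : Matrix (Fin ℓ) (Fin m) ℚ) (σ : ℚ) (lev : (Fin m → ℝ) → Fin ℓ → ℝ)
    (S : Multicone blk p H) (F : CoeffFamily n ℓ) (f : (Fin n → ℂ) → ℂ) : Prop :=
  ∀ S' : Multicone blk p H, S'.ProperIn S → ∀ N : Fin ℓ → ℕ, ∃ C : ℝ, ∀ z ∈ S'.carrier,
    ‖f z - app A blk σ F N z‖ ≤
      C * ∏ j, lev (blockNorms blk z) j ^ ((N j : ℝ) / (σ : ℝ))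

/-- `f_{J,α} = ∂^α f / ∂z^α |_{Z_J}` on `S_J`: for every multicone `S'` properly contained in `S`,
`f_{J,α}` is on `π_J(S')` the restriction of the continuous extension of `∂^α f` from `S'` to the
closure of `S'`. -/
def IsTaylorCoeff (A : Matrix (Fin ℓ) (Fin m) ℚ) (S : Multicone blk p H)
    (f : (Fin n → ℂ) → ℂ) (F : CoeffFamily n ℓ) (J : Finset (Fin ℓ)) (α : Fin n → ℕ) : Prop :=
  ∀ S' : Multicone blk p H, S'.ProperIn S →
    HasRestriction (iterPDeriv α f) S'.carrier (F J α) (proj A blk J '' S'.carrier)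

/-- The total family `F` is consistent: all derivatives of `f_{J,α}` along `Z_J` are bounded on
`S'_J = π_J(S')` for the multicones `S'` properly contained in `S`, and for `J ⊆ R` the function
`f_{R,α+β}` is the restriction `∂^β f_{J,α} / ∂z^β |_{Z_R}`. -/
def IsConsistent (A : Matrix (Fin ℓ) (Fin m) ℚ) (S : Multicone blk p H)
    (F : CoeffFamily n ℓ) : Prop :=
  (∀ J : Finset (Fin ℓ), J.Nonempty → ∀ α, Normal A blk J α → ∀ β, Tangential A blk J β →
    ∀ S' : Multicone blk p H, S'.ProperIn S →
      ∃ C : ℝ, ∀ z ∈ proj A blk J '' S'.carrier, ‖iterPDeriv β (F J α) z‖ ≤ C) ∧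
  (∀ J R : Finset (Fin ℓ), J.Nonempty → J ⊆ R → ∀ α, Normal A blk J α → ∀ β,
    Tangential A blk J β → Normal A blk R (α + β) →
    ∀ S' : Multicone blk p H, S'.ProperIn S →
      HasRestriction (iterPDeriv β (F J α)) (proj A blk J '' S'.carrier)
        (F R (α + β)) (proj A blk R '' S'.carrier))

end MultiAsymp

end

/-!
Why `f_{J,α}` is the boundary value of `∂^α f` on `Z_J`.

The level functions have three properties. They solve `φ_k(ρ_Λ(τ')) = ∏_{i ≤ L} τ_i ^ b_{ik}`, where
`b` expresses the columns of `A` by the first `L` columns (`prod_rhoPerm_rpow`); so every point `z` of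
a multicone is `μ(x, ρ_Λ(z))` with `x` in a compact set (`exists_normalizedSet`), and the polydiscs
about `z` with radii proportional to `φ_k(ρ_Λ(z))` stay in a slightly larger multicone
(`exists_polydisc_subset`). On these polydiscs the level functions grow by at most a
constant factor, and they are bounded on multicones (`exists_rhoPerm_le`,
`exists_rhoPerm_le_const`). Finally, for every `q` some admissible order `θ` of the actions gives a
level function with `ρ^θ_q(μ_q(z, t)) ≤ t ρ^θ_q(z)` (`exists_rhoPerm_muSingle_le`); as `ρ̂_q ≤ ρ^θ_q`,
this is the strictness of `μ_q`. All this rests on the Fourier–Motzkin elimination that defines the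
level functions: it preserves the cone generated by the monomials (`mem_monoCone_elimLam`), and the
monomials that occur have non-negative weights (`elimSeq_cases`).

Let `jet J α` be the value of `∂^α f` on `Z_J` that the coefficients predict, `jet ∅ α = ∂^α f`. If
`n_j = σ ∑_k a_{jk} |α⁽ᵏ⁾| + 1_{J₀}(j)`, then the terms of `App^{<N}` whose `α`-th derivative survives
are those with `J ⊆ J₀`, and `∂^α (f - App^{<N}) = ∑_{J ⊆ J₀} (-1)^{#J} jet J α`
(`iterPDeriv_sub_app`). Cauchy's inequalities on the polydiscs turn the asymptotic estimate into
`|∑_{J ⊆ J₀} (-1)^{#J} jet J α| ≤ C ∏_{j ∈ J₀} (ρ^θ_j)^{1/σ}` (`exists_norm_sum_jet_le`). By induction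
over `J` this gives `|jet J α - jet (J ∪ {q}) α| ≤ C (ρ^θ_q)^{1/σ}`, and the `jet J α` are bounded on
multicones properly contained in `S`.

If `π_J(z) ∈ Z_q`, then `μ_q` changes neither `jet J α` nor `jet (J ∪ {q}) α` at `z`, but it makes
`ρ^θ_q` tend to zero for a suitable `θ`; so the two jets agree at `z` (`jet_insert`). When points of
`S'` converge to a point `z₀`, compactness provides, along an ultrafilter, a set `J` of indices such
that `ρ_j → 0` for `j ∈ J` and `z₀ ∈ S_J` (`exists_proj_eq_of_tendsto`). Hence `∂^α f` tends to
`jet J α` at `z₀`, a value that depends only on `z₀` (`tendsto_iterPDeriv`). So `∂^α f` has a continuous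
extension to the closure of `S'`, with the values `jet J α` on `π_J(S')`; the formulas for the
coefficients, their uniqueness and the consistency of the family are properties of this extension.
-/

noncomputable section

namespace MultiAsymp

/-! ### Holomorphic functions of several variables -/

section Derivatives
variable {n : ℕ}

theorem pderiv_eq_fderiv {u : (Fin n → ℂ) → ℂ} {z : Fin n → ℂ} (h : DifferentiableAt ℂ u z)
    (i : Fin n) : pderiv i u z = fderiv ℂ u z (Pi.single i 1) :=
  h.lineDeriv_eq_fderiv

/-- The partial derivatives of a holomorphic function are holomorphic: near a point they are Cauchy
integrals, which can be differentiated under the integral sign. -/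
theorem differentiableOn_pderiv {u : (Fin n → ℂ) → ℂ} {Ω : Set (Fin n → ℂ)} (hΩ : IsOpen Ω)
    (hu : DifferentiableOn ℂ u Ω) (i : Fin n) : DifferentiableOn ℂ (pderiv i u) Ω := by
  intro z₀ hz₀
  refine DifferentiableAt.differentiableWithinAt ?_
  have hc : ContinuousAt u z₀ := (hu.differentiableAt (hΩ.mem_nhds hz₀)).continuousAt
  have hb : ∀ᶠ z in 𝓝 z₀, ‖u z‖ < ‖u z₀‖ + 1 :=
    hc.norm.eventually_lt continuousAt_const (by simp)
  obtain ⟨r, hr, hrb⟩ := Metric.eventually_nhds_iff_ball.1 (hb.and (hΩ.mem_nhds hz₀))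
  set M := ‖u z₀‖ + 1
  obtain ⟨R, hR, h4⟩ : ∃ R > 0, 4 * R ≤ r := ⟨r / 4, by positivity, by linarith⟩
  set e : Fin n → ℂ := Pi.single i 1
  have he : ‖e‖ = 1 := by rw [Pi.norm_single, norm_one]
  have hshift : ∀ z ∈ Metric.ball z₀ R, ∀ ζ : ℂ, ‖ζ‖ ≤ R → z + ζ • e ∈ Metric.ball z₀ (2 * R) := by
    intro z hz ζ hζ
    rw [Metric.mem_ball, dist_eq_norm] at hz ⊢
    calc ‖z + ζ • e - z₀‖ = ‖(z - z₀) + ζ • e‖ := by congr 1; abel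
      _ ≤ ‖z - z₀‖ + ‖ζ • e‖ := norm_add_le _ _
      _ < 2 * R := by rw [norm_smul, he]; linarith
  have hdiff : ∀ y ∈ Metric.ball z₀ (4 * R), DifferentiableAt ℂ u y := fun y hy =>
    hu.differentiableAt (hΩ.mem_nhds (hrb y (Metric.ball_subset_ball h4 hy)).2)
  have hbound : ∀ y ∈ Metric.ball z₀ (2 * R), ‖fderiv ℂ u y‖ ≤ 2 * M / R := by
    intro y hy
    have hsub : Metric.ball y R ⊆ Metric.ball z₀ (4 * R) := by
      refine Metric.ball_subset_ball' ?_
      rw [Metric.mem_ball] at hy; linarith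
    refine Complex.norm_fderiv_le_div_of_mapsTo_ball
      (fun x hx => (hdiff x (hsub hx)).differentiableWithinAt) ?_ hR
    intro x hx
    rw [mem_closedBall_iff_norm]
    have h1 := (hrb x (Metric.ball_subset_ball h4 (hsub hx))).1
    have h2 := (hrb y (Metric.ball_subset_ball h4 (hsub (Metric.mem_ball_self hR)))).1
    calc ‖u x - u y‖ ≤ ‖u x‖ + ‖u y‖ := norm_sub_le _ _
      _ ≤ 2 * M := by linarith
  set c : ℝ → ℂ := fun θ => deriv (circleMap 0 R) θ * ((circleMap 0 R θ - 0) ^ 2)⁻¹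
  have hcm : ∀ θ, ‖circleMap 0 R θ‖ ≤ R := fun θ => by simp [abs_of_pos hR]
  have hcc : Continuous c := by
    refine Continuous.mul ?_ (Continuous.inv₀ (by fun_prop) ?_)
    · have : deriv (circleMap 0 R) = fun θ => circleMap 0 R θ * Complex.I := by
        funext θ; rw [deriv_circleMap]
      rw [this]; fun_prop
    · intro θ; simp [circleMap_eq_center_iff, hR.ne']
  have hrep : ∀ z ∈ Metric.ball z₀ R, pderiv i u z =
      (2 * Real.pi * Complex.I : ℂ)⁻¹ * ∫ θ in (0 : ℝ)..2 * Real.pi, c θ * u (z + circleMap 0 R θ • e) := by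
    intro z hz
    have hd : DifferentiableOn ℂ (fun ζ : ℂ => u (z + ζ • e)) (Metric.closedBall 0 R) := by
      intro ζ hζ
      rw [mem_closedBall_zero_iff] at hζ
      have := hdiff _ (Metric.ball_subset_ball (by linarith) (hshift z hz ζ hζ))
      exact (this.comp ζ (f := fun ζ : ℂ => z + ζ • e) (by fun_prop)).differentiableWithinAt
    have := hd.deriv_eq_smul_circleIntegral (f := fun ζ : ℂ => u (z + ζ • e)) hR
    have h2 : (2 * Real.pi * Complex.I : ℂ) ≠ 0 := Complex.two_pi_I_ne_zero
    rw [pderiv, lineDeriv, ← inv_mul_eq_iff_eq_mul₀ h2 |>.2 this, circleIntegral]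
    congr 1
    refine intervalIntegral.integral_congr fun θ _ => ?_
    simp only [c, e, smul_eq_mul]
    ring
  have hmain : DifferentiableAt ℂ (fun z : Fin n → ℂ =>
      ∫ θ in (0 : ℝ)..2 * Real.pi, c θ * u (z + circleMap 0 R θ • e)) z₀ := by
    have hcont : ∀ z ∈ Metric.ball z₀ R, Continuous fun θ => c θ * u (z + circleMap 0 R θ • e) := by
      intro z hz
      refine hcc.mul (continuous_iff_continuousAt.2 fun θ => ?_)
      have h1 := (hdiff _ (Metric.ball_subset_ball (by linarith) (hshift z hz _ (hcm θ)))).continuousAt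
      exact ContinuousAt.comp (f := fun θ : ℝ => z + circleMap 0 R θ • e) h1 (by fun_prop)
    have hball : Metric.ball z₀ R ∈ 𝓝 z₀ := Metric.ball_mem_nhds _ hR
    have := intervalIntegral.hasFDerivAt_integral_of_dominated_of_fderiv_le (𝕜 := ℂ)
      (μ := MeasureTheory.volume) (a := 0) (b := 2 * Real.pi)
      (F := fun (z : Fin n → ℂ) (θ : ℝ) => c θ * u (z + circleMap 0 R θ • e))
      (F' := fun z θ => c θ • fderiv ℂ u (z + circleMap 0 R θ • e))
      (bound := fun θ => ‖c θ‖ * (2 * M / R)) hball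
      (Filter.mem_of_superset hball fun z hz => (hcont z hz).aestronglyMeasurable)
      ((hcont z₀ (Metric.mem_ball_self hR)).intervalIntegrable _ _)
      (by
        refine (hcc.aestronglyMeasurable).smul ?_
        refine Measurable.aestronglyMeasurable ?_
        exact (measurable_fderiv ℂ u).comp (by fun_prop : Continuous fun θ : ℝ =>
          z₀ + circleMap 0 R θ • e).measurable)
      (Filter.Eventually.of_forall fun θ _ z hz => by
        rw [norm_smul]
        exact mul_le_mul_of_nonneg_left (hbound _ (hshift z hz _ (hcm θ))) (norm_nonneg _))
      ((hcc.norm.mul continuous_const).intervalIntegrable _ _)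
      (Filter.Eventually.of_forall fun θ _ z hz => by
        have h1 := (hdiff _ (Metric.ball_subset_ball (by linarith)
          (hshift z hz _ (hcm θ)))).hasFDerivAt
        have h2 : HasFDerivAt (fun z : Fin n → ℂ => z + circleMap 0 R θ • e)
          (ContinuousLinearMap.id ℂ _) z := (hasFDerivAt_id z).add_const _
        exact (h1.comp z h2).const_mul (c θ))
    exact this.differentiableAt
  exact (hmain.const_mul _).congr_of_eventuallyEq
    (Filter.mem_of_superset (Metric.ball_mem_nhds _ hR) hrep)

theorem differentiableOn_iterate_pderiv {u : (Fin n → ℂ) → ℂ} {Ω : Set (Fin n → ℂ)}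
    (hΩ : IsOpen Ω) (hu : DifferentiableOn ℂ u Ω) (i : Fin n) (k : ℕ) :
    DifferentiableOn ℂ ((pderiv i)^[k] u) Ω := by
  induction k with
  | zero => exact hu
  | succ k ih => rw [Function.iterate_succ_apply']; exact differentiableOn_pderiv hΩ ih i

/-- The iterated partial derivative in which only the variables of a list are used, in the order
of the list; `iterPDeriv` is the case of the list of all variables. -/
def listPDeriv (l : List (Fin n)) (α : Fin n → ℕ) (g : (Fin n → ℂ) → ℂ) : (Fin n → ℂ) → ℂ :=
  l.foldr (fun i h => (pderiv i)^[α i] h) g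

theorem listPDeriv_cons (i : Fin n) (l : List (Fin n)) (α : Fin n → ℕ) (g : (Fin n → ℂ) → ℂ) :
    listPDeriv (i :: l) α g = (pderiv i)^[α i] (listPDeriv l α g) := rfl

theorem differentiableOn_listPDeriv {u : (Fin n → ℂ) → ℂ} {Ω : Set (Fin n → ℂ)}
    (hΩ : IsOpen Ω) (hu : DifferentiableOn ℂ u Ω) (l : List (Fin n)) (α : Fin n → ℕ) :
    DifferentiableOn ℂ (listPDeriv l α u) Ω := by
  induction l with
  | nil => exact hu
  | cons i l ih => exact differentiableOn_iterate_pderiv hΩ ih i _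

/-! ### Linearity -/

theorem eqOn_pderiv {u v : (Fin n → ℂ) → ℂ} {Ω : Set (Fin n → ℂ)} (hΩ : IsOpen Ω)
    (h : Set.EqOn u v Ω) (i : Fin n) : Set.EqOn (pderiv i u) (pderiv i v) Ω := by
  intro z hz
  exact (h.eventuallyEq_of_mem (hΩ.mem_nhds hz)).lineDeriv_eq

theorem eqOn_iterate_pderiv {u v : (Fin n → ℂ) → ℂ} {Ω : Set (Fin n → ℂ)} (hΩ : IsOpen Ω)
    (h : Set.EqOn u v Ω) (i : Fin n) (k : ℕ) :
    Set.EqOn ((pderiv i)^[k] u) ((pderiv i)^[k] v) Ω := by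
  induction k with
  | zero => exact h
  | succ k ih => simp only [Function.iterate_succ_apply']; exact eqOn_pderiv hΩ ih i

theorem listPDeriv_add_const_mul {u v : (Fin n → ℂ) → ℂ} {Ω : Set (Fin n → ℂ)} (hΩ : IsOpen Ω)
    (hu : DifferentiableOn ℂ u Ω) (hv : DifferentiableOn ℂ v Ω) (c : ℂ)
    (l : List (Fin n)) (α : Fin n → ℕ) :
    Set.EqOn (listPDeriv l α (fun z => u z + c * v z))
      (fun z => listPDeriv l α u z + c * listPDeriv l α v z) Ω := by
  have step : ∀ (i : Fin n) (k : ℕ) {u v : (Fin n → ℂ) → ℂ}, DifferentiableOn ℂ u Ω →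
      DifferentiableOn ℂ v Ω → Set.EqOn ((pderiv i)^[k] (fun z => u z + c * v z))
      (fun z => (pderiv i)^[k] u z + c * (pderiv i)^[k] v z) Ω := by
    intro i k u v hu hv
    induction k with
    | zero => intro z _; rfl
    | succ k ih =>
      simp only [Function.iterate_succ_apply']
      refine (eqOn_pderiv hΩ ih i).trans fun z hz => ?_
      have h1 := (differentiableOn_iterate_pderiv hΩ hu i k).differentiableAt (hΩ.mem_nhds hz)
      have h2 := (differentiableOn_iterate_pderiv hΩ hv i k).differentiableAt (hΩ.mem_nhds hz)
      have h3 : DifferentiableAt ℂ (fun z => (pderiv i)^[k] u z + c * (pderiv i)^[k] v z) z :=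
        h1.add (h2.const_mul c)
      rw [pderiv_eq_fderiv h1, pderiv_eq_fderiv h2, pderiv_eq_fderiv h3,
        fderiv_fun_add h1 (h2.const_mul c), fderiv_const_mul h2]
      rfl
  induction l with
  | nil => intro z _; rfl
  | cons i l ih =>
    exact (eqOn_iterate_pderiv hΩ ih i _).trans (step i _ (differentiableOn_listPDeriv hΩ hu l α)
      (differentiableOn_listPDeriv hΩ hv l α))

/-- Holomorphy is needed here, as the junk value of a derivative is not additive. -/
theorem iterPDeriv_add_sum {ι : Type*} (s : Finset ι) (c : ι → ℂ) {u : (Fin n → ℂ) → ℂ}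
    {v : ι → (Fin n → ℂ) → ℂ} {Ω : Set (Fin n → ℂ)} (hΩ : IsOpen Ω)
    (hu : DifferentiableOn ℂ u Ω) (hv : ∀ x ∈ s, DifferentiableOn ℂ (v x) Ω) (α : Fin n → ℕ) :
    Set.EqOn (iterPDeriv α (fun z => u z + ∑ x ∈ s, c x * v x z))
      (fun z => iterPDeriv α u z + ∑ x ∈ s, c x * iterPDeriv α (v x) z) Ω := by
  classical
  induction s using Finset.induction_on with
  | empty => intro z _; simp
  | insert a s ha ih =>
    have hv' : ∀ x ∈ s, DifferentiableOn ℂ (v x) Ω := fun x hx => hv x (Finset.mem_insert_of_mem hx)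
    have e : (fun z => u z + ∑ x ∈ insert a s, c x * v x z) =
        fun z => (u z + ∑ x ∈ s, c x * v x z) + c a * v a z := by
      funext z; rw [Finset.sum_insert ha]; ring
    rw [e]
    have hsum : DifferentiableOn ℂ (fun z => u z + ∑ x ∈ s, c x * v x z) Ω :=
      hu.add (DifferentiableOn.fun_sum fun x hx => (hv' x hx).const_mul _)
    refine (listPDeriv_add_const_mul hΩ hsum (hv a (Finset.mem_insert_self _ _)) (c a) _ α).trans ?_
    intro z hz
    have := ih hv' hz
    change iterPDeriv α _ z + c a * iterPDeriv α (v a) z = _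
    rw [this]
    simp only [Finset.sum_insert ha]
    ring

/-! ### Cauchy estimates -/

/-- The first derivatives are estimated on the concentric polydisc of half the size, so that the
estimate can be iterated. -/
theorem norm_pderiv_le {u : (Fin n → ℂ) → ℂ} {Ω : Set (Fin n → ℂ)} (hΩ : IsOpen Ω)
    (hu : DifferentiableOn ℂ u Ω) {z : Fin n → ℂ} {R : Fin n → ℝ} (hR : ∀ i, 0 < R i)
    (hsub : ∀ w : Fin n → ℂ, (∀ i, ‖w i - z i‖ ≤ R i) → w ∈ Ω) {M : ℝ}
    (hM : ∀ w : Fin n → ℂ, (∀ i, ‖w i - z i‖ ≤ R i) → ‖u w‖ ≤ M) (i : Fin n) {w : Fin n → ℂ}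
    (hw : ∀ j, ‖w j - z j‖ ≤ R j / 2) : ‖pderiv i u w‖ ≤ M / (R i / 2) := by
  have hin : ∀ ζ : ℂ, ‖ζ‖ ≤ R i / 2 → ∀ j, ‖(w + ζ • (Pi.single i 1 : Fin n → ℂ)) j - z j‖ ≤ R j := by
    intro ζ hζ j
    by_cases hj : j = i
    · subst hj
      have e : (w + ζ • (Pi.single j 1 : Fin n → ℂ)) j - z j = (w j - z j) + ζ := by simp; ring
      rw [e]
      have := hw j
      exact (norm_add_le _ _).trans (by linarith)
    · have e : (w + ζ • (Pi.single i 1 : Fin n → ℂ)) j - z j = w j - z j := by simp [hj]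
      rw [e]
      exact (hw j).trans (by linarith [hR j])
  refine Complex.norm_deriv_le_of_forall_mem_sphere_norm_le (half_pos (hR i)) ?_ ?_
  · have : DifferentiableOn ℂ (fun ζ : ℂ => u (w + ζ • (Pi.single i 1 : Fin n → ℂ)))
        (Metric.closedBall 0 (R i / 2)) := by
      intro ζ hζ
      rw [mem_closedBall_zero_iff] at hζ
      have h1 := hu.differentiableAt (hΩ.mem_nhds (hsub _ (hin ζ hζ)))
      exact (h1.comp ζ (f := fun ζ : ℂ => w + ζ • (Pi.single i 1 : Fin n → ℂ))
        (by fun_prop)).differentiableWithinAt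
    exact (this.mono Metric.closure_ball_subset_closedBall).diffContOnCl
  · intro ζ hζ
    rw [mem_sphere_zero_iff_norm] at hζ
    exact hM _ (hin ζ hζ.le)

/-- `κ` is the ratio of the sizes of the polydiscs; it depends only on the order of the derivative. -/
theorem exists_norm_iterate_pderiv_le (i : Fin n) (k : ℕ) : ∃ C κ : ℝ, 0 < C ∧ 0 < κ ∧ κ ≤ 1 ∧
    ∀ {u : (Fin n → ℂ) → ℂ} {Ω : Set (Fin n → ℂ)}, IsOpen Ω → DifferentiableOn ℂ u Ω →
    ∀ {z : Fin n → ℂ} {R : Fin n → ℝ}, (∀ i, 0 < R i) →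
    (∀ w : Fin n → ℂ, (∀ i, ‖w i - z i‖ ≤ R i) → w ∈ Ω) → ∀ {M : ℝ},
    (∀ w : Fin n → ℂ, (∀ i, ‖w i - z i‖ ≤ R i) → ‖u w‖ ≤ M) → ∀ w : Fin n → ℂ,
    (∀ j, ‖w j - z j‖ ≤ κ * R j) → ‖(pderiv i)^[k] u w‖ ≤ C * M / R i ^ k := by
  induction k with
  | zero =>
    refine ⟨1, 1, one_pos, one_pos, le_rfl, ?_⟩
    intro u Ω hΩ hu z R hR hsub M hM w hw
    simpa using hM w (by simpa using hw)
  | succ k ih =>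
    obtain ⟨C, κ, hC, hκ, hκ1, h⟩ := ih
    refine ⟨C * 2 / κ, κ / 2, by positivity, by positivity, by linarith, ?_⟩
    intro u Ω hΩ hu z R hR hsub M hM w hw
    rw [Function.iterate_succ_apply']
    have hle : ∀ j, κ * R j ≤ R j := fun j => by nlinarith [hR j]
    refine (norm_pderiv_le hΩ (differentiableOn_iterate_pderiv hΩ hu i k) (z := z)
      (R := fun j => κ * R j) (fun j => mul_pos hκ (hR j))
      (fun v hv => hsub v fun j => (hv j).trans (hle j))
      (fun v hv => h hΩ hu hR hsub hM v hv) i fun j => by have := hw j; linarith).trans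
      (le_of_eq ?_)
    have := (hR i).ne'
    field_simp
    ring

theorem exists_norm_listPDeriv_le (l : List (Fin n)) (α : Fin n → ℕ) : ∃ C κ : ℝ, 0 < C ∧ 0 < κ ∧
    κ ≤ 1 ∧ ∀ {u : (Fin n → ℂ) → ℂ} {Ω : Set (Fin n → ℂ)}, IsOpen Ω → DifferentiableOn ℂ u Ω →
    ∀ {z : Fin n → ℂ} {R : Fin n → ℝ}, (∀ i, 0 < R i) →
    (∀ w : Fin n → ℂ, (∀ i, ‖w i - z i‖ ≤ R i) → w ∈ Ω) → ∀ {M : ℝ},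
    (∀ w : Fin n → ℂ, (∀ i, ‖w i - z i‖ ≤ R i) → ‖u w‖ ≤ M) → ∀ w : Fin n → ℂ,
    (∀ j, ‖w j - z j‖ ≤ κ * R j) →
    ‖listPDeriv l α u w‖ ≤ C * M / (l.map fun i => R i ^ α i).prod := by
  induction l with
  | nil =>
    refine ⟨1, 1, one_pos, one_pos, le_rfl, ?_⟩
    intro u Ω hΩ hu z R hR hsub M hM w hw
    simpa [listPDeriv] using hM w (by simpa using hw)
  | cons i l ih =>
    obtain ⟨C, κ, hC, hκ, hκ1, h⟩ := ih
    obtain ⟨C', κ', hC', hκ', hκ1', h'⟩ := exists_norm_iterate_pderiv_le i (α i)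
    refine ⟨C' * C / κ ^ α i, κ' * κ, by positivity, by positivity,
      mul_le_one₀ hκ1' hκ.le hκ1, ?_⟩
    intro u Ω hΩ hu z R hR hsub M hM w hw
    have hle : ∀ j, κ * R j ≤ R j := fun j => by nlinarith [hR j]
    rw [listPDeriv_cons]
    refine (h' hΩ (differentiableOn_listPDeriv hΩ hu l α) (z := z) (R := fun j => κ * R j)
      (fun j => mul_pos hκ (hR j)) (fun v hv => hsub v fun j => (hv j).trans (hle j))
      (fun v hv => h hΩ hu hR hsub hM v hv) w fun j => by
        have := hw j; rw [mul_assoc] at this; exact this).trans (le_of_eq ?_)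
    have h1 := (hR i).ne'
    have h2 : (l.map fun i => R i ^ α i).prod ≠ 0 := by
      refine List.prod_ne_zero fun h0 => ?_
      obtain ⟨j, -, hj⟩ := List.mem_map.1 h0
      exact (pow_pos (hR j) _).ne' hj
    rw [List.map_cons, List.prod_cons, mul_pow]
    field_simp

/-- **Cauchy estimates** on polydiscs. -/
theorem exists_norm_iterPDeriv_le (α : Fin n → ℕ) : ∃ C : ℝ, 0 < C ∧
    ∀ {u : (Fin n → ℂ) → ℂ} {Ω : Set (Fin n → ℂ)}, IsOpen Ω → DifferentiableOn ℂ u Ω →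
    ∀ {z : Fin n → ℂ} {R : Fin n → ℝ}, (∀ i, 0 < R i) →
    (∀ w : Fin n → ℂ, (∀ i, ‖w i - z i‖ ≤ R i) → w ∈ Ω) → ∀ {M : ℝ},
    (∀ w : Fin n → ℂ, (∀ i, ‖w i - z i‖ ≤ R i) → ‖u w‖ ≤ M) →
    ‖iterPDeriv α u z‖ ≤ C * M / ∏ i, R i ^ α i := by
  obtain ⟨C, κ, hC, hκ, -, h⟩ := exists_norm_listPDeriv_le (List.finRange n) α
  refine ⟨C, hC, ?_⟩
  intro u Ω hΩ hu z R hR hsub M hM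
  rw [Fin.prod_univ_def]
  exact h hΩ hu hR hsub hM z fun j => by simpa using (mul_pos hκ (hR j)).le

end Derivatives

/-! ### Partial derivatives of monomials with coefficients -/

section Monomials
variable {n : ℕ}

/-- `G` does not depend on the variable `z_i`. -/
def IndepOf (i : Fin n) (G : (Fin n → ℂ) → ℂ) : Prop :=
  ∀ (z : Fin n → ℂ) (t : ℂ), G (z + t • Pi.single i 1) = G z

theorem IndepOf.pderiv {j : Fin n} {G : (Fin n → ℂ) → ℂ} (h : IndepOf j G) (i : Fin n) :
    IndepOf j (pderiv i G) := by
  intro z t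
  simp only [MultiAsymp.pderiv, lineDeriv]
  congr 1
  funext s
  rw [add_right_comm, h]

theorem IndepOf.iterate_pderiv {j : Fin n} {G : (Fin n → ℂ) → ℂ} (h : IndepOf j G) (i : Fin n)
    (k : ℕ) : IndepOf j ((MultiAsymp.pderiv i)^[k] G) := by
  induction k with
  | zero => exact h
  | succ k ih => rw [Function.iterate_succ_apply']; exact ih.pderiv i

theorem IndepOf.listPDeriv {j : Fin n} {G : (Fin n → ℂ) → ℂ} (h : IndepOf j G) (l : List (Fin n))
    (α : Fin n → ℕ) : IndepOf j (listPDeriv l α G) := by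
  induction l with
  | nil => exact h
  | cons i l ih => exact ih.iterate_pderiv i _

theorem pderiv_mul_of_indepOf_right {i : Fin n} {m : (Fin n → ℂ) → ℂ} (hm : IndepOf i m)
    (G : (Fin n → ℂ) → ℂ) : pderiv i (fun z => G z * m z) = fun z => pderiv i G z * m z := by
  funext z
  simp only [pderiv, lineDeriv, hm z]
  exact deriv_mul_const_field _

theorem iterate_pderiv_mul_of_indepOf_right {i : Fin n} {m : (Fin n → ℂ) → ℂ} (hm : IndepOf i m)
    (G : (Fin n → ℂ) → ℂ) (k : ℕ) :
    (pderiv i)^[k] (fun z => G z * m z) = fun z => (pderiv i)^[k] G z * m z := by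
  induction k with
  | zero => rfl
  | succ k ih => simp only [Function.iterate_succ_apply', ih, pderiv_mul_of_indepOf_right hm]

/-- The `a`-th derivative of `x ^ b / b!`. -/
def divPow (b a : ℕ) (x : ℂ) : ℂ := if a ≤ b then x ^ (b - a) / ((b - a).factorial : ℂ) else 0

theorem hasDerivAt_divPow (b a : ℕ) (x : ℂ) : HasDerivAt (divPow b a) (divPow b (a + 1) x) x := by
  unfold divPow
  by_cases h : a + 1 ≤ b
  · simp only [h, (Nat.le_succ a).trans h, if_true]
    obtain ⟨c, rfl⟩ := Nat.exists_eq_add_of_le h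
    have e1 : a + 1 + c - a = c + 1 := by omega
    have e2 : a + 1 + c - (a + 1) = c := by omega
    rw [e1, e2]
    have := (hasDerivAt_pow (c + 1) x).div_const ((c + 1).factorial : ℂ)
    have h1 : (c : ℂ) + 1 ≠ 0 := by exact_mod_cast c.succ_ne_zero
    have h2 : (c.factorial : ℂ) ≠ 0 := by exact_mod_cast c.factorial_ne_zero
    have e3 : ((c + 1 : ℕ) : ℂ) * x ^ (c + 1 - 1) / ((c + 1).factorial : ℂ) =
        x ^ c / (c.factorial : ℂ) := by
      rw [Nat.factorial_succ]
      push_cast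
      field_simp
    rwa [e3] at this
  · rw [if_neg h]
    by_cases h' : a ≤ b
    · have : b - a = 0 := by omega
      simp only [h', if_true, this, pow_zero]
      exact hasDerivAt_const _ _
    · simp only [h', if_false]
      exact hasDerivAt_const _ _

theorem iterate_pderiv_mul_divPow {i : Fin n} {G : (Fin n → ℂ) → ℂ} (hG : IndepOf i G)
    (β a : Fin n → ℕ) (k : ℕ) :
    (pderiv i)^[k] (fun z => G z * ∏ j, divPow (β j) (a j) (z j)) =
      fun z => G z * ∏ j, divPow (β j) ((a + Pi.single i k : Fin n → ℕ) j) (z j) := by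
  induction k with
  | zero => simp
  | succ k ih =>
    rw [Function.iterate_succ_apply', ih]
    funext z
    simp only [pderiv, lineDeriv, hG z]
    rw [deriv_const_mul_field]
    congr 1
    rw [← Finset.mul_prod_erase _ _ (Finset.mem_univ i)]
    have hprod : ∀ t : ℂ, ∏ j, divPow (β j) ((a + Pi.single i k : Fin n → ℕ) j)
        ((z + t • (Pi.single i 1 : Fin n → ℂ)) j) = divPow (β i) (a i + k) (z i + t) *
          ∏ j ∈ Finset.univ.erase i, divPow (β j) (a j) (z j) := by
      intro t
      rw [← Finset.mul_prod_erase _ _ (Finset.mem_univ i)]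
      congr 1
      · simp
      · refine Finset.prod_congr rfl fun j hj => ?_
        have := Finset.ne_of_mem_erase hj
        simp [this]
    have herase : ∏ j ∈ Finset.univ.erase i, divPow (β j) ((a + Pi.single i (k + 1) : Fin n → ℕ) j)
        (z j) = ∏ j ∈ Finset.univ.erase i, divPow (β j) (a j) (z j) := by
      refine Finset.prod_congr rfl fun j hj => ?_
      have := Finset.ne_of_mem_erase hj
      simp [this]
    simp only [hprod, herase]
    rw [deriv_mul_const_field]
    congr 1
    have := (hasDerivAt_divPow (β i) (a i + k) (z i + 0)).comp_const_add (z i) 0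
    rw [this.deriv]
    simp [add_assoc]

/-- `P` holds for the variables on which the coefficient `G` does not depend; the monomial contains
only these variables. As the variables are separated, no differentiability of `G` is needed. -/
theorem listPDeriv_mul_divPow (P : Fin n → Prop) [DecidablePred P] {G : (Fin n → ℂ) → ℂ}
    (hG : ∀ i, P i → IndepOf i G) (α β : Fin n → ℕ) (hβ : ∀ i, ¬ P i → β i = 0)
    (l : List (Fin n)) (hl : l.Nodup) :
    listPDeriv l α (fun z => G z * ∏ j, divPow (β j) 0 (z j)) = fun z =>
      listPDeriv l (fun i => if P i then 0 else α i) G z *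
        ∏ j, divPow (β j) (if j ∈ l ∧ P j then α j else 0) (z j) := by
  induction l with
  | nil => simp [listPDeriv]
  | cons i l ih =>
    obtain ⟨hi, hl⟩ := List.nodup_cons.1 hl
    rw [listPDeriv_cons, listPDeriv_cons, ih hl]
    by_cases hP : P i
    · rw [iterate_pderiv_mul_divPow ((hG i hP).listPDeriv l _) β
        (fun j => if j ∈ l ∧ P j then α j else 0)]
      funext z
      simp only [hP, if_true, Function.iterate_zero, id]
      congr 1
      refine Finset.prod_congr rfl fun j _ => ?_
      congr 1
      by_cases hj : j = i
      · subst hj; simp [hi, hP]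
      · simp [hj]
    · rw [iterate_pderiv_mul_of_indepOf_right]
      · funext z
        simp only [hP, if_false]
        congr 1
        refine Finset.prod_congr rfl fun j _ => ?_
        congr 1
        by_cases hj : j = i
        · subst hj; simp [hi, hP]
        · simp [hj]
      · intro z t
        refine Finset.prod_congr rfl fun j _ => ?_
        by_cases hj : j = i
        · subst hj; simp [hβ j hP, hP, divPow]
        · simp [hj]

section Projection

variable {m ℓ : ℕ} {A : Matrix (Fin ℓ) (Fin m) ℚ} {blk : Fin n → Fin (m + 1)}
  {J : Finset (Fin ℓ)}

open Classical in
/-- The part of a multi-index that belongs to the blocks `k ∈ K_J`. -/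
def norPart (A : Matrix (Fin ℓ) (Fin m) ℚ) (blk : Fin n → Fin (m + 1)) (J : Finset (Fin ℓ))
    (α : Fin n → ℕ) : Fin n → ℕ := fun i => if InK A blk J i then α i else 0

open Classical in
/-- The part of a multi-index that belongs to the blocks `k ∉ K_J`. -/
def tanPart (A : Matrix (Fin ℓ) (Fin m) ℚ) (blk : Fin n → Fin (m + 1)) (J : Finset (Fin ℓ))
    (α : Fin n → ℕ) : Fin n → ℕ := fun i => if InK A blk J i then 0 else α i

theorem normal_norPart (α : Fin n → ℕ) : Normal A blk J (norPart A blk J α) :=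
  fun i hi => by simp [norPart, hi]

theorem tangential_tanPart (α : Fin n → ℕ) : Tangential A blk J (tanPart A blk J α) :=
  fun i hi => by simp [tanPart, hi]

theorem norPart_add {α β : Fin n → ℕ} (hα : Normal A blk J α) (hβ : Tangential A blk J β) :
    norPart A blk J (α + β) = α := by
  funext i
  by_cases h : InK A blk J i
  · simp [norPart, h, hβ i h]
  · simp [norPart, h, hα i h]

theorem tanPart_add {α β : Fin n → ℕ} (hα : Normal A blk J α) (hβ : Tangential A blk J β) :
    tanPart A blk J (α + β) = β := by
  funext i
  by_cases h : InK A blk J i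
  · simp [tanPart, h, hβ i h]
  · simp [tanPart, h, hα i h]

theorem proj_add_smul_single_of_inK {i : Fin n} (hi : InK A blk J i) (z : Fin n → ℂ) (t : ℂ) :
    proj A blk J (z + t • Pi.single i 1) = proj A blk J z := by
  funext j
  by_cases hj : InK A blk J j
  · simp [proj, hj]
  · have : j ≠ i := by rintro rfl; exact hj hi
    simp [proj, hj, this]

theorem proj_add_smul_single_of_not_inK {i : Fin n} (hi : ¬ InK A blk J i) (z : Fin n → ℂ)
    (t : ℂ) : proj A blk J (z + t • Pi.single i 1) = proj A blk J z + t • Pi.single i 1 := by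
  funext j
  by_cases hj : InK A blk J j
  · have : j ≠ i := by rintro rfl; exact hi hj
    simp [proj, hj, this]
  · simp [proj, hj]

theorem indepOf_comp_proj (F : (Fin n → ℂ) → ℂ) {i : Fin n} (hi : InK A blk J i) :
    IndepOf i (fun z => F (proj A blk J z)) :=
  fun z t => congrArg F (proj_add_smul_single_of_inK hi z t)

/-- Derivatives along `Z_J` of a function on `Z_J` are derivatives of its pullback under `π_J`. -/
theorem listPDeriv_comp_proj (F : (Fin n → ℂ) → ℂ) {α : Fin n → ℕ} (hα : Tangential A blk J α)
    (l : List (Fin n)) : listPDeriv l α (fun z => F (proj A blk J z)) =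
      fun z => listPDeriv l α F (proj A blk J z) := by
  induction l with
  | nil => rfl
  | cons i l ih =>
    rw [listPDeriv_cons, listPDeriv_cons, ih]
    by_cases hi : InK A blk J i
    · simp [hα i hi]
    · generalize listPDeriv l α F = g
      induction α i with
      | zero => rfl
      | succ k ihk =>
        rw [Function.iterate_succ_apply', Function.iterate_succ_apply', ihk]
        funext z
        simp only [pderiv, lineDeriv, proj_add_smul_single_of_not_inK hi]

/-- The monomial `z^β / β!` with coefficient `F(π_J(z))`. -/
def coeffMonomial (A : Matrix (Fin ℓ) (Fin m) ℚ) (blk : Fin n → Fin (m + 1)) (J : Finset (Fin ℓ))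
    (F : (Fin n → ℂ) → ℂ) (β : Fin n → ℕ) (z : Fin n → ℂ) : ℂ :=
  F (proj A blk J z) / ((∏ i, (β i).factorial : ℕ) : ℂ) * ∏ i, z i ^ β i

/-- The part of `α` in the blocks of `K_J` is applied to the monomial, the other part to the
coefficient. -/
theorem iterPDeriv_coeffMonomial (F : (Fin n → ℂ) → ℂ) (α : Fin n → ℕ) {β : Fin n → ℕ}
    (hβ : Normal A blk J β) : iterPDeriv α (coeffMonomial A blk J F β) = fun z =>
      iterPDeriv (tanPart A blk J α) F (proj A blk J z) *
        ∏ i, divPow (β i) (norPart A blk J α i) (z i) := by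
  classical
  have e : coeffMonomial A blk J F β = fun z =>
      (fun z => F (proj A blk J z)) z * ∏ j, divPow (β j) 0 (z j) := by
    funext z
    simp only [coeffMonomial, divPow, Nat.zero_le, if_true, Nat.sub_zero, Finset.prod_div_distrib]
    push_cast
    ring
  rw [e]
  have h1 := listPDeriv_mul_divPow (InK A blk J) (fun i hi => indepOf_comp_proj F hi) α β hβ
    (List.finRange n) (List.nodup_finRange n)
  have h2 : (fun i => if InK A blk J i then 0 else α i) = tanPart A blk J α := by
    funext i; unfold tanPart; congr
  rw [h2, listPDeriv_comp_proj F (tangential_tanPart α)] at h1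
  refine h1.trans ?_
  funext z
  change _ = listPDeriv _ _ _ _ * _
  congr 1
  refine Finset.prod_congr rfl fun j _ => ?_
  congr 1
  simp only [List.mem_finRange, true_and, norPart]

theorem iterPDeriv_coeffMonomial_eq_zero (F : (Fin n → ℂ) → ℂ) {α β : Fin n → ℕ}
    (hβ : Normal A blk J β) {i : Fin n} (hi : InK A blk J i) (h : β i < α i) (z : Fin n → ℂ) :
    iterPDeriv α (coeffMonomial A blk J F β) z = 0 := by
  rw [iterPDeriv_coeffMonomial F α hβ]
  refine mul_eq_zero_of_right _ (Finset.prod_eq_zero (Finset.mem_univ i) ?_)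
  simp [divPow, norPart, hi, h]

theorem iterPDeriv_coeffMonomial_norPart (F : (Fin n → ℂ) → ℂ) (α : Fin n → ℕ) (z : Fin n → ℂ) :
    iterPDeriv α (coeffMonomial A blk J F (norPart A blk J α)) z =
      iterPDeriv (tanPart A blk J α) F (proj A blk J z) := by
  rw [iterPDeriv_coeffMonomial F α (normal_norPart α)]
  simp [divPow]

end Projection
end Monomials

/-! ### Exponents, weights and logarithms -/

section Linear
variable {m ℓ : ℕ}

/-- The logarithm of the value of a monomial, as a linear function of the exponents; `y` and `x`
are the logarithms of the values of the variables `τ` and `λ`. -/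
def logEval (y : Fin m → ℝ) (x : Fin ℓ → ℝ) : Expo m ℓ →ₗ[ℚ] ℝ where
  toFun e := (∑ k, (e.1 k : ℝ) * y k) + ∑ j, (e.2 j : ℝ) * x j
  map_add' e e' := by
    simp only [Prod.fst_add, Prod.snd_add, Pi.add_apply, Rat.cast_add, add_mul,
      Finset.sum_add_distrib]
    ring
  map_smul' c e := by
    simp only [Prod.smul_fst, Prod.smul_snd, Pi.smul_apply, smul_eq_mul, Rat.cast_mul, mul_assoc,
      ← Finset.mul_sum, RingHom.id_apply, Rat.smul_def, mul_add]

theorem logEval_apply (y : Fin m → ℝ) (x : Fin ℓ → ℝ) (e : Expo m ℓ) :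
    logEval y x e = (∑ k, (e.1 k : ℝ) * y k) + ∑ j, (e.2 j : ℝ) * x j := rfl

theorem Expo.eval_eq_exp {e : Expo m ℓ} {τ : Fin m → ℝ} {lam : Fin ℓ → ℝ}
    (hτ : ∀ k, 0 < τ k ∨ e.1 k = 0) (hlam : ∀ j, 0 < lam j) :
    e.eval τ lam = Real.exp (logEval (fun k => Real.log (τ k)) (fun j => Real.log (lam j)) e) := by
  rw [logEval_apply, Real.exp_add, Real.exp_sum, Real.exp_sum, Expo.eval]
  congr 1
  · refine Finset.prod_congr rfl fun k _ => ?_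
    rcases hτ k with h | h
    · rw [Real.rpow_def_of_pos h, mul_comm]
    · simp [h]
  · refine Finset.prod_congr rfl fun j _ => ?_
    rw [Real.rpow_def_of_pos (hlam j), mul_comm]

/-- The weight of a monomial under the `j`-th action, which multiplies `τ_k` by `t ^ a_{jk}` and
`λ_j` by `t`. -/
def weight (A : Matrix (Fin ℓ) (Fin m) ℚ) (j : Fin ℓ) : Expo m ℓ →ₗ[ℚ] ℚ where
  toFun e := (∑ k, A j k * e.1 k) + e.2 j
  map_add' e e' := by
    simp only [Prod.fst_add, Prod.snd_add, Pi.add_apply, mul_add, Finset.sum_add_distrib]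
    ring
  map_smul' c e := by
    simp only [Prod.smul_fst, Prod.smul_snd, Pi.smul_apply, smul_eq_mul, RingHom.id_apply, mul_add,
      Finset.mul_sum]
    congr 1
    exact Finset.sum_congr rfl fun k _ => by ring

theorem weight_apply (A : Matrix (Fin ℓ) (Fin m) ℚ) (j : Fin ℓ) (e : Expo m ℓ) :
    weight A j e = (∑ k, A j k * e.1 k) + e.2 j := rfl

theorem weight_tauE (A : Matrix (Fin ℓ) (Fin m) ℚ) (j : Fin ℓ) (k : Fin m) :
    weight A j (tauE k) = A j k := by
  simp [weight_apply, tauE, Pi.single_apply]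

theorem weight_lamE (A : Matrix (Fin ℓ) (Fin m) ℚ) (j i : Fin ℓ) :
    weight A j (lamE i) = if j = i then 1 else 0 := by
  simp [weight_apply, lamE, Pi.single_apply]

/-! ### Fourier–Motzkin elimination -/

/-- The convex cone that is generated by the monomials of a set of pairs. -/
def monoCone (B : Set (Weighted m ℓ)) : AddSubmonoid (Expo m ℓ) :=
  AddSubmonoid.closure {e | ∃ c : ℚ, 0 ≤ c ∧ ∃ p ∈ B, e = c • Multiplicative.toAdd p.1}

theorem smul_mem_monoCone {B : Set (Weighted m ℓ)} {p : Weighted m ℓ} (hp : p ∈ B) {c : ℚ}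
    (hc : 0 ≤ c) : c • Multiplicative.toAdd p.1 ∈ monoCone B :=
  AddSubmonoid.subset_closure ⟨c, hc, p, hp, rfl⟩

theorem smul_mem_monoCone_of_mem {B : Set (Weighted m ℓ)} {e : Expo m ℓ} (he : e ∈ monoCone B)
    {c : ℚ} (hc : 0 ≤ c) : c • e ∈ monoCone B := by
  induction he using AddSubmonoid.closure_induction with
  | mem x hx =>
    obtain ⟨d, hd, p, hp, rfl⟩ := hx
    rw [smul_smul]
    exact smul_mem_monoCone hp (mul_nonneg hc hd)
  | zero => rw [smul_zero]; exact zero_mem _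
  | add x y _ _ hx hy => rw [smul_add]; exact add_mem hx hy

theorem exists_coprime_mul_eq {x y : ℚ} (hx : 0 < x) (hy : 0 < y) :
    ∃ a b : ℕ, 0 < a ∧ 0 < b ∧ Nat.Coprime a b ∧ (a : ℚ) * x = b * y := by
  have hq : 0 < y / x := div_pos hy hx
  refine ⟨(y / x).num.natAbs, (y / x).den, ?_, (y / x).pos, (y / x).reduced, ?_⟩
  · exact Int.natAbs_pos.2 (Rat.num_pos.2 hq).ne'
  · have h1 : (((y / x).num.natAbs : ℕ) : ℚ) = (y / x).num := by
      rw [← Int.cast_natCast, Int.natAbs_of_nonneg (Rat.num_pos.2 hq).le]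
    rw [h1]
    have h2 : ((y / x).num : ℚ) = y / x * (y / x).den := (Rat.mul_den_eq_num _).symm
    rw [h2]
    field_simp

/-- The elimination produces, up to positive multiples, the combination of `f` and `g` in which
`λ_j` cancels. -/
theorem combine_mem_monoCone_elimLam {B : Set (Weighted m ℓ)} {j : Fin ℓ} {f g : Weighted m ℓ}
    (hf : f ∈ B) (hg : g ∈ B) (hfj : 0 < lamExp f j) (hgj : lamExp g j < 0) :
    (-lamExp g j) • Multiplicative.toAdd f.1 + lamExp f j • Multiplicative.toAdd g.1 ∈
      monoCone (elimLam j B) := by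
  obtain ⟨a, b, ha, hb, hab, h⟩ := exists_coprime_mul_eq (abs_pos.2 hfj.ne') (abs_pos.2 hgj.ne)
  have hmem : f ^ a * g ^ b ∈ elimLam j B := Or.inr ⟨f, hf, g, hg, a, b, hfj, hgj, hab, h, rfl⟩
  rw [abs_of_pos hfj, abs_of_neg hgj] at h
  have ha' : (0 : ℚ) < a := by exact_mod_cast ha
  have := smul_mem_monoCone hmem (c := -lamExp g j / a) (div_nonneg (by linarith) ha'.le)
  convert this using 1
  simp only [Prod.fst_mul, Prod.pow_fst, toAdd_mul, toAdd_pow, smul_add, ← Nat.cast_smul_eq_nsmul ℚ,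
    smul_smul]
  congr 2
  · field_simp
  · field_simp
    linarith

/-- **Fourier–Motzkin elimination**: the elements of the cone of `B` that do not contain `λ_j` are
in the cone of the set that is obtained by the elimination of `λ_j`. -/
theorem mem_monoCone_elimLam {B : Set (Weighted m ℓ)} {j : Fin ℓ} {e : Expo m ℓ}
    (he : e ∈ monoCone B) (hj : e.2 j = 0) : e ∈ monoCone (elimLam j B) := by
  set P := monoCone {p ∈ B | 0 < lamExp p j}
  set Q := monoCone {p ∈ B | lamExp p j < 0}
  set Z := monoCone (elimLam j B)
  have hdec : ∃ z ∈ Z, ∃ u ∈ P, ∃ v ∈ Q, e = z + (u + v) := by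
    clear hj
    induction he using AddSubmonoid.closure_induction with
    | mem x hx =>
      obtain ⟨c, hc, p, hp, rfl⟩ := hx
      rcases lt_trichotomy (lamExp p j) 0 with h | h | h
      · exact ⟨0, zero_mem _, 0, zero_mem _, _,
          smul_mem_monoCone (B := {p ∈ B | lamExp p j < 0}) ⟨hp, h⟩ hc, by simp⟩
      · exact ⟨_, smul_mem_monoCone (Or.inl ⟨hp, h⟩) hc, 0, zero_mem _, 0, zero_mem _, by simp⟩
      · exact ⟨0, zero_mem _, _,
          smul_mem_monoCone (B := {p ∈ B | 0 < lamExp p j}) ⟨hp, h⟩ hc, 0, zero_mem _, by simp⟩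
    | zero => exact ⟨0, zero_mem _, 0, zero_mem _, 0, zero_mem _, by simp⟩
    | add x y _ _ hx hy =>
      obtain ⟨z, hz, u, hu, v, hv, rfl⟩ := hx
      obtain ⟨z', hz', u', hu', v', hv', rfl⟩ := hy
      exact ⟨_, add_mem hz hz', _, add_mem hu hu', _, add_mem hv hv', by abel⟩
  obtain ⟨z, hz, u, hu, v, hv, rfl⟩ := hdec
  clear he
  have hu0 : 0 ≤ u.2 j ∧ (u.2 j = 0 → u = 0) := by
    clear hj
    induction hu using AddSubmonoid.closure_induction with
    | mem x hx =>
      obtain ⟨c, hc, p, ⟨-, hp⟩, rfl⟩ := hx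
      change 0 ≤ c * lamExp p j ∧ (c * lamExp p j = 0 → _)
      refine ⟨mul_nonneg hc hp.le, fun h => ?_⟩
      rw [(mul_eq_zero.1 h).resolve_right hp.ne', zero_smul]
    | zero => simp
    | add x y _ _ hx hy =>
      refine ⟨add_nonneg hx.1 hy.1, fun h => ?_⟩
      have h' : x.2 j + y.2 j = 0 := h
      rw [hx.2 (by linarith [hx.1, hy.1]), hy.2 (by linarith [hx.1, hy.1]), add_zero]
  have hv0 : v.2 j ≤ 0 ∧ (v.2 j = 0 → v = 0) := by
    clear hj
    induction hv using AddSubmonoid.closure_induction with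
    | mem x hx =>
      obtain ⟨c, hc, p, ⟨-, hp⟩, rfl⟩ := hx
      change c * lamExp p j ≤ 0 ∧ (c * lamExp p j = 0 → _)
      refine ⟨mul_nonpos_of_nonneg_of_nonpos hc hp.le, fun h => ?_⟩
      rw [(mul_eq_zero.1 h).resolve_right hp.ne, zero_smul]
    | zero => simp
    | add x y _ _ hx hy =>
      refine ⟨add_nonpos hx.1 hy.1, fun h => ?_⟩
      have h' : x.2 j + y.2 j = 0 := h
      rw [hx.2 (by linarith [hx.1, hy.1]), hy.2 (by linarith [hx.1, hy.1]), add_zero]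
  -- the bilinear combination of `u` and `v` without `λ_j`
  have huv : (-v.2 j) • u + u.2 j • v ∈ Z := by
    clear hj hu0 hv0
    induction hu using AddSubmonoid.closure_induction with
    | mem x hx =>
      obtain ⟨c, hc, p, ⟨hpB, hp⟩, rfl⟩ := hx
      induction hv using AddSubmonoid.closure_induction with
      | mem y hy =>
        obtain ⟨d, hd, q, ⟨hqB, hq⟩, rfl⟩ := hy
        have := smul_mem_monoCone_of_mem (combine_mem_monoCone_elimLam hpB hqB hp hq)
          (mul_nonneg hc hd)
        convert this using 1
        change (-(d * lamExp q j)) • c • Multiplicative.toAdd p.1 +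
          (c * lamExp p j) • d • Multiplicative.toAdd q.1 = _
        simp only [smul_smul, smul_add]
        congr 2 <;> ring
      | zero => simp
      | add x y _ _ hx hy =>
        convert add_mem hx hy using 1
        simp only [Prod.snd_add, Pi.add_apply, neg_add, add_smul, smul_add]
        abel
    | zero => simp
    | add x y _ _ hx hy =>
      convert add_mem hx hy using 1
      simp only [Prod.snd_add, Pi.add_apply, add_smul, smul_add]
      abel
  refine add_mem hz ?_
  have hz0 : z.2 j = 0 := by
    clear huv hu0 hv0 hj
    induction hz using AddSubmonoid.closure_induction with
    | mem x hx =>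
      obtain ⟨c, hc, p, hp, rfl⟩ := hx
      change c * lamExp p j = 0
      rcases hp with ⟨-, hp⟩ | ⟨f, -, g, -, a, b, hf, hg, -, h, rfl⟩
      · rw [hp, mul_zero]
      · rw [abs_of_pos hf, abs_of_neg hg] at h
        have : lamExp (f ^ a * g ^ b) j = a * lamExp f j + b * lamExp g j := by
          simp [lamExp]
        rw [this, h]; ring
    | zero => rfl
    | add x y _ _ hx hy =>
      change x.2 j + y.2 j = 0
      rw [hx, hy, add_zero]
  have hsum : u.2 j + v.2 j = 0 := by
    have h1 : z.2 j + (u.2 j + v.2 j) = 0 := hj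
    linarith
  rcases hu0.1.eq_or_lt with h | h
  · rw [hu0.2 h.symm, hv0.2 (by linarith), add_zero]
    exact zero_mem _
  · have h1 : -v.2 j = u.2 j := by linarith
    rw [h1, ← smul_add] at huv
    have := smul_mem_monoCone_of_mem huv (inv_nonneg.2 hu0.1)
    rwa [smul_smul, inv_mul_cancel₀ h.ne', one_smul] at this

theorem finite_elimLam {B : Set (Weighted m ℓ)} (hB : B.Finite) (j : Fin ℓ) :
    (elimLam j B).Finite := by
  refine (hB.subset fun p hp => hp.1).union ?_
  -- the coprime exponents `a, b` are determined by `f, g`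
  have huniq : ∀ f g : Weighted m ℓ, {p | ∃ a b : ℕ, 0 < lamExp f j ∧ lamExp g j < 0 ∧
      Nat.Coprime a b ∧ (a : ℚ) * |lamExp f j| = (b : ℚ) * |lamExp g j| ∧
      p = f ^ a * g ^ b}.Finite := by
    intro f g
    refine Set.Subsingleton.finite ?_
    rintro p ⟨a, b, hf, hg, hab, h, rfl⟩ q ⟨a', b', -, -, hab', h', rfl⟩
    have hx := abs_pos.2 hf.ne'
    have hy := abs_pos.2 hg.ne
    have hcross : a * b' = a' * b := by
      have : (a : ℚ) * b' * (|lamExp f j| * |lamExp g j|) =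
          a' * b * (|lamExp f j| * |lamExp g j|) := by
        calc (a : ℚ) * b' * (|lamExp f j| * |lamExp g j|)
            = (a * |lamExp f j|) * (b' * |lamExp g j|) := by ring
          _ = (b * |lamExp g j|) * (a' * |lamExp f j|) := by rw [h, ← h']
          _ = _ := by ring
      exact_mod_cast mul_right_cancel₀ (mul_pos hx hy).ne' this
    have e1 : a = a' := Nat.dvd_antisymm
      (hab.dvd_of_dvd_mul_right (Dvd.intro _ hcross))
      (hab'.dvd_of_dvd_mul_right (Dvd.intro _ hcross.symm))
    have e2 : b = b' := Nat.dvd_antisymm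
      (hab.symm.dvd_of_dvd_mul_left (Dvd.intro_left a' (by rw [← hcross])))
      (hab'.symm.dvd_of_dvd_mul_left (Dvd.intro_left a (by rw [hcross])))
    rw [e1, e2]
  refine (hB.biUnion fun f _ => hB.biUnion fun g _ => huniq f g).subset ?_
  rintro p ⟨f, hf, g, hg, a, b, h⟩
  exact Set.mem_biUnion hf (Set.mem_biUnion hg ⟨a, b, h⟩)

end Linear

/-! ### The elimination for a matrix of actions -/

section Levels
variable {L r s : ℕ}

/-- Non-negative matrices without zero rows whose leading submatrix is invertible and whose columns
are the linear combinations, with coefficients `b`, of the first `L` columns. -/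
structure IsLevelMatrix (A : Matrix (Fin (L + r)) (Fin (L + s)) ℚ) (b : Fin L → Fin (L + s) → ℚ) :
    Prop where
  nonneg : ∀ j k, 0 ≤ A j k
  row : ∀ j, ∃ k, A j k ≠ 0
  det : (leading A).det ≠ 0
  col : ∀ j k, A j k = ∑ i, A j (Fin.castAdd s i) * b i k

theorem exists_isLevelMatrix {A : Matrix (Fin (L + r)) (Fin (L + s)) ℚ} (h0 : ∀ j k, 0 ≤ A j k)
    (hrow : ∀ j, ∃ k, A j k ≠ 0) (hrank : A.rank = L) (hdet : (leading A).det ≠ 0) :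
    ∃ b, IsLevelMatrix A b := by
  have hli : LinearIndependent ℚ (fun i : Fin L => A.col (Fin.castAdd s i)) := by
    have h1 : LinearIndependent ℚ (leading A).col := by
      rw [Matrix.linearIndependent_cols_iff_isUnit, Matrix.isUnit_iff_isUnit_det]
      exact hdet.isUnit
    refine LinearIndependent.of_comp (LinearMap.funLeft ℚ ℚ (Fin.castAdd r)) ?_
    exact h1
  have hspan : Submodule.span ℚ (Set.range fun i : Fin L => A.col (Fin.castAdd s i)) =
      Submodule.span ℚ (Set.range A.col) := by
    refine Submodule.eq_of_le_of_finrank_eq (Submodule.span_mono ?_) ?_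
    · rintro _ ⟨i, rfl⟩; exact ⟨_, rfl⟩
    · rw [finrank_span_eq_card hli, Fintype.card_fin, ← Matrix.rank_eq_finrank_span_cols, hrank]
  have hmem : ∀ k, ∃ c : Fin L → ℚ, ∑ i, c i • A.col (Fin.castAdd s i) = A.col k := by
    intro k
    have : A.col k ∈ Submodule.span ℚ (Set.range fun i : Fin L => A.col (Fin.castAdd s i)) := by
      rw [hspan]; exact Submodule.subset_span ⟨k, rfl⟩
    exact (Submodule.mem_span_range_iff_exists_fun ℚ).1 this
  choose c hc using hmem
  refine ⟨fun i k => c k i, h0, hrow, hdet, fun j k => ?_⟩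
  have := congrFun (hc k) j
  simp only [Finset.sum_apply, Pi.smul_apply, smul_eq_mul, Matrix.col_apply] at this
  rw [← this]
  exact Finset.sum_congr rfl fun i _ => mul_comm _ _

variable {A : Matrix (Fin (L + r)) (Fin (L + s)) ℚ} {b : Fin L → Fin (L + s) → ℚ}

/-- The coefficients `b` do not depend on the order of the rows. -/
theorem IsLevelMatrix.perm (h : IsLevelMatrix A b) {θ : Equiv.Perm (Fin (L + r))}
    (hθ : Admissible A θ) : IsLevelMatrix (A.submatrix θ id) b where
  nonneg j k := h.nonneg _ _
  row j := h.row _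
  col j k := h.col _ _
  det := by
    have h1 : LinearIndependent ℚ (leading (A.submatrix θ id)).row := by
      rw [Fintype.linearIndependent_iff]
      intro g hg
      refine Fintype.linearIndependent_iff.1 hθ g ?_
      funext k
      have hg' : ∀ i' : Fin L, ∑ i, g i * A (θ (Fin.castAdd r i)) (Fin.castAdd s i') = 0 := by
        intro i'
        have := congrFun hg i'
        simpa [leading, Matrix.row] using this
      simp only [Finset.sum_apply, Pi.smul_apply, smul_eq_mul, Pi.zero_apply]
      calc ∑ i, g i * A (θ (Fin.castAdd r i)) k
          = ∑ i, ∑ i', g i * A (θ (Fin.castAdd r i)) (Fin.castAdd s i') * b i' k := by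
            refine Finset.sum_congr rfl fun i _ => ?_
            rw [h.col, Finset.mul_sum]
            exact Finset.sum_congr rfl fun i' _ => by ring
        _ = ∑ i', (∑ i, g i * A (θ (Fin.castAdd r i)) (Fin.castAdd s i')) * b i' k := by
            rw [Finset.sum_comm]
            exact Finset.sum_congr rfl fun i' _ => by rw [Finset.sum_mul]
        _ = 0 := by simp [hg']
    rw [Matrix.linearIndependent_rows_iff_isUnit, Matrix.isUnit_iff_isUnit_det] at h1
    exact h1.ne_zero

/-- A row is determined by its first `L` entries, so these do not all vanish. -/
theorem IsLevelMatrix.exists_pos (h : IsLevelMatrix A b) (j : Fin (L + r)) :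
    ∃ i : Fin L, 0 < A j (Fin.castAdd s i) := by
  by_contra! hcon
  obtain ⟨k, hk⟩ := h.row j
  refine hk ?_
  rw [h.col]
  refine Finset.sum_eq_zero fun i _ => ?_
  rw [le_antisymm (hcon i) (h.nonneg _ _), zero_mul]

/-- The monomials `φ_i⁻¹` (`i ≤ L`) and `λ_j` (`j > L`). -/
def genE (A : Matrix (Fin (L + r)) (Fin (L + s)) ℚ) : Fin (L + r) → Expo (L + s) (L + r) :=
  Fin.addCases (phiInv A) (fun t => lamE (Fin.natAdd L t))

theorem genE_castAdd (i : Fin L) : genE A (Fin.castAdd r i) = phiInv A i := by simp [genE]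

theorem genE_natAdd (t : Fin r) : genE A (Fin.natAdd L t) = lamE (Fin.natAdd L t) := by
  simp [genE]

theorem weight_phiInv (h : IsLevelMatrix A b) (j : Fin (L + r)) (i : Fin L) :
    weight A j (phiInv A i) = if j = Fin.castAdd r i then 1 else 0 := by
  have hmul : leading A * (leading A)⁻¹ = 1 := Matrix.mul_nonsing_inv _ h.det.isUnit
  simp only [phiInv, map_sum, map_smul, map_sub, weight_tauE, weight_lamE, smul_eq_mul]
  refine Fin.addCases (fun j' => ?_) (fun t => ?_) j
  · have hz : ∀ t : Fin r, (Fin.castAdd r j' = Fin.natAdd L t) = False := fun t => by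
      simp only [eq_iff_iff, iff_false]
      intro h'; have := congrArg Fin.val h'; simp at this; omega
    simp only [hz, if_false, mul_zero, Finset.sum_const_zero, sub_zero]
    have := congrFun (congrFun hmul j') i
    rw [Matrix.mul_apply, Matrix.one_apply] at this
    simp only [Fin.castAdd_inj]
    rw [← this]
    exact Finset.sum_congr rfl fun k _ => mul_comm _ _
  · have hz : (Fin.natAdd L t = Fin.castAdd r i) = False := by
      simp only [eq_iff_iff, iff_false]
      intro h'; have := congrArg Fin.val h'; simp at this; omega
    rw [if_neg (by rw [hz]; exact id)]
    refine Finset.sum_eq_zero fun k _ => ?_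
    simp

/-- The weights are the coordinates dual to the monomials `φ_i⁻¹`, `λ_j`. -/
theorem weight_genE (h : IsLevelMatrix A b) (j i : Fin (L + r)) :
    weight A j (genE A i) = if j = i then 1 else 0 := by
  refine Fin.addCases (fun i' => ?_) (fun t => ?_) i
  · rw [genE_castAdd, weight_phiInv h]
  · rw [genE_natAdd, weight_lamE]

theorem sum_smul_genE_castAdd (h : IsLevelMatrix A b) (k : Fin L) :
    ∑ j, A j (Fin.castAdd s k) • genE A j = tauE (Fin.castAdd s k) := by
  have hmul : (leading A)⁻¹ * leading A = 1 := Matrix.nonsing_inv_mul _ h.det.isUnit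
  have hentry : ∀ k' : Fin L, ∑ i : Fin L, A (Fin.castAdd r i) (Fin.castAdd s k) *
      (leading A)⁻¹ k' i = if k' = k then 1 else 0 := by
    intro k'
    have := congrFun (congrFun hmul k') k
    rw [Matrix.mul_apply, Matrix.one_apply] at this
    rw [← this]
    exact Finset.sum_congr rfl fun i _ => mul_comm _ _
  rw [Fin.sum_univ_add]
  simp only [genE_castAdd, genE_natAdd, phiInv, Finset.smul_sum, smul_smul]
  rw [Finset.sum_comm]
  simp only [← Finset.sum_smul, hentry, ite_smul, one_smul, zero_smul, Finset.sum_ite_eq',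
    Finset.mem_univ, if_true]
  abel

theorem sum_smul_genE (h : IsLevelMatrix A b) (k : Fin (L + s)) :
    ∑ j, A j k • genE A j = ∑ i, b i k • tauE (Fin.castAdd s i) := by
  simp only [← sum_smul_genE_castAdd h, Finset.smul_sum, smul_smul]
  rw [Finset.sum_comm]
  refine Finset.sum_congr rfl fun j _ => ?_
  rw [← Finset.sum_smul, h.col]
  congr 1
  exact Finset.sum_congr rfl fun i _ => mul_comm _ _

theorem psi_eq_sub_sum_genE (k : Fin s) :
    psi A k = tauE (Fin.natAdd L k) - ∑ j, A j (Fin.natAdd L k) • genE A j := by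
  rw [psi, Fin.sum_univ_add]
  simp only [genE_castAdd, genE_natAdd]

theorem psi_eq (h : IsLevelMatrix A b) (k : Fin s) :
    psi A k = tauE (Fin.natAdd L k) - ∑ i, b i (Fin.natAdd L k) • tauE (Fin.castAdd s i) := by
  rw [psi_eq_sub_sum_genE, sum_smul_genE h]

theorem b_castAdd (h : IsLevelMatrix A b) (i k : Fin L) :
    b i (Fin.castAdd s k) = if i = k then 1 else 0 := by
  have h1 := (sum_smul_genE h (Fin.castAdd s k)).symm.trans (sum_smul_genE_castAdd h k)
  have h2 := congrFun (congrArg Prod.fst h1) (Fin.castAdd s i)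
  simpa [tauE, Prod.fst_sum, Pi.single_apply] using h2

theorem psi_snd (h : IsLevelMatrix A b) (k : Fin s) : (psi A k).2 = 0 := by
  rw [psi_eq h]; simp [tauE, Prod.snd_sum]

theorem weight_psi (h : IsLevelMatrix A b) (k : Fin s) (j : Fin (L + r)) :
    weight A j (psi A k) = 0 := by
  rw [psi_eq_sub_sum_genE, map_sub, map_sum, weight_tauE]
  simp [weight_genE h]

theorem genE_snd_castAdd (j : Fin (L + r)) (i : Fin L) : (genE A j).2 (Fin.castAdd r i) = 0 := by
  have hne : ∀ t : Fin r, Fin.castAdd r i ≠ Fin.natAdd L t := fun t h' => by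
    have := congrArg Fin.val h'; simp at this; omega
  refine Fin.addCases (fun j' => ?_) (fun t => ?_) j
  · rw [genE_castAdd]
    simp [phiInv, tauE, lamE, Prod.snd_sum, hne]
  · rw [genE_natAdd]
    simp [lamE, hne]

theorem genE_fst_natAdd (j : Fin (L + r)) (k : Fin s) : (genE A j).1 (Fin.natAdd L k) = 0 := by
  have hne : ∀ t : Fin L, Fin.natAdd L k ≠ Fin.castAdd s t := fun t h' => by
    have := congrArg Fin.val h'; simp at this; omega
  refine Fin.addCases (fun j' => ?_) (fun t => ?_) j
  · rw [genE_castAdd]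
    simp [phiInv, tauE, lamE, Prod.fst_sum, hne]
  · rw [genE_natAdd]
    simp [lamE]

/-- Products of the monomials `φ_i⁻¹` and `λ_j` with non-negative exponents. The exponents are the
weights of the monomial. -/
def IsPure (A : Matrix (Fin (L + r)) (Fin (L + s)) ℚ) (e : Expo (L + s) (L + r)) : Prop :=
  (∀ j, 0 ≤ weight A j e) ∧ e = ∑ j, weight A j e • genE A j

theorem isPure_genE (h : IsLevelMatrix A b) (i : Fin (L + r)) : IsPure A (genE A i) := by
  constructor
  · intro j; rw [weight_genE h]; split_ifs <;> norm_num
  · simp [weight_genE h]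

theorem IsPure.add {e e' : Expo (L + s) (L + r)} (h : IsPure A e) (h' : IsPure A e') :
    IsPure A (e + e') := by
  refine ⟨fun j => by rw [map_add]; exact add_nonneg (h.1 j) (h'.1 j), ?_⟩
  simp only [map_add, add_smul, Finset.sum_add_distrib]
  rw [← h.2, ← h'.2]

theorem IsPure.smul {e : Expo (L + s) (L + r)} (h : IsPure A e) {c : ℚ} (hc : 0 ≤ c) :
    IsPure A (c • e) := by
  refine ⟨fun j => by rw [map_smul]; exact mul_nonneg hc (h.1 j), ?_⟩
  simp only [map_smul, smul_eq_mul, mul_smul, ← Finset.smul_sum]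
  rw [← h.2]

theorem IsPure.snd_castAdd {e : Expo (L + s) (L + r)} (h : IsPure A e) (i : Fin L) :
    e.2 (Fin.castAdd r i) = 0 := by
  rw [h.2]; simp [Prod.snd_sum, genE_snd_castAdd]

theorem IsPure.fst_natAdd {e : Expo (L + s) (L + r)} (h : IsPure A e) (k : Fin s) :
    e.1 (Fin.natAdd L k) = 0 := by
  rw [h.2]; simp [Prod.fst_sum, genE_fst_natAdd]

variable {w : Fin (L + s) → ℝ}

theorem elimSeq_succ {t : ℕ} (ht : t < r) :
    elimSeq A w (t + 1) = elimLam (Fin.natAdd L ⟨t, ht⟩) (elimSeq A w t) := by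
  rw [elimSeq, dif_pos ht]

theorem finite_elimSeq (t : ℕ) : (elimSeq A w t).Finite := by
  induction t with
  | zero =>
    have h0 : (Set.range (fun i : Fin L => mkPair (phiInv A i) 0) ∪
      Set.range (fun k : Fin s =>
        mkPair (psi A k) (Real.toNNReal ((psi A k).eval w (fun _ => 1)))) ∪
      Set.range (fun t : Fin r => mkPair (lamE (Fin.natAdd L t)) 0)).Finite :=
      ((Set.finite_range _).union (Set.finite_range _)).union (Set.finite_range _)
    refine h0.union ((h0.image fun q => q⁻¹).subset ?_)
    rintro p ⟨q, hq, -, rfl⟩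
    exact ⟨q, hq, rfl⟩
  | succ t ih =>
    by_cases ht : t < r
    · rw [elimSeq_succ ht]; exact finite_elimLam ih _
    · rw [elimSeq, dif_neg ht]; exact ih

theorem mem_elimSeq_zero {p : Weighted (L + s) (L + r)}
    (hp : p ∈ elimSeq A w 0) :
    (∃ j, p = mkPair (genE A j) 0) ∨
    (∃ k, p = mkPair (psi A k) (Real.toNNReal ((psi A k).eval w (fun _ => 1)))) ∨
    ∃ k, 0 < (psi A k).eval w (fun _ => 1) ∧
      p = (mkPair (psi A k) (Real.toNNReal ((psi A k).eval w (fun _ => 1))))⁻¹ := by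
  rcases hp with ((⟨i, rfl⟩ | ⟨k, rfl⟩) | ⟨t, rfl⟩) | ⟨q, ((⟨i, rfl⟩ | ⟨k, rfl⟩) | ⟨t, rfl⟩), hq, rfl⟩
  · exact Or.inl ⟨_, by rw [genE_castAdd]⟩
  · exact Or.inr (Or.inl ⟨k, rfl⟩)
  · exact Or.inl ⟨_, by rw [genE_natAdd]⟩
  · exact absurd rfl hq
  · refine Or.inr (Or.inr ⟨k, ?_, rfl⟩)
    exact Real.toNNReal_pos.1 (pos_iff_ne_zero.2 hq)
  · exact absurd rfl hq

theorem mkPair_genE_mem (j : Fin (L + r)) : mkPair (genE A j) 0 ∈ elimSeq A w 0 := by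
  refine Fin.addCases (fun i => ?_) (fun t => ?_) j
  · rw [genE_castAdd]; exact Or.inl (Or.inl (Or.inl ⟨i, rfl⟩))
  · rw [genE_natAdd]; exact Or.inl (Or.inr ⟨t, rfl⟩)

/-- The elements of the sets `F^{0, L + t}` are products of the `φ_i⁻¹` and `λ_j` without
`λ_{L+1}, …, λ_{L+t}`, or they are among the `ψ_k` and their inverses, which contain no `λ` at all and
never take part in the elimination. -/
theorem elimSeq_cases (h : IsLevelMatrix A b) {t : ℕ} (ht : t ≤ r) {p : Weighted (L + s) (L + r)}
    (hp : p ∈ elimSeq A w t) :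
    (IsPure A (Multiplicative.toAdd p.1) ∧
      ∀ u : Fin r, (u : ℕ) < t → lamExp p (Fin.natAdd L u) = 0) ∨ lamExp p = 0 := by
  induction t generalizing p with
  | zero =>
    rcases mem_elimSeq_zero hp with ⟨j, rfl⟩ | ⟨k, rfl⟩ | ⟨k, -, rfl⟩
    · exact Or.inl ⟨isPure_genE h j, fun u hu => absurd hu (Nat.not_lt_zero _)⟩
    · exact Or.inr (psi_snd h k)
    · refine Or.inr ?_
      change (-(psi A k)).2 = 0
      rw [Prod.snd_neg, psi_snd h, neg_zero]
  | succ t ih =>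
    rw [elimSeq_succ ht] at hp
    have key : ∀ {q : Weighted (L + s) (L + r)}, (∀ u : Fin r, (u : ℕ) < t → lamExp q (Fin.natAdd L u) = 0) →
        lamExp q (Fin.natAdd L (⟨t, ht⟩ : Fin r)) = 0 →
        ∀ u : Fin r, (u : ℕ) < t + 1 → lamExp q (Fin.natAdd L u) = 0 := by
      intro q h1 h2 u hu
      rcases Nat.lt_succ_iff_lt_or_eq.1 hu with h' | h'
      · exact h1 u h'
      · have : u = ⟨t, ht⟩ := Fin.ext h'
        rw [this]; exact h2
    rcases hp with ⟨hp, hp0⟩ | ⟨f, hf, g, hg, a, b', hfj, hgj, -, hab, rfl⟩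
    · rcases ih (Nat.le_of_succ_le ht) hp with h1 | h1
      · exact Or.inl ⟨h1.1, key h1.2 hp0⟩
      · exact Or.inr h1
    · rcases ih (Nat.le_of_succ_le ht) hf with h1 | h1
      swap
      · rw [h1] at hfj; exact absurd hfj (lt_irrefl _)
      rcases ih (Nat.le_of_succ_le ht) hg with h2 | h2
      swap
      · rw [h2] at hgj; exact absurd hgj (lt_irrefl _)
      have hlam : ∀ i, lamExp (f ^ a * g ^ b') i = a * lamExp f i + b' * lamExp g i := by
        intro i; simp [lamExp]
      have hexp : Multiplicative.toAdd (f ^ a * g ^ b').1 =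
          (a : ℚ) • Multiplicative.toAdd f.1 + (b' : ℚ) • Multiplicative.toAdd g.1 := by
        simp only [Prod.fst_mul, Prod.pow_fst, toAdd_mul, toAdd_pow, Nat.cast_smul_eq_nsmul]
      refine Or.inl ⟨?_, key (fun u hu => ?_) ?_⟩
      · rw [hexp]
        exact (h1.1.smul (Nat.cast_nonneg a)).add (h2.1.smul (Nat.cast_nonneg b'))
      · rw [hlam, h1.2 u hu, h2.2 u hu]; ring
      · rw [hlam]
        rw [abs_of_pos hfj, abs_of_neg hgj] at hab
        rw [hab]; ring

theorem isPure_of_lamExp_ne (h : IsLevelMatrix A b) {t : ℕ} (ht : t ≤ r)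
    {p : Weighted (L + s) (L + r)} (hp : p ∈ elimSeq A w t) {j : Fin (L + r)}
    (hj : lamExp p j ≠ 0) : IsPure A (Multiplicative.toAdd p.1) ∧
      ∀ u : Fin r, (u : ℕ) < t → lamExp p (Fin.natAdd L u) = 0 :=
  (elimSeq_cases h ht hp).resolve_right fun h' => hj (by rw [h']; rfl)

/-- At each step of the elimination the variable `λ_j` occurs with a negative exponent: for a column
`k ≤ L` with `a_{jk} > 0`, the monomial `τ_k ∏_{i ≥ j} λ_i ^ (-a_{ik})` is in the cone of `G`. -/
theorem exists_lamExp_neg (h : IsLevelMatrix A b) (t : Fin r) :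
    ∃ p ∈ elimSeq A w t, lamExp p (Fin.natAdd L t) < 0 := by
  by_contra! hcon
  obtain ⟨k, hk⟩ := h.exists_pos (Fin.natAdd L t)
  set e : Expo (L + s) (L + r) := tauE (Fin.castAdd s k) -
    ∑ u : Fin r, (if u < t then 0 else A (Fin.natAdd L u) (Fin.castAdd s k)) • lamE (Fin.natAdd L u)
    with he
  have hexp : ∀ u : Fin r, e.2 (Fin.natAdd L u) =
      -(if u < t then 0 else A (Fin.natAdd L u) (Fin.castAdd s k)) := by
    intro u
    have hne : ∀ x : Fin r, (Fin.natAdd L u = Fin.natAdd L x) = (u = x) := fun x => by simp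
    simp only [he, Prod.snd_sub, Prod.snd_sum, Prod.smul_snd, Pi.sub_apply, Finset.sum_apply,
      Pi.smul_apply, lamE, tauE, Pi.single_apply, smul_eq_mul, mul_ite, mul_one, mul_zero, hne,
      Finset.sum_ite_eq, Finset.mem_univ, if_true, Pi.zero_apply, zero_sub]
  have hmem : ∀ v : ℕ, v ≤ t → e ∈ monoCone (elimSeq A w v) := by
    intro v hv
    induction v with
    | zero =>
      have : e = ∑ j, (Fin.addCases (fun i => A (Fin.castAdd r i) (Fin.castAdd s k))
          (fun u : Fin r => if u < t then A (Fin.natAdd L u) (Fin.castAdd s k) else 0) j : ℚ) •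
          genE A j := by
        rw [he, ← sum_smul_genE_castAdd h k, Fin.sum_univ_add, Fin.sum_univ_add]
        simp only [Fin.addCases_left, Fin.addCases_right, genE_natAdd]
        rw [add_sub_assoc, ← Finset.sum_sub_distrib]
        congr 1
        refine Finset.sum_congr rfl fun u _ => ?_
        split_ifs <;> simp
      rw [this]
      refine sum_mem fun j _ => ?_
      refine smul_mem_monoCone (mkPair_genE_mem j) ?_
      refine Fin.addCases (fun i => ?_) (fun u => ?_) j
      · simp [h.nonneg]
      · simp only [Fin.addCases_right]; split_ifs <;> simp [h.nonneg]
    | succ v ih =>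
      rw [elimSeq_succ (lt_of_lt_of_le hv t.2.le)]
      refine mem_monoCone_elimLam (ih (Nat.le_of_succ_le hv)) ?_
      rw [hexp, if_pos, neg_zero]
      exact Fin.lt_def.2 hv
  have hnn : ∀ e' ∈ monoCone (elimSeq A w t), 0 ≤ e'.2 (Fin.natAdd L t) := by
    intro e' he'
    induction he' using AddSubmonoid.closure_induction with
    | mem x hx =>
      obtain ⟨c, hc, p, hp, rfl⟩ := hx
      exact mul_nonneg hc (hcon p hp)
    | zero => exact le_rfl
    | add x y _ _ hx hy => exact add_nonneg hx hy
  have := hnn e (hmem t le_rfl)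
  rw [hexp, if_neg (lt_irrefl _)] at this
  linarith

end Levels

/-! ### The level functions -/

section LevelFunctions
variable {L r s : ℕ}

theorem logEval_congr {m ℓ : ℕ} {y y' : Fin m → ℝ} {x x' : Fin ℓ → ℝ} {e : Expo m ℓ}
    (hy : ∀ k, e.1 k ≠ 0 → y k = y' k) (hx : ∀ j, e.2 j ≠ 0 → x j = x' j) :
    logEval y x e = logEval y' x' e := by
  rw [logEval_apply, logEval_apply]
  congr 1
  · refine Finset.sum_congr rfl fun k _ => ?_
    by_cases h : e.1 k = 0
    · simp [h]
    · rw [hy k h]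
  · refine Finset.sum_congr rfl fun j _ => ?_
    by_cases h : e.2 j = 0
    · simp [h]
    · rw [hx j h]

theorem abs_logEval_sub_le {m ℓ : ℕ} {y y' : Fin m → ℝ} {x x' : Fin ℓ → ℝ} {e : Expo m ℓ} {D : ℝ}
    (hy : ∀ k, e.1 k ≠ 0 → |y k - y' k| ≤ D) (hx : ∀ j, e.2 j ≠ 0 → |x j - x' j| ≤ D) :
    |logEval y x e - logEval y' x' e| ≤ ((∑ k, |(e.1 k : ℝ)|) + ∑ j, |(e.2 j : ℝ)|) * D := by
  have e1 : logEval y x e - logEval y' x' e =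
      (∑ k, (e.1 k : ℝ) * (y k - y' k)) + ∑ j, (e.2 j : ℝ) * (x j - x' j) := by
    simp only [logEval_apply, mul_sub, Finset.sum_sub_distrib]
    ring
  rw [e1, add_mul, Finset.sum_mul, Finset.sum_mul]
  refine (abs_add_le _ _).trans (add_le_add ?_ ?_)
  · refine (Finset.abs_sum_le_sum_abs _ _).trans (Finset.sum_le_sum fun k _ => ?_)
    rw [abs_mul]
    by_cases h : e.1 k = 0
    · simp [h]
    · exact mul_le_mul_of_nonneg_left (hy k h) (abs_nonneg _)
  · refine (Finset.abs_sum_le_sum_abs _ _).trans (Finset.sum_le_sum fun j _ => ?_)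
    rw [abs_mul]
    by_cases h : e.2 j = 0
    · simp [h]
    · exact mul_le_mul_of_nonneg_left (hx j h) (abs_nonneg _)

theorem logEval_lamE {m ℓ : ℕ} (y : Fin m → ℝ) (x : Fin ℓ → ℝ) (j : Fin ℓ) :
    logEval y x (lamE j) = x j := by
  simp [logEval_apply, lamE, Pi.single_apply, apply_ite (Rat.cast : ℚ → ℝ)]

theorem logEval_tauE {m ℓ : ℕ} (y : Fin m → ℝ) (x : Fin ℓ → ℝ) (k : Fin m) :
    logEval y x (tauE k) = y k := by
  simp [logEval_apply, tauE, Pi.single_apply, apply_ite (Rat.cast : ℚ → ℝ)]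

theorem logEval_update {m ℓ : ℕ} (y : Fin m → ℝ) (x : Fin ℓ → ℝ) (j : Fin ℓ) (a : ℝ)
    (e : Expo m ℓ) :
    logEval y (Function.update x j a) e = logEval y x e + e.2 j * (a - x j) := by
  have : ∑ i, (e.2 i : ℝ) * Function.update x j a i =
      ∑ i, ((e.2 i : ℝ) * x i + if i = j then (e.2 j : ℝ) * (a - x j) else 0) := by
    refine Finset.sum_congr rfl fun i _ => ?_
    by_cases h : i = j
    · subst h; simp; ring
    · simp [h]
  rw [logEval_apply, logEval_apply, this, Finset.sum_add_distrib]
  simp [add_assoc]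

theorem logEval_solE {m ℓ : ℕ} (y : Fin m → ℝ) (x : Fin ℓ → ℝ) (j : Fin ℓ) (p : Weighted m ℓ) :
    logEval y x (solE j p) =
      x j + 1 / |(lamExp p j : ℝ)| * logEval y x (Multiplicative.toAdd p.1) := by
  rw [solE, map_add, map_smul, logEval_lamE, Rat.smul_def]
  push_cast
  rfl

theorem solE_snd_self {m ℓ : ℕ} {j : Fin ℓ} {p : Weighted m ℓ} (h : lamExp p j < 0) :
    (solE j p).2 j = 0 := by
  have : (solE j p).2 j = 1 + 1 / |lamExp p j| * lamExp p j := by simp [solE, lamE, lamExp]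
  have h' := h.ne
  rw [this, abs_of_neg h]
  field_simp
  ring

variable {A : Matrix (Fin (L + r)) (Fin (L + s)) ℚ} {b : Fin L → Fin (L + s) → ℚ}
  {w : Fin (L + s) → ℝ} {τ τ' : Fin (L + s) → ℝ}

/-- `ρ_j` is the maximum of the `sol_j(f)`: the maximum is attained, and the case `ρ_j = 1` of the
definition does not occur. -/
theorem rho_spec (h : IsLevelMatrix A b) (hτ : ∀ i : Fin L, 0 < τ (Fin.castAdd s i)) (t : Fin r)
    {lam : Fin (L + r) → ℝ} (hlam : ∀ j, 0 < lam j) :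
    (∃ p ∈ elimSeq A w t, lamExp p (Fin.natAdd L t) < 0 ∧ rho A w t τ lam = Real.exp
      (logEval (fun k => Real.log (τ k)) (fun j => Real.log (lam j)) (solE (Fin.natAdd L t) p))) ∧
    ∀ p ∈ elimSeq A w t, lamExp p (Fin.natAdd L t) < 0 → Real.exp
      (logEval (fun k => Real.log (τ k)) (fun j => Real.log (lam j)) (solE (Fin.natAdd L t) p)) ≤
      rho A w t τ lam := by
  have hev : ∀ p ∈ elimSeq A w t, lamExp p (Fin.natAdd L t) < 0 →
      (solE (Fin.natAdd L t) p).eval τ lam = Real.exp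
      (logEval (fun k => Real.log (τ k)) (fun j => Real.log (lam j)) (solE (Fin.natAdd L t) p)) := by
    intro p hp hneg
    refine Expo.eval_eq_exp (fun k => ?_) hlam
    refine Fin.addCases (fun i => Or.inl (hτ i)) (fun k => Or.inr ?_) k
    have := (isPure_of_lamExp_ne h t.2.le hp hneg.ne).1.fst_natAdd k
    simp [solE, lamE, this]
  have hex := exists_lamExp_neg (w := w) h t
  set B := {p | p ∈ elimSeq A w t ∧ lamExp p (Fin.natAdd L t) < 0} with hB
  have hfin : ((fun p => (solE (Fin.natAdd L t) p).eval τ lam) '' B).Finite :=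
    ((finite_elimSeq _).subset fun p hp => hp.1).image _
  have hrho : rho A w t τ lam = sSup ((fun p => (solE (Fin.natAdd L t) p).eval τ lam) '' B) := by
    rw [rho, if_pos hex]
  constructor
  · have hne : B.Nonempty := hex
    obtain ⟨p, hp, hpe⟩ := (hne.image _).csSup_mem hfin
    exact ⟨p, hp.1, hp.2, by rw [hrho, ← hpe]; exact hev p hp.1 hp.2⟩
  · intro p hp hneg
    rw [hrho, ← hev p hp hneg]
    exact le_csSup hfin.bddAbove (Set.mem_image_of_mem _ (⟨hp, hneg⟩ : p ∈ B))

theorem rhoLower_pos (h : IsLevelMatrix A b) (hτ : ∀ i : Fin L, 0 < τ (Fin.castAdd s i))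
    (t : Fin r) : 0 < rhoLower A w τ t := by
  rw [rhoLower]
  obtain ⟨⟨p, -, -, hp⟩, -⟩ := rho_spec (w := w) h hτ t (lam := Fin.addCases (fun _ => 1)
    (fun u : Fin r => if _h : t < u then rhoLower A w τ u else 1)) (by
      intro j
      refine Fin.addCases (fun i => ?_) (fun u => ?_) j
      · simp
      · simp only [Fin.addCases_right]
        split_ifs with hu
        · exact rhoLower_pos h hτ u
        · exact one_pos)
  rw [hp]
  exact Real.exp_pos _
termination_by r - (t : ℕ)

/-- The logarithms of the values `λ_j = ρ_{Λ,j}(τ')`, `L < j ≤ ℓ`; the values `0` for `j ≤ L` are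
of no importance, as `λ_1, …, λ_L` do not occur in the monomials that are considered. -/
def logLower (A : Matrix (Fin (L + r)) (Fin (L + s)) ℚ) (w τ : Fin (L + s) → ℝ) :
    Fin (L + r) → ℝ :=
  Fin.addCases (fun _ => 0) (fun t => Real.log (rhoLower A w τ t))

theorem logEval_solE_logLower (h : IsLevelMatrix A b) {t : Fin r} {p : Weighted (L + s) (L + r)}
    (hp : p ∈ elimSeq A w t) (hneg : lamExp p (Fin.natAdd L t) < 0) :
    logEval (fun k => Real.log (τ k)) (fun j => Real.log ((Fin.addCases (fun _ => 1)
      (fun u : Fin r => if _h : t < u then rhoLower A w τ u else 1) : Fin (L + r) → ℝ) j))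
      (solE (Fin.natAdd L t) p) =
    logEval (fun k => Real.log (τ k)) (logLower A w τ) (solE (Fin.natAdd L t) p) := by
  obtain ⟨hpure, hlow⟩ := isPure_of_lamExp_ne h t.2.le hp hneg.ne
  refine logEval_congr (fun _ _ => rfl) fun j hj => ?_
  revert hj
  refine Fin.addCases (fun i => ?_) (fun u => ?_) j
  · intro _; simp [logLower]
  · intro hj
    have hu : t < u := by
      by_contra hu
      rcases (not_lt.1 hu).lt_or_eq with h' | h'
      · refine hj ?_
        have hne : Fin.natAdd L u ≠ Fin.natAdd L t := by simpa using h'.ne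
        have h0 : (Multiplicative.toAdd p.1).2 (Fin.natAdd L u) = 0 := hlow u h'
        simp [solE, lamE, h0, hne]
      · subst h'
        exact hj (solE_snd_self hneg)
    simp [logLower, hu]

/-- At `λ'' = ρ_Λ(τ')` the monomials with a negative exponent of `λ_j` that occur before the
elimination of `λ_j` are at most `1`. -/
theorem logEval_nonpos (h : IsLevelMatrix A b) (hτ : ∀ i : Fin L, 0 < τ (Fin.castAdd s i))
    {t : Fin r} {p : Weighted (L + s) (L + r)} (hp : p ∈ elimSeq A w t)
    (hneg : lamExp p (Fin.natAdd L t) < 0) :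
    logEval (fun k => Real.log (τ k)) (logLower A w τ) (Multiplicative.toAdd p.1) ≤ 0 := by
  have hpos : ∀ j, 0 < (Fin.addCases (fun _ => 1)
    (fun u : Fin r => if _h : t < u then rhoLower A w τ u else 1) : Fin (L + r) → ℝ) j := by
    intro j
    refine Fin.addCases (fun i => ?_) (fun u => ?_) j
    · simp
    · simp only [Fin.addCases_right]
      split_ifs with hu
      · exact rhoLower_pos h hτ u
      · exact one_pos
  have h1 := (rho_spec (w := w) h hτ t hpos).2 p hp hneg
  rw [← rhoLower, ← Real.le_log_iff_exp_le (rhoLower_pos h hτ t), logEval_solE_logLower h hp hneg,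
    logEval_solE] at h1
  have h2 : logLower A w τ (Fin.natAdd L t) = Real.log (rhoLower A w τ t) := by simp [logLower]
  rw [h2] at h1
  have h3 : (0 : ℝ) < 1 / |(lamExp p (Fin.natAdd L t) : ℝ)| := by
    have : (lamExp p (Fin.natAdd L t) : ℝ) ≠ 0 := by exact_mod_cast hneg.ne
    positivity
  by_contra! hcon
  have := mul_pos h3 hcon
  linarith

/-- One of the monomials of `logEval_nonpos` attains the value `1`. -/
theorem exists_logEval_eq_zero (h : IsLevelMatrix A b)
    (hτ : ∀ i : Fin L, 0 < τ (Fin.castAdd s i)) (t : Fin r) :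
    ∃ p ∈ elimSeq A w t, lamExp p (Fin.natAdd L t) < 0 ∧
    logEval (fun k => Real.log (τ k)) (logLower A w τ) (Multiplicative.toAdd p.1) = 0 := by
  have hpos : ∀ j, 0 < (Fin.addCases (fun _ => 1)
    (fun u : Fin r => if _h : t < u then rhoLower A w τ u else 1) : Fin (L + r) → ℝ) j := by
    intro j
    refine Fin.addCases (fun i => ?_) (fun u => ?_) j
    · simp
    · simp only [Fin.addCases_right]
      split_ifs with hu
      · exact rhoLower_pos h hτ u
      · exact one_pos
  obtain ⟨⟨p, hp, hneg, h1⟩, -⟩ := rho_spec (w := w) h hτ t hpos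
  refine ⟨p, hp, hneg, ?_⟩
  rw [← rhoLower] at h1
  have h2 := congrArg Real.log h1
  rw [Real.log_exp, logEval_solE_logLower h hp hneg, logEval_solE] at h2
  have h3 : logLower A w τ (Fin.natAdd L t) = Real.log (rhoLower A w τ t) := by simp [logLower]
  have h4 : (1 : ℝ) / |(lamExp p (Fin.natAdd L t) : ℝ)| ≠ 0 := by
    have : (lamExp p (Fin.natAdd L t) : ℝ) ≠ 0 := by exact_mod_cast hneg.ne
    positivity
  rw [h3] at h2
  exact (mul_eq_zero.1 (by linarith)).resolve_left h4

theorem rhoLevel_eq_exp (h : IsLevelMatrix A b) (hτ : ∀ i : Fin L, 0 < τ (Fin.castAdd s i))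
    (j : Fin (L + r)) : rhoLevel A w τ j =
      Real.exp (logEval (fun k => Real.log (τ k)) (logLower A w τ) (genE A j)) := by
  refine Fin.addCases (fun i => ?_) (fun t => ?_) j
  · rw [rhoLevel, Fin.addCases_left, Expo.eval_eq_exp, genE_castAdd]
    · congr 1
      refine logEval_congr (fun _ _ => rfl) fun j _ => ?_
      refine Fin.addCases (fun i => ?_) (fun t => ?_) j <;> simp [logLower]
    · intro k
      refine Fin.addCases (fun i => Or.inl (hτ i)) (fun k => Or.inr ?_) k
      rw [← genE_castAdd]; exact genE_fst_natAdd _ _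
    · intro j
      refine Fin.addCases (fun i => ?_) (fun t => ?_) j
      · simp
      · simpa using rhoLower_pos h hτ t
  · rw [rhoLevel, Fin.addCases_right, genE_natAdd, logEval_lamE, logLower, Fin.addCases_right,
      Real.exp_log (rhoLower_pos h hτ t)]

theorem rhoLevel_pos (h : IsLevelMatrix A b) (hτ : ∀ i : Fin L, 0 < τ (Fin.castAdd s i))
    (j : Fin (L + r)) : 0 < rhoLevel A w τ j := by
  rw [rhoLevel_eq_exp h hτ]; exact Real.exp_pos _

/-- `φ_k(ρ_Λ(τ')) = ∏_{i ≤ L} τ_i ^ b_{ik}`. -/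
theorem sum_mul_log_rhoLevel (h : IsLevelMatrix A b) (hτ : ∀ i : Fin L, 0 < τ (Fin.castAdd s i))
    (k : Fin (L + s)) : ∑ j, (A j k : ℝ) * Real.log (rhoLevel A w τ j) =
      ∑ i, (b i k : ℝ) * Real.log (τ (Fin.castAdd s i)) := by
  have := congrArg (logEval (fun k => Real.log (τ k)) (logLower A w τ)) (sum_smul_genE h k)
  simp only [map_sum, map_smul, Rat.smul_def, logEval_tauE] at this
  rw [← this]
  exact Finset.sum_congr rfl fun j _ => by rw [rhoLevel_eq_exp h hτ, Real.log_exp]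

/-- The level functions are bounded by the `λ`-free monomials that the elimination produces. -/
theorem rhoLevel_le_exp (h : IsLevelMatrix A b) (hτ : ∀ i : Fin L, 0 < τ (Fin.castAdd s i))
    {M : ℝ} (hM0 : 0 ≤ M) (hM : ∀ p ∈ elimSeq A w r, IsPure A (Multiplicative.toAdd p.1) →
      logEval (fun k => Real.log (τ k)) (logLower A w τ) (Multiplicative.toAdd p.1) ≤ M)
    (j : Fin (L + r)) : rhoLevel A w τ j ≤ Real.exp M := by
  have key : ∀ d t : ℕ, t + d = r → ∀ p ∈ elimSeq A w t, IsPure A (Multiplicative.toAdd p.1) →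
      logEval (fun k => Real.log (τ k)) (logLower A w τ) (Multiplicative.toAdd p.1) ≤ M := by
    intro d
    induction d with
    | zero =>
      intro t ht p hp
      rw [add_zero] at ht
      rw [ht] at hp
      exact hM p hp
    | succ d ih =>
      intro t ht p hp hpure
      have htr : t < r := by omega
      have ih' := ih (t + 1) (by omega)
      rw [elimSeq_succ htr] at ih'
      set t' : Fin r := ⟨t, htr⟩
      rcases lt_trichotomy (lamExp p (Fin.natAdd L t')) 0 with hc | hc | hc
      · exact (logEval_nonpos h hτ (t := t') hp hc).trans hM0
      · exact ih' p (Or.inl ⟨hp, hc⟩) hpure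
      · obtain ⟨q, hq, hqn, hq0⟩ := exists_logEval_eq_zero (w := w) h hτ t'
        obtain ⟨a, b', ha, hb, hab, he⟩ :=
          exists_coprime_mul_eq (abs_pos.2 hc.ne') (abs_pos.2 hqn.ne)
        have hexp : Multiplicative.toAdd (p ^ a * q ^ b').1 =
            (a : ℚ) • Multiplicative.toAdd p.1 + (b' : ℚ) • Multiplicative.toAdd q.1 := by
          simp only [Prod.fst_mul, Prod.pow_fst, toAdd_mul, toAdd_pow, Nat.cast_smul_eq_nsmul]
        have := ih' (p ^ a * q ^ b') (Or.inr ⟨p, hp, q, hq, a, b', hc, hqn, hab, he, rfl⟩) (by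
          rw [hexp]
          exact (hpure.smul (Nat.cast_nonneg a)).add
            ((isPure_of_lamExp_ne h htr.le hq hqn.ne).1.smul (Nat.cast_nonneg b')))
        rw [hexp, map_add, map_smul, map_smul, hq0, smul_zero, add_zero, Rat.smul_def] at this
        push_cast at this
        have ha1 : (1 : ℝ) ≤ a := by exact_mod_cast ha
        by_contra! hcon
        have := le_mul_of_one_le_left (hM0.trans hcon.le) ha1
        linarith
  rw [rhoLevel_eq_exp h hτ, Real.exp_le_exp]
  have := key r 0 (zero_add r) (mkPair (genE A j) 0) (mkPair_genE_mem j) (isPure_genE h j)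
  exact this

/-- The logarithms of the level functions are Lipschitz functions of `log τ'`. -/
theorem exists_abs_log_rhoLevel_sub_le (h : IsLevelMatrix A b) (w : Fin (L + s) → ℝ) :
    ∃ K : ℝ, 0 ≤ K ∧ ∀ (τ τ' : Fin (L + s) → ℝ) (d : ℝ), 0 ≤ d →
      (∀ i : Fin L, 0 < τ (Fin.castAdd s i)) → (∀ i : Fin L, 0 < τ' (Fin.castAdd s i)) →
      (∀ i : Fin L, |Real.log (τ (Fin.castAdd s i)) - Real.log (τ' (Fin.castAdd s i))| ≤ d) →
      ∀ j, |Real.log (rhoLevel A w τ j) - Real.log (rhoLevel A w τ' j)| ≤ K * d := by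
  have key : ∀ c t : ℕ, t + c = r → ∃ K : ℝ, 0 ≤ K ∧ ∀ (τ τ' : Fin (L + s) → ℝ) (d : ℝ), 0 ≤ d →
      (∀ i : Fin L, 0 < τ (Fin.castAdd s i)) → (∀ i : Fin L, 0 < τ' (Fin.castAdd s i)) →
      (∀ i : Fin L, |Real.log (τ (Fin.castAdd s i)) - Real.log (τ' (Fin.castAdd s i))| ≤ d) →
      ∀ u : Fin r, t ≤ u → |logLower A w τ (Fin.natAdd L u) - logLower A w τ' (Fin.natAdd L u)| ≤
        K * d := by
    intro c
    induction c with
    | zero =>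
      intro t ht
      exact ⟨0, le_rfl, fun τ τ' d _ _ _ _ u hu => absurd u.2 (by omega)⟩
    | succ c ih =>
      intro t ht
      obtain ⟨K, hK, hlip⟩ := ih (t + 1) (by omega)
      have htr : t < r := by omega
      set t' : Fin r := ⟨t, htr⟩
      set size : Weighted (L + s) (L + r) → ℝ := fun p =>
        ((∑ k, |((Multiplicative.toAdd p.1).1 k : ℝ)|) +
          ∑ j, |((Multiplicative.toAdd p.1).2 j : ℝ)|) / |(lamExp p (Fin.natAdd L t') : ℝ)|
      obtain ⟨Q, hQ⟩ := ((finite_elimSeq (A := A) (w := w) t).image size).bddAbove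
      have hQ' : ∀ p ∈ elimSeq A w t, size p ≤ max Q 0 := fun p hp =>
        (hQ (Set.mem_image_of_mem _ hp)).trans (le_max_left _ _)
      have hone : ∀ (τ τ' : Fin (L + s) → ℝ) (d : ℝ), 0 ≤ d →
          (∀ i : Fin L, 0 < τ (Fin.castAdd s i)) → (∀ i : Fin L, 0 < τ' (Fin.castAdd s i)) →
          (∀ i : Fin L, |Real.log (τ (Fin.castAdd s i)) - Real.log (τ' (Fin.castAdd s i))| ≤ d) →
          logLower A w τ' (Fin.natAdd L t') - logLower A w τ (Fin.natAdd L t') ≤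
            max Q 0 * ((K + 1) * d) := by
        intro τ τ' d hd hτ hτ' hdist
        obtain ⟨p, hp, hneg, hp0⟩ := exists_logEval_eq_zero (w := w) h hτ' t'
        have hp1 := logEval_nonpos (w := w) h hτ hp hneg
        obtain ⟨hpure, hlow⟩ := isPure_of_lamExp_ne h htr.le hp hneg.ne
        have hle := abs_logEval_sub_le (e := Multiplicative.toAdd p.1) (D := (K + 1) * d)
          (y := fun k => Real.log (τ k)) (y' := fun k => Real.log (τ' k))
          (x := Function.update (logLower A w τ) (Fin.natAdd L t')
            (logLower A w τ' (Fin.natAdd L t'))) (x' := logLower A w τ')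
          (fun k hk => by
            revert hk
            refine Fin.addCases (fun i => ?_) (fun k => ?_) k
            · intro _; exact (hdist i).trans (by nlinarith)
            · intro hk; exact absurd (hpure.fst_natAdd k) hk)
          (fun j hj => by
            revert hj
            refine Fin.addCases (fun i => ?_) (fun u => ?_) j
            · intro hj; exact absurd (hpure.snd_castAdd i) hj
            · intro hj
              by_cases hu : u = t'
              · subst hu
                simp only [Function.update_self, sub_self, abs_zero]
                positivity
              · have hne : Fin.natAdd L u ≠ Fin.natAdd L t' := by simpa using hu
                rw [Function.update_of_ne hne]
                have hu' : t + 1 ≤ u := by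
                  rcases lt_or_ge (u : ℕ) t with h' | h'
                  · exact absurd (hlow u h') hj
                  · refine lt_of_le_of_ne h' fun h'' => hu (Fin.ext h''.symm)
                exact (hlip τ τ' d hd hτ hτ' hdist u hu').trans (by nlinarith))
        rw [logEval_update, hp0, sub_zero] at hle
        have hc : (lamExp p (Fin.natAdd L t') : ℝ) < 0 := by exact_mod_cast hneg
        have hs := hQ' p hp
        have hs' : ((∑ k, |((Multiplicative.toAdd p.1).1 k : ℝ)|) +
          ∑ j, |((Multiplicative.toAdd p.1).2 j : ℝ)|) ≤
            max Q 0 * |(lamExp p (Fin.natAdd L t') : ℝ)| :=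
          (div_le_iff₀ (abs_pos.2 hc.ne)).1 hs
        have hD : 0 ≤ (K + 1) * d := by positivity
        have h5 := (neg_le_of_abs_le hle)
        have h6 := mul_le_mul_of_nonneg_right hs' hD
        rw [abs_of_neg hc] at h6
        change _ ≤ _ + (lamExp p (Fin.natAdd L t') : ℝ) * _ at h5
        by_contra! hcon
        nlinarith [mul_lt_mul_of_neg_left hcon hc]
      refine ⟨max K (max Q 0 * (K + 1)), le_max_of_le_left hK, ?_⟩
      intro τ τ' d hd hτ hτ' hdist u hu
      rcases hu.eq_or_lt with h' | h'
      · have hut : u = t' := Fin.ext h'.symm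
        subst hut
        have h1 := hone τ τ' d hd hτ hτ' hdist
        have h2 := hone τ' τ d hd hτ' hτ fun i => by rw [abs_sub_comm]; exact hdist i
        have h3 : max Q 0 * ((K + 1) * d) ≤ max K (max Q 0 * (K + 1)) * d := by
          rw [← mul_assoc]; exact mul_le_mul_of_nonneg_right (le_max_right _ _) hd
        exact abs_le.2 ⟨by linarith, by linarith⟩
      · exact (hlip τ τ' d hd hτ hτ' hdist u h').trans
          (mul_le_mul_of_nonneg_right (le_max_left _ _) hd)
  obtain ⟨K, hK, hlip⟩ := key r 0 (zero_add r)
  obtain ⟨Q, hQ⟩ := (Set.finite_range fun j => (∑ k, |((genE A j).1 k : ℝ)|) +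
    ∑ i, |((genE A j).2 i : ℝ)|).bddAbove
  refine ⟨max Q 0 * (K + 1), by positivity, ?_⟩
  intro τ τ' d hd hτ hτ' hdist j
  rw [rhoLevel_eq_exp h hτ, rhoLevel_eq_exp h hτ', Real.log_exp, Real.log_exp, mul_assoc]
  refine (abs_logEval_sub_le (D := (K + 1) * d) (fun k hk => ?_) fun i hi => ?_).trans
    (mul_le_mul_of_nonneg_right ((hQ ⟨j, rfl⟩).trans (le_max_left _ _)) (by positivity))
  · revert hk
    refine Fin.addCases (fun i => ?_) (fun k => ?_) k
    · intro _; exact (hdist i).trans (by nlinarith)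
    · intro hk; exact absurd (genE_fst_natAdd j k) hk
  · revert hi
    refine Fin.addCases (fun i => ?_) (fun u => ?_) i
    · intro hj; exact absurd (genE_snd_castAdd j i) hj
    · intro _
      exact (hlip τ τ' d hd hτ hτ' hdist u (Nat.zero_le _)).trans (by nlinarith)

end LevelFunctions

/-! ### Level functions under the actions -/

section Scaling
variable {L r s : ℕ} {A : Matrix (Fin (L + r)) (Fin (L + s)) ℚ} {b : Fin L → Fin (L + s) → ℚ}
  {w : Fin (L + s) → ℝ} {τ τ' : Fin (L + s) → ℝ}

/-- The value of a product of the `φ_i⁻¹` and `λ_j` under the `j`-th action on `τ'`, with `λ` fixed. -/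
theorem logEval_scale {e : Expo (L + s) (L + r)} (he : IsPure A e) {j : Fin (L + r)} {c : ℝ}
    {y y' : Fin (L + s) → ℝ} (hy : ∀ i : Fin L, y' (Fin.castAdd s i) = y (Fin.castAdd s i) +
      (A j (Fin.castAdd s i) : ℝ) * c) (x : Fin (L + r) → ℝ) :
    logEval y' x e = logEval y x e + ((weight A j e - e.2 j : ℚ) : ℝ) * c := by
  have hsum : ∀ y : Fin (L + s) → ℝ, ∑ k, (e.1 k : ℝ) * y k =
      ∑ i : Fin L, (e.1 (Fin.castAdd s i) : ℝ) * y (Fin.castAdd s i) := by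
    intro y
    rw [Fin.sum_univ_add]
    simp [he.fst_natAdd]
  have hw : ((weight A j e - e.2 j : ℚ) : ℝ) = ∑ k, (e.1 k : ℝ) * (A j k : ℝ) := by
    rw [weight_apply, add_sub_cancel_right]
    push_cast
    exact Finset.sum_congr rfl fun k _ => mul_comm _ _
  rw [logEval_apply, logEval_apply, hw, hsum, hsum, hsum, Finset.sum_mul]
  simp only [hy, mul_add, Finset.sum_add_distrib, mul_assoc]
  ring

theorem rhoLevel_scale_of_phiInv_snd_eq_zero (h : IsLevelMatrix A b)
    (hτ : ∀ i : Fin L, 0 < τ (Fin.castAdd s i)) (hτ' : ∀ i : Fin L, 0 < τ' (Fin.castAdd s i))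
    {i : Fin L} (hi : (phiInv A i).2 = 0) {t : ℝ} (ht : 0 < t)
    (hs : ∀ k : Fin L, τ' (Fin.castAdd s k) =
      t ^ (A (Fin.castAdd r i) (Fin.castAdd s k) : ℝ) * τ (Fin.castAdd s k)) :
    rhoLevel A w τ' (Fin.castAdd r i) ≤ t * rhoLevel A w τ (Fin.castAdd r i) := by
  rw [rhoLevel_eq_exp h hτ, rhoLevel_eq_exp h hτ']
  have hlog : ∀ k : Fin L, Real.log (τ' (Fin.castAdd s k)) = Real.log (τ (Fin.castAdd s k)) +
      (A (Fin.castAdd r i) (Fin.castAdd s k) : ℝ) * Real.log t := by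
    intro k
    rw [hs, Real.log_mul (Real.rpow_pos_of_pos ht _).ne' (hτ k).ne', Real.log_rpow ht]
    ring
  rw [logEval_scale (isPure_genE h _) (j := Fin.castAdd r i) (y := fun k => Real.log (τ k))
    (c := Real.log t) hlog, weight_genE h, if_pos rfl, genE_castAdd, hi]
  have h1 : logEval (fun k => Real.log (τ k)) (logLower A w τ') (phiInv A i) =
      logEval (fun k => Real.log (τ k)) (logLower A w τ) (phiInv A i) :=
    logEval_congr (fun _ _ => rfl) fun j hj => absurd (congrFun hi j) hj
  rw [h1, Real.exp_add]
  simp [Real.exp_log ht, mul_comm]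

/-- The last level function is at least homogeneous of degree one under the last action: the
monomials `f` that determine it contain `λ_ℓ` with an exponent `-x < 0` and have non-negative
weight, so that `sol_ℓ(f)` has weight at least `1`. -/
theorem rhoLevel_scale_last (h : IsLevelMatrix A b)
    (hτ : ∀ i : Fin L, 0 < τ (Fin.castAdd s i)) (hτ' : ∀ i : Fin L, 0 < τ' (Fin.castAdd s i))
    {u : Fin r} (hu : (u : ℕ) + 1 = r) {t : ℝ} (ht : 0 < t) (ht1 : t ≤ 1)
    (hs : ∀ k : Fin L, τ' (Fin.castAdd s k) =
      t ^ (A (Fin.natAdd L u) (Fin.castAdd s k) : ℝ) * τ (Fin.castAdd s k)) :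
    rhoLevel A w τ' (Fin.natAdd L u) ≤ t * rhoLevel A w τ (Fin.natAdd L u) := by
  rw [rhoLevel_eq_exp h hτ, rhoLevel_eq_exp h hτ', genE_natAdd, logEval_lamE, logEval_lamE]
  have hlog : ∀ k : Fin L, Real.log (τ' (Fin.castAdd s k)) = Real.log (τ (Fin.castAdd s k)) +
      (A (Fin.natAdd L u) (Fin.castAdd s k) : ℝ) * Real.log t := by
    intro k
    rw [hs, Real.log_mul (Real.rpow_pos_of_pos ht _).ne' (hτ k).ne', Real.log_rpow ht]
    ring
  obtain ⟨p, hp, hneg, hp0⟩ := exists_logEval_eq_zero (w := w) h hτ' u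
  have hp1 := logEval_nonpos (w := w) h hτ hp hneg
  obtain ⟨hpure, hlow⟩ := isPure_of_lamExp_ne h u.2.le hp hneg.ne
  rw [logEval_scale hpure (j := Fin.natAdd L u) (y := fun k => Real.log (τ k))
    (c := Real.log t) hlog] at hp0
  have h1 : logEval (fun k => Real.log (τ k)) (logLower A w τ') (Multiplicative.toAdd p.1) =
      logEval (fun k => Real.log (τ k)) (Function.update (logLower A w τ) (Fin.natAdd L u)
        (logLower A w τ' (Fin.natAdd L u))) (Multiplicative.toAdd p.1) := by
    refine logEval_congr (fun _ _ => rfl) fun j hj => ?_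
    revert hj
    refine Fin.addCases (fun i => ?_) (fun v => ?_) j
    · intro hj; exact absurd (hpure.snd_castAdd i) hj
    · intro hj
      by_cases hv : v = u
      · subst hv; simp
      · refine absurd (hlow v ?_) hj
        have := v.2
        have : (v : ℕ) ≠ u := fun h' => hv (Fin.ext h')
        omega
  rw [h1, logEval_update] at hp0
  have hc : (lamExp p (Fin.natAdd L u) : ℝ) < 0 := by exact_mod_cast hneg
  have hwt : (0 : ℝ) ≤ (weight A (Fin.natAdd L u) (Multiplicative.toAdd p.1) : ℝ) := by
    exact_mod_cast hpure.1 _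
  have hlt : Real.log t ≤ 0 := Real.log_nonpos ht.le ht1
  have key : logLower A w τ' (Fin.natAdd L u) ≤ Real.log t + logLower A w τ (Fin.natAdd L u) := by
    change _ + (lamExp p (Fin.natAdd L u) : ℝ) * _ + (((weight A (Fin.natAdd L u)
      (Multiplicative.toAdd p.1) - lamExp p (Fin.natAdd L u) : ℚ) : ℝ)) * _ = 0 at hp0
    push_cast at hp0
    by_contra! hcon
    have h2 := mul_lt_mul_of_neg_left hcon hc
    have h3 := mul_nonpos_of_nonneg_of_nonpos hwt hlt
    linarith
  calc Real.exp (logLower A w τ' (Fin.natAdd L u))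
      ≤ Real.exp (Real.log t + logLower A w τ (Fin.natAdd L u)) := Real.exp_le_exp.2 key
    _ = _ := by rw [Real.exp_add, Real.exp_log ht]

theorem admissible_one (h : IsLevelMatrix A b) : Admissible A 1 := by
  have h1 : LinearIndependent ℚ (leading A).row := by
    rw [Matrix.linearIndependent_rows_iff_isUnit, Matrix.isUnit_iff_isUnit_det]
    exact h.det.isUnit
  exact LinearIndependent.of_comp (LinearMap.funLeft ℚ ℚ (Fin.castAdd s)) h1

/-- The row `i ≤ L` of the first `L` rows can be exchanged for a row `λ_j`, `j > L`, if `λ_j` occurs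
in `φ_i⁻¹`. The exponents of `τ'` in `φ_i⁻¹` form a vector that is orthogonal to the other rows. -/
theorem admissible_of_phiInv_ne (h : IsLevelMatrix A b) {i : Fin L} {u : Fin r}
    (hne : (phiInv A i).2 (Fin.natAdd L u) ≠ 0) {θ : Equiv.Perm (Fin (L + r))}
    (hθi : θ (Fin.castAdd r i) = Fin.natAdd L u)
    (hθ : ∀ i' : Fin L, i' ≠ i → θ (Fin.castAdd r i') = Fin.castAdd r i') : Admissible A θ := by
  refine Fintype.linearIndependent_iff.2 fun g hg => ?_
  have hdual : ∀ j, ∑ k, A j k * (phiInv A i).1 k =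
      (if j = Fin.castAdd r i then 1 else 0) - (phiInv A i).2 j := by
    intro j
    rw [← weight_phiInv h j i, weight_apply]; ring
  have hsnd : ∀ i' : Fin L, (phiInv A i).2 (Fin.castAdd r i') = 0 := by
    intro i'; rw [← genE_castAdd]; exact genE_snd_castAdd _ _
  have hgi : g i = 0 := by
    have h1 : ∑ i', g i' * ∑ k, A (θ (Fin.castAdd r i')) k * (phiInv A i).1 k = 0 := by
      simp only [Finset.mul_sum]
      rw [Finset.sum_comm]
      refine Finset.sum_eq_zero fun k _ => ?_
      have := congrFun hg k
      simp only [Finset.sum_apply, Pi.smul_apply, smul_eq_mul, Pi.zero_apply] at this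
      simp only [← mul_assoc, ← Finset.sum_mul, this, zero_mul]
    rw [Finset.sum_eq_single i] at h1
    · rw [hθi, hdual, if_neg] at h1
      · simpa [hne] using h1
      · intro h'; have := congrArg Fin.val h'; simp at this; omega
    · intro i' _ hi'
      rw [hθ i' hi', hdual, hsnd, if_neg (by simpa using hi')]; simp
    · simp
  have hrest : ∑ i', g i' • A (Fin.castAdd r i') = 0 := by
    rw [← hg]
    refine Finset.sum_congr rfl fun i' _ => ?_
    by_cases hi' : i' = i
    · rw [hi', hgi, zero_smul, zero_smul]
    · rw [hθ i' hi']
  exact Fintype.linearIndependent_iff.1 (admissible_one h) g hrest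

/-- For each action there is an admissible ordering for which its level function is at least
homogeneous of degree one: if the action is needed in every admissible ordering, then `φ_j⁻¹` does
not contain `λ''`; otherwise the action can be put into the last place. -/
theorem exists_admissible_scale (h : IsLevelMatrix A b) (w : Fin (L + s) → ℝ) (j : Fin (L + r)) :
    ∃ θ : Equiv.Perm (Fin (L + r)), Admissible A θ ∧ ∀ (τ τ' : Fin (L + s) → ℝ) (t : ℝ),
      0 < t → t ≤ 1 → (∀ i : Fin L, 0 < τ (Fin.castAdd s i)) →
      (∀ i : Fin L, 0 < τ' (Fin.castAdd s i)) →
      (∀ k : Fin L, τ' (Fin.castAdd s k) =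
        t ^ (A j (Fin.castAdd s k) : ℝ) * τ (Fin.castAdd s k)) →
      rhoLevel (A.submatrix θ id) w τ' (θ.symm j) ≤
        t * rhoLevel (A.submatrix θ id) w τ (θ.symm j) := by
  have hlast : ∀ (θ : Equiv.Perm (Fin (L + r))), Admissible A θ → ∀ u : Fin r, (u : ℕ) + 1 = r →
      θ (Fin.natAdd L u) = j → ∀ (τ τ' : Fin (L + s) → ℝ) (t : ℝ),
      0 < t → t ≤ 1 → (∀ i : Fin L, 0 < τ (Fin.castAdd s i)) →
      (∀ i : Fin L, 0 < τ' (Fin.castAdd s i)) →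
      (∀ k : Fin L, τ' (Fin.castAdd s k) =
        t ^ (A j (Fin.castAdd s k) : ℝ) * τ (Fin.castAdd s k)) →
      rhoLevel (A.submatrix θ id) w τ' (θ.symm j) ≤
        t * rhoLevel (A.submatrix θ id) w τ (θ.symm j) := by
    intro θ hθ u hu huj τ τ' t ht ht1 hτ hτ' hs
    have e : θ.symm j = Fin.natAdd L u := by rw [← huj, Equiv.symm_apply_apply]
    rw [e]
    refine rhoLevel_scale_last (h.perm hθ) hτ hτ' hu ht ht1 fun k => ?_
    rw [hs]; simp [huj]
  have hex : ∀ u : Fin r, ∃ v : Fin r, (v : ℕ) + 1 = r := fun u =>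
    ⟨⟨r - 1, by have := u.2; omega⟩, by have := u.2; simp only; omega⟩
  have hnat : ∀ (i : Fin L) (u : Fin r), Fin.castAdd r i ≠ Fin.natAdd L u := fun i u h' => by
    have := congrArg Fin.val h'; simp at this; omega
  revert hlast
  refine Fin.addCases (fun i => ?_) (fun u => ?_) j
  · intro hlast
    by_cases hz : (phiInv A i).2 = 0
    · refine ⟨1, admissible_one h, fun τ τ' t ht _ hτ hτ' hs => ?_⟩
      exact rhoLevel_scale_of_phiInv_snd_eq_zero h hτ hτ' hz ht hs
    · obtain ⟨j', hj'⟩ := Function.ne_iff.1 hz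
      revert hj'
      refine Fin.addCases (fun i' => ?_) (fun u => ?_) j'
      · intro h'
        rw [← genE_castAdd] at h'
        exact absurd (genE_snd_castAdd _ _) h'
      · intro hu
        obtain ⟨v, hv⟩ := hex u
        refine ⟨Equiv.swap (Fin.castAdd r i) (Fin.natAdd L u) *
          Equiv.swap (Fin.natAdd L u) (Fin.natAdd L v), ?_, hlast _ ?_ v hv ?_⟩
        · refine admissible_of_phiInv_ne h hu ?_ fun i' hi' => ?_
          · simp [Equiv.swap_apply_of_ne_of_ne (hnat _ _) (hnat _ _)]
          · rw [Equiv.Perm.mul_apply, Equiv.swap_apply_of_ne_of_ne (hnat _ _) (hnat _ _),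
              Equiv.swap_apply_of_ne_of_ne (by simpa using hi') (hnat _ _)]
        · refine admissible_of_phiInv_ne h hu ?_ fun i' hi' => ?_
          · simp [Equiv.swap_apply_of_ne_of_ne (hnat _ _) (hnat _ _)]
          · rw [Equiv.Perm.mul_apply, Equiv.swap_apply_of_ne_of_ne (hnat _ _) (hnat _ _),
              Equiv.swap_apply_of_ne_of_ne (by simpa using hi') (hnat _ _)]
        · simp
  · intro hlast
    obtain ⟨v, hv⟩ := hex u
    have hadm : Admissible A (Equiv.swap (Fin.natAdd L u) (Fin.natAdd L v)) := by
      have := admissible_one h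
      unfold Admissible at this ⊢
      convert! this using 2 with i
      rw [Equiv.swap_apply_of_ne_of_ne (hnat _ _) (hnat _ _)]
      rfl
    exact ⟨_, hadm, hlast _ hadm v hv (by simp)⟩

/-- The level function `ρ^θ_{Λ, θ⁻¹(j)}` that belongs to the action `j` and the ordering `θ`. -/
def rhoPerm (A : Matrix (Fin (L + r)) (Fin (L + s)) ℚ) (w : Fin (L + s) → ℝ)
    (θ : Equiv.Perm (Fin (L + r))) (τ : Fin (L + s) → ℝ) (j : Fin (L + r)) : ℝ :=
  rhoLevel (A.submatrix θ id) w τ (θ.symm j)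

variable {θ : Equiv.Perm (Fin (L + r))}

theorem rhoPerm_pos (h : IsLevelMatrix A b) (hθ : Admissible A θ)
    (hτ : ∀ i : Fin L, 0 < τ (Fin.castAdd s i)) (j : Fin (L + r)) : 0 < rhoPerm A w θ τ j :=
  rhoLevel_pos (h.perm hθ) hτ _

theorem rhoHat_nonneg (h : IsLevelMatrix A b) (hτ : ∀ i : Fin L, 0 < τ (Fin.castAdd s i))
    (j : Fin (L + r)) : 0 ≤ rhoHat A w τ j :=
  Real.iInf_nonneg fun θ => (rhoPerm_pos h θ.2 hτ j).le

theorem rhoHat_le (h : IsLevelMatrix A b) (hθ : Admissible A θ)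
    (hτ : ∀ i : Fin L, 0 < τ (Fin.castAdd s i)) (j : Fin (L + r)) :
    rhoHat A w τ j ≤ rhoPerm A w θ τ j := by
  refine ciInf_le (f := fun θ : {θ : Equiv.Perm (Fin (L + r)) // Admissible A θ} =>
    rhoLevel (A.submatrix θ.1 id) w τ (θ.1.symm j)) ⟨0, ?_⟩ ⟨θ, hθ⟩
  rintro _ ⟨θ', rfl⟩
  exact (rhoPerm_pos h θ'.2 hτ j).le

theorem sum_mul_log_rhoPerm (h : IsLevelMatrix A b) (hθ : Admissible A θ)
    (hτ : ∀ i : Fin L, 0 < τ (Fin.castAdd s i)) (k : Fin (L + s)) :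
    ∑ j, (A j k : ℝ) * Real.log (rhoPerm A w θ τ j) =
      ∑ i, (b i k : ℝ) * Real.log (τ (Fin.castAdd s i)) := by
  rw [← sum_mul_log_rhoLevel (w := w) (h.perm hθ) hτ k, ← Equiv.sum_comp θ]
  simp [rhoPerm]

/-- The level functions do not vary by more than a constant factor when `log τ'` varies by at most
`1`. -/
theorem exists_rhoPerm_le (h : IsLevelMatrix A b) (hθ : Admissible A θ) (w : Fin (L + s) → ℝ) :
    ∃ C : ℝ, 0 < C ∧ ∀ τ τ' : Fin (L + s) → ℝ,
      (∀ i : Fin L, 0 < τ (Fin.castAdd s i)) → (∀ i : Fin L, 0 < τ' (Fin.castAdd s i)) →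
      (∀ i : Fin L, |Real.log (τ (Fin.castAdd s i)) - Real.log (τ' (Fin.castAdd s i))| ≤ 1) →
      ∀ j, rhoPerm A w θ τ j ≤ C * rhoPerm A w θ τ' j := by
  obtain ⟨K, -, hK⟩ := exists_abs_log_rhoLevel_sub_le (h.perm hθ) w
  refine ⟨Real.exp K, Real.exp_pos _, fun τ τ' hτ hτ' hd j => ?_⟩
  have h1 := (abs_le.1 (hK τ τ' 1 zero_le_one hτ hτ' hd (θ.symm j))).2
  have p1 := rhoPerm_pos (w := w) h hθ hτ j
  have p2 := rhoPerm_pos (w := w) h hθ hτ' j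
  have h2 : Real.log (rhoPerm A w θ τ j) ≤ K + Real.log (rhoPerm A w θ τ' j) := by
    change Real.log (rhoPerm A w θ τ j) - Real.log (rhoPerm A w θ τ' j) ≤ _ at h1
    linarith
  rw [← Real.exp_le_exp, Real.exp_add, Real.exp_log p1, Real.exp_log p2] at h2
  exact h2

end Scaling

/-! ### Monomials on multicones -/

section Monomials
variable {m : ℕ}

/-- The value of the monomial `τ^e`. -/
def monEval (e : Fin m → ℚ) (τ : Fin m → ℝ) : ℝ := ∏ k, τ k ^ (e k : ℝ)

theorem Expo.eval_one {ℓ : ℕ} (e : Expo m ℓ) (τ : Fin m → ℝ) :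
    e.eval τ (fun _ => 1) = monEval e.1 τ := by
  simp [Expo.eval, monEval]

theorem monEval_nonneg (e : Fin m → ℚ) {τ : Fin m → ℝ} (hτ : ∀ k, 0 ≤ τ k) : 0 ≤ monEval e τ :=
  Finset.prod_nonneg fun k _ => Real.rpow_nonneg (hτ k) _

theorem monEval_add {e e' : Fin m → ℚ} {τ : Fin m → ℝ}
    (hτ : ∀ k, 0 < τ k ∨ (0 ≤ τ k ∧ 0 ≤ e k ∧ 0 ≤ e' k)) :
    monEval (e + e') τ = monEval e τ * monEval e' τ := by
  rw [monEval, monEval, monEval, ← Finset.prod_mul_distrib]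
  refine Finset.prod_congr rfl fun k _ => ?_
  rw [Pi.add_apply, Rat.cast_add]
  rcases hτ k with h | ⟨h, h1, h2⟩
  · exact Real.rpow_add h _ _
  · exact Real.rpow_add_of_nonneg h (by exact_mod_cast h1) (by exact_mod_cast h2)

theorem monEval_nsmul (e : Fin m → ℚ) {τ : Fin m → ℝ} (hτ : ∀ k, 0 ≤ τ k) (N : ℕ) :
    monEval (N • e) τ = monEval e τ ^ N := by
  rw [monEval, monEval, ← Finset.prod_pow]
  refine Finset.prod_congr rfl fun k _ => ?_
  rw [← Real.rpow_mul_natCast (hτ k)]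
  congr 1
  simp [mul_comm]

theorem monEval_mul (e : Fin m → ℚ) {τ τ' : Fin m → ℝ} (hτ : ∀ k, 0 ≤ τ k) (hτ' : ∀ k, 0 ≤ τ' k) :
    monEval e (fun k => τ k * τ' k) = monEval e τ * monEval e τ' := by
  rw [monEval, monEval, monEval, ← Finset.prod_mul_distrib]
  exact Finset.prod_congr rfl fun k _ => Real.mul_rpow (hτ k) (hτ' k)

/-- The behaviour of a monomial under the actions. -/
theorem monEval_action {ℓ : ℕ} (A : Matrix (Fin ℓ) (Fin m) ℚ) (e : Fin m → ℚ)
    {lam : Fin ℓ → ℝ} (hlam : ∀ j, 0 < lam j) :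
    monEval e (fun k => ∏ j, lam j ^ (A j k : ℝ)) =
      ∏ j, lam j ^ ((∑ k, A j k * e k : ℚ) : ℝ) := by
  simp only [monEval]
  have h1 : ∀ k, (∏ j, lam j ^ (A j k : ℝ)) ^ (e k : ℝ) =
      ∏ j, lam j ^ ((A j k : ℝ) * (e k : ℝ)) := by
    intro k
    rw [← Real.finsetProd_rpow _ _ fun j _ => Real.rpow_nonneg (hlam j).le _]
    exact Finset.prod_congr rfl fun j _ => (Real.rpow_mul (hlam j).le _ _).symm
  simp only [h1]
  rw [Finset.prod_comm]
  refine Finset.prod_congr rfl fun j _ => ?_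
  rw [← Real.rpow_sum_of_pos (hlam j)]
  push_cast
  rfl

theorem monEval_eq_exp {ℓ : ℕ} {e : Expo m ℓ} (he : e.2 = 0) {τ : Fin m → ℝ}
    (hτ : ∀ k, 0 < τ k ∨ e.1 k = 0) (x : Fin ℓ → ℝ) :
    monEval e.1 τ = Real.exp (logEval (fun k => Real.log (τ k)) x e) := by
  rw [← Expo.eval_one e, Expo.eval_eq_exp hτ fun _ => one_pos]
  congr 1
  exact logEval_congr (fun _ _ => rfl) fun j hj => absurd (congrFun he j) hj

theorem continuousAt_monEval (e : Fin m → ℚ) {τ : Fin m → ℝ} (hτ : ∀ k, τ k ≠ 0 ∨ 0 ≤ e k) :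
    ContinuousAt (monEval e) τ := by
  unfold monEval
  refine tendsto_finsetProd _ fun k _ => ?_
  have h1 : ContinuousAt (fun x : ℝ => x ^ (e k : ℝ)) (τ k) :=
    Real.continuousAt_rpow_const _ _ ((hτ k).imp id fun h => by exact_mod_cast h)
  exact h1.tendsto.comp (continuous_apply k).continuousAt

theorem exists_mul_eq_natCast {ι : Type*} [Fintype ι] (q : ι → ℚ) (hq : ∀ i, 0 ≤ q i) :
    ∃ D : ℕ, 0 < D ∧ ∀ i, ∃ N : ℕ, (D : ℚ) * q i = N := by
  refine ⟨∏ i, (q i).den, Finset.prod_pos fun i _ => (q i).pos, fun i => ?_⟩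
  obtain ⟨c, hc⟩ := Finset.dvd_prod_of_mem (fun i => (q i).den) (Finset.mem_univ i)
  refine ⟨(q i).num.natAbs * c, ?_⟩
  have h1 : (((q i).num.natAbs : ℕ) : ℚ) = (q i).num := by
    rw [← Int.cast_natCast, Int.natAbs_of_nonneg (Rat.num_nonneg.2 (hq i))]
  rw [hc]
  push_cast
  rw [h1, ← Rat.mul_den_eq_num (q i)]
  ring

end Monomials

section Setting
variable {n L r s : ℕ}

/-- The data of the theorem: a level matrix, a point whose first `L` blocks do not vanish, and a
finite set `H` of pairs without `λ` that generates, up to equivalence, the multicone semigroup `𝒢`. -/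
structure IsMulticoneSetting (A : Matrix (Fin (L + r)) (Fin (L + s)) ℚ)
    (b : Fin L → Fin (L + s) → ℚ) (blk : Fin n → Fin (L + s + 1)) (p : Fin n → ℂ)
    (H : Finset (Weighted (L + s) (L + r))) : Prop where
  level : IsLevelMatrix A b
  lead : ∀ k : Fin L, blockPart blk p (Fin.castAdd s k).succ ≠ 0
  lamExp_eq : ∀ h ∈ H, lamExp h = 0
  equiv : EquivSemigroup (Submonoid.closure (H : Set (Weighted (L + s) (L + r))) : Set _)
      (semiG A (blockNorms blk p))

variable {A : Matrix (Fin (L + r)) (Fin (L + s)) ℚ} {b : Fin L → Fin (L + s) → ℚ}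
  {blk : Fin n → Fin (L + s + 1)} {p : Fin n → ℂ} {H : Finset (Weighted (L + s) (L + r))}

theorem blockNorms_nonneg {m : ℕ} (blk : Fin n → Fin (m + 1)) (z : Fin n → ℂ) (k : Fin m) :
    0 ≤ blockNorms blk z k := norm_nonneg _

theorem zero_notMem_cone {m ℓ : ℕ} {blk : Fin n → Fin (m + 1)} {p : Fin n → ℂ}
    {H : Finset (Weighted m ℓ)} (S : Multicone blk p H) {k : Fin m}
    (hk : blockPart blk p k.succ ≠ 0) : 0 ∉ S.V k := by
  intro h0
  obtain ⟨hopen, -, hcone, hne, -⟩ := S.cone k hk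
  refine hne (Set.eq_univ_of_forall fun x => ?_)
  have h1 : ∀ᶠ t : ℝ in 𝓝[>] 0, t • x ∈ S.V k := by
    have h2 : Tendsto (fun t : ℝ => t • x) (𝓝[>] 0) (𝓝 0) := by
      have : Tendsto (fun t : ℝ => t • x) (𝓝 0) (𝓝 ((0 : ℝ) • x)) :=
        (continuous_id.smul continuous_const).tendsto 0
      rw [zero_smul] at this
      exact this.mono_left nhdsWithin_le_nhds
    exact h2 (hopen.mem_nhds h0)
  obtain ⟨t, ht, ht0⟩ := (h1.and self_mem_nhdsWithin).exists
  have ht0' : (0 : ℝ) < t := ht0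
  have := hcone t⁻¹ (inv_pos.2 ht0') _ ht
  rwa [smul_smul, inv_mul_cancel₀ ht0'.ne', one_smul] at this

theorem blockNorms_pos {m ℓ : ℕ} {blk : Fin n → Fin (m + 1)} {p : Fin n → ℂ}
    {H : Finset (Weighted m ℓ)} {S : Multicone blk p H} {z : Fin n → ℂ} (hz : z ∈ S.carrier)
    {k : Fin m} (hk : blockPart blk p k.succ ≠ 0) : 0 < blockNorms blk z k := by
  refine norm_pos_iff.2 fun h0 => zero_notMem_cone S hk ?_
  rw [← h0]; exact hz.1 k

/-- Properties of the elements of the multicone semigroup. -/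
theorem mem_closure_genG (h : IsLevelMatrix A b)
    (hlead : ∀ k : Fin L, blockPart blk p (Fin.castAdd s k).succ ≠ 0)
    {q : Weighted (L + s) (L + r)} (hq : q ∈ Submonoid.closure (genG A (blockNorms blk p))) :
    (∀ j, 0 ≤ weight A j (Multiplicative.toAdd q.1)) ∧
    (q.2 ≠ 0 → ∀ j, weight A j (Multiplicative.toAdd q.1) = 0) ∧
    ∀ k, blockPart blk p k.succ = 0 → 0 ≤ (Multiplicative.toAdd q.1).1 k := by
  induction hq using Submonoid.closure_induction with
  | mem q hq =>
    have hpsi : ∀ k k' : Fin s, (psi A k).1 (Fin.natAdd L k') = if k' = k then 1 else 0 := by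
      intro k k'
      have hne : ∀ i : Fin L, Fin.natAdd L k' ≠ Fin.castAdd s i := fun i h' => by
        have := congrArg Fin.val h'; simp at this; omega
      rw [psi_eq h]
      simp [tauE, Prod.fst_sum, Pi.single_apply, hne]
    rcases mem_elimSeq_zero hq with ⟨j, rfl⟩ | ⟨k, rfl⟩ | ⟨k, hk, rfl⟩
    · refine ⟨(isPure_genE h j).1, fun h0 => absurd rfl h0, fun k => ?_⟩
      refine Fin.addCases (fun i => fun h0 => absurd h0 (hlead i)) (fun k _ => ?_) k
      exact ((isPure_genE h j).fst_natAdd k).ge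
    · refine ⟨fun j => (weight_psi h k j).ge, fun _ j => weight_psi h k j, fun k' => ?_⟩
      refine Fin.addCases (fun i => fun h0 => absurd h0 (hlead i)) (fun k' _ => ?_) k'
      change 0 ≤ (psi A k).1 (Fin.natAdd L k')
      rw [hpsi]; split_ifs <;> norm_num
    · have hw : ∀ j, weight A j (-(psi A k)) = 0 := fun j => by rw [map_neg, weight_psi h, neg_zero]
      refine ⟨fun j => (hw j).ge, fun _ j => hw j, fun k' => ?_⟩
      refine Fin.addCases (fun i => fun h0 => absurd h0 (hlead i)) (fun k' h0 => ?_) k'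
      change 0 ≤ (-(psi A k)).1 (Fin.natAdd L k')
      have hne : k' ≠ k := by
        rintro rfl
        refine hk.ne' ?_
        rw [Expo.eval_one, monEval]
        refine Finset.prod_eq_zero (Finset.mem_univ (Fin.natAdd L k')) ?_
        rw [hpsi, if_pos rfl, blockNorms, h0]
        simp
      simp [hpsi, hne]
  | one => simp
  | mul x y _ _ hx hy =>
    have e : Multiplicative.toAdd (x * y).1 = Multiplicative.toAdd x.1 + Multiplicative.toAdd y.1 :=
      rfl
    rw [e]
    refine ⟨fun j => ?_, fun hne j => ?_, fun k hk => ?_⟩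
    · rw [map_add]; exact add_nonneg (hx.1 j) (hy.1 j)
    · have hne' : x.2 * y.2 ≠ 0 := hne
      rw [map_add, hx.2.1 (left_ne_zero_of_mul hne') j, hy.2.1 (right_ne_zero_of_mul hne') j,
        add_zero]
    · exact add_nonneg (hx.2.2 k hk) (hy.2.2 k hk)

namespace IsMulticoneSetting

/-- The weights of the elements of `H` are non-negative, they are zero if `v ≠ 0`, and the blocks
with `ζ⁽ᵏ⁾ = 0` have non-negative exponents. -/
theorem mem_H (hs : IsMulticoneSetting A b blk p H) {h : Weighted (L + s) (L + r)} (hh : h ∈ H) :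
    (∀ j, 0 ≤ ∑ k, A j k * (Multiplicative.toAdd h.1).1 k) ∧
    (h.2 ≠ 0 → ∀ j, ∑ k, A j k * (Multiplicative.toAdd h.1).1 k = 0) ∧
    ∀ k, blockPart blk p k.succ = 0 → 0 ≤ (Multiplicative.toAdd h.1).1 k := by
  obtain ⟨N₁, N₂, h1, h2, hsub, -⟩ := hs.equiv
  obtain ⟨g, ⟨hg, -⟩, hgh⟩ := hsub ⟨h, Submonoid.subset_closure hh, rfl⟩
  obtain ⟨g1, g2, g3⟩ := mem_closure_genG hs.level hs.lead hg
  have e1 : (N₂ : ℚ) • Multiplicative.toAdd g.1 = (N₁ : ℚ) • Multiplicative.toAdd h.1 := by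
    have := congrArg (fun q => Multiplicative.toAdd q.1) hgh
    simpa [Nat.cast_smul_eq_nsmul] using this
  have e2 : g.2 ^ N₂ = h.2 ^ N₁ := by
    have := congrArg Prod.snd hgh
    simpa using this
  have hN1 : (0 : ℚ) < N₁ := by exact_mod_cast h1
  have hN2 : (0 : ℚ) < N₂ := by exact_mod_cast h2
  have hw : ∀ j, (N₁ : ℚ) * ∑ k, A j k * (Multiplicative.toAdd h.1).1 k =
      N₂ * weight A j (Multiplicative.toAdd g.1) := by
    intro j
    have h0 : weight A j (Multiplicative.toAdd h.1) =
        ∑ k, A j k * (Multiplicative.toAdd h.1).1 k := by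
      have : (Multiplicative.toAdd h.1).2 j = 0 := congrFun (hs.lamExp_eq h hh) j
      rw [weight_apply, this, add_zero]
    have h3 := congrArg (weight A j) e1
    rw [map_smul, map_smul, smul_eq_mul, smul_eq_mul] at h3
    rw [← h0, h3]
  refine ⟨fun j => ?_, fun hne j => ?_, fun k hk => ?_⟩
  · have := mul_nonneg hN2.le (g1 j)
    rw [← hw] at this
    exact nonneg_of_mul_nonneg_right this hN1
  · have hg : g.2 ≠ 0 := by
      intro h0
      rw [h0, zero_pow h2.ne'] at e2
      exact pow_ne_zero _ hne e2.symm
    have := hw j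
    rw [g2 hg j, mul_zero] at this
    exact (mul_eq_zero.1 this).resolve_left hN1.ne'
  · have h3 := congrFun (congrArg Prod.fst e1) k
    have h4 : (N₂ : ℚ) * (Multiplicative.toAdd g.1).1 k =
      N₁ * (Multiplicative.toAdd h.1).1 k := h3
    have := mul_nonneg hN2.le (g3 k hk)
    rw [h4] at this
    exact nonneg_of_mul_nonneg_right this hN1

/-- The monomials of the multicone semigroup are bounded on multicones, because some power of them
is a product of elements of `H`. -/
theorem exists_monEval_le (hs : IsMulticoneSetting A b blk p H) (S : Multicone blk p H)
    {g : Weighted (L + s) (L + r)} (hg : g ∈ semiG A (blockNorms blk p)) :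
    ∃ B : ℝ, 1 ≤ B ∧ ∀ z ∈ S.carrier,
      monEval (Multiplicative.toAdd g.1).1 (blockNorms blk z) ≤ B := by
  obtain ⟨N₁, N₂, h1, h2, -, hsub⟩ := hs.equiv
  have hmem := hsub ⟨g, hg, rfl⟩
  have key : ∀ q ∈ Submonoid.closure (H : Set (Weighted (L + s) (L + r))),
      (∀ k, blockPart blk p k.succ = 0 → 0 ≤ (Multiplicative.toAdd q.1).1 k) ∧
      ∃ B : ℝ, 1 ≤ B ∧ ∀ z ∈ S.carrier,
        monEval (Multiplicative.toAdd q.1).1 (blockNorms blk z) ≤ B := by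
    intro q hq
    induction hq using Submonoid.closure_induction with
    | mem q hq =>
      refine ⟨(hs.mem_H hq).2.2, max 1 (q.2 + S.epsPlus q), le_max_left _ _, fun z hz => ?_⟩
      rw [← Expo.eval_one (Multiplicative.toAdd q.1)]
      exact (hz.2.2 q hq).2.le.trans (le_max_right _ _)
    | one => exact ⟨fun k _ => le_rfl, 1, le_rfl, fun z hz => by simp [monEval]⟩
    | mul x y _ _ hx hy =>
      obtain ⟨hx0, B, hB, hxB⟩ := hx
      obtain ⟨hy0, B', hB', hyB⟩ := hy
      refine ⟨fun k hk => add_nonneg (hx0 k hk) (hy0 k hk), B * B',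
        one_le_mul_of_one_le_of_one_le hB hB', fun z hz => ?_⟩
      have e : (Multiplicative.toAdd (x * y).1).1 =
        (Multiplicative.toAdd x.1).1 + (Multiplicative.toAdd y.1).1 := rfl
      rw [e, monEval_add]
      · exact mul_le_mul (hxB z hz) (hyB z hz) (monEval_nonneg _ (blockNorms_nonneg blk z))
          (by linarith)
      · intro k
        by_cases hk : blockPart blk p k.succ = 0
        · exact Or.inr ⟨blockNorms_nonneg blk z k, hx0 k hk, hy0 k hk⟩
        · exact Or.inl (blockNorms_pos hz hk)
  obtain ⟨-, B, hB, hzB⟩ := key _ hmem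
  refine ⟨B, hB, fun z hz => ?_⟩
  have := hzB z hz
  have e : (Multiplicative.toAdd ((fun p => p ^ N₂) g).1).1 =
    N₂ • (Multiplicative.toAdd g.1).1 := by
    simp
  rw [e, monEval_nsmul _ (blockNorms_nonneg blk z)] at this
  by_cases h' : 1 ≤ monEval (Multiplicative.toAdd g.1).1 (blockNorms blk z)
  · exact (le_self_pow₀ h' h2.ne').trans this
  · linarith

/-- The monomials `τ'^t` of non-negative weights are bounded on multicones. -/
theorem exists_monEval_le_of_weight_nonneg (hs : IsMulticoneSetting A b blk p H)
    (S : Multicone blk p H) {e : Expo (L + s) (L + r)} (he2 : e.2 = 0)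
    (he1 : ∀ k : Fin s, e.1 (Fin.natAdd L k) = 0) (hw : ∀ j, 0 ≤ weight A j e) :
    ∃ B : ℝ, 1 ≤ B ∧ ∀ z ∈ S.carrier, monEval e.1 (blockNorms blk z) ≤ B := by
  -- a monomial in `τ'` is a product of powers of the `φ_i⁻¹` and `λ_j`, with its weights as exponents
  have hpure : e = ∑ j, weight A j e • genE A j := by
    have h1 : e = ∑ i : Fin L, e.1 (Fin.castAdd s i) • tauE (Fin.castAdd s i) := by
      refine Prod.ext ?_ ?_
      · funext k
        refine Fin.addCases (fun i => ?_) (fun k => ?_) k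
        · simp [tauE, Prod.fst_sum, Pi.single_apply]
        · have hne : ∀ i : Fin L, Fin.natAdd L k ≠ Fin.castAdd s i := fun i h' => by
            have := congrArg Fin.val h'; simp at this; omega
          simp [tauE, Prod.fst_sum, he1, hne]
      · rw [he2]; simp [tauE, Prod.snd_sum]
    have h2 : ∀ j, weight A j e = ∑ i : Fin L, A j (Fin.castAdd s i) * e.1 (Fin.castAdd s i) := by
      intro j
      rw [weight_apply, he2, Fin.sum_univ_add]
      simp [he1]
    simp only [h2]
    nth_rewrite 1 [h1]
    simp only [← sum_smul_genE_castAdd hs.level, Finset.smul_sum, smul_smul]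
    rw [Finset.sum_comm]
    refine Finset.sum_congr rfl fun j _ => ?_
    rw [Finset.sum_smul]
    exact Finset.sum_congr rfl fun i _ => by rw [mul_comm]
  obtain ⟨D, hD, hN⟩ := exists_mul_eq_natCast (fun j => weight A j e) hw
  choose N hN using hN
  set g : Weighted (L + s) (L + r) := ∏ j, mkPair (genE A j) 0 ^ N j with hg
  have hexp : Multiplicative.toAdd g.1 = D • e := by
    have : Multiplicative.toAdd g.1 = ∑ j, N j • genE A j := by
      rw [hg, Prod.fst_prod, toAdd_prod]
      rfl
    rw [this]
    conv_rhs => rw [hpure]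
    rw [Finset.smul_sum]
    refine Finset.sum_congr rfl fun j _ => ?_
    rw [← Nat.cast_smul_eq_nsmul ℚ, ← Nat.cast_smul_eq_nsmul ℚ, smul_smul, hN]
  have hmem : g ∈ semiG A (blockNorms blk p) := by
    refine ⟨prod_mem fun j _ => pow_mem (Submonoid.subset_closure (mkPair_genE_mem j)) _, ?_⟩
    change (Multiplicative.toAdd g.1).2 = 0
    rw [hexp]; simp [he2]
  obtain ⟨B, hB, hzB⟩ := hs.exists_monEval_le S hmem
  refine ⟨B, hB, fun z hz => ?_⟩
  have := hzB z hz
  rw [hexp, Prod.smul_fst, monEval_nsmul _ (blockNorms_nonneg blk z)] at this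
  by_cases h' : 1 ≤ monEval e.1 (blockNorms blk z)
  · exact (le_self_pow₀ h' hD.ne').trans this
  · linarith

theorem lead_pos (hs : IsMulticoneSetting A b blk p H) {S : Multicone blk p H} {z : Fin n → ℂ}
    (hz : z ∈ S.carrier) (i : Fin L) : 0 < blockNorms blk z (Fin.castAdd s i) :=
  blockNorms_pos hz (hs.lead i)

/-- For every order of the actions the elimination ends with monomials in `τ'` of non-negative
weights; these are bounded on multicones, and they bound the level functions. -/
theorem exists_rhoPerm_le_const (hs : IsMulticoneSetting A b blk p H) (S : Multicone blk p H)
    {θ : Equiv.Perm (Fin (L + r))} (hθ : Admissible A θ) :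
    ∃ B : ℝ, 1 ≤ B ∧ ∀ z ∈ S.carrier, ∀ j,
      rhoPerm A (blockNorms blk p) θ (blockNorms blk z) j ≤ B := by
  set w := blockNorms blk p
  have hA := hs.level.perm hθ
  have hbd : ∀ q ∈ elimSeq (A.submatrix θ id) w r, ∃ M : ℝ,
      IsPure (A.submatrix θ id) (Multiplicative.toAdd q.1) → ∀ z ∈ S.carrier,
      logEval (fun k => Real.log (blockNorms blk z k))
        (logLower (A.submatrix θ id) w (blockNorms blk z)) (Multiplicative.toAdd q.1) ≤ M := by
    intro q hq
    by_cases hpure : IsPure (A.submatrix θ id) (Multiplicative.toAdd q.1)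
    swap
    · exact ⟨0, fun h => absurd h hpure⟩
    have h2 : (Multiplicative.toAdd q.1).2 = 0 := by
      rcases elimSeq_cases hA le_rfl hq with h' | h'
      · funext j
        refine Fin.addCases (fun i => hpure.snd_castAdd i) (fun u => h'.2 u u.2) j
      · exact h'
    obtain ⟨B, hB, hzB⟩ := hs.exists_monEval_le_of_weight_nonneg S h2 hpure.fst_natAdd fun j => by
      have := hpure.1 (θ.symm j)
      simpa [weight_apply, h2] using this
    refine ⟨Real.log B, fun _ z hz => ?_⟩
    rw [Real.le_log_iff_exp_le (by linarith), ← monEval_eq_exp h2]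
    · exact hzB z hz
    · intro k
      refine Fin.addCases (fun i => Or.inl (hs.lead_pos hz i)) (fun k => Or.inr ?_) k
      exact hpure.fst_natAdd k
  choose! M hM using hbd
  obtain ⟨Q, hQ⟩ := ((finite_elimSeq (A := A.submatrix θ id) (w := w) r).image M).bddAbove
  refine ⟨Real.exp (max Q 0), Real.one_le_exp (le_max_right _ _), fun z hz j => ?_⟩
  refine rhoLevel_le_exp hA (hs.lead_pos hz) (le_max_right _ _) (fun q hq hpure => ?_) _
  exact (hM q hq hpure z hz).trans ((hQ (Set.mem_image_of_mem _ hq)).trans (le_max_left _ _))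

end IsMulticoneSetting

/-- `R_k(τ') = ∏_{i ≤ L} τ_i ^ b_{ik} = φ_k(ρ_Λ(τ'))`, the size of the block `z⁽ᵏ⁾` in a multicone. -/
def blockScale (b : Fin L → Fin (L + s) → ℚ) (τ : Fin (L + s) → ℝ) (k : Fin (L + s)) : ℝ :=
  ∏ i, τ (Fin.castAdd s i) ^ (b i k : ℝ)

theorem blockScale_pos {τ : Fin (L + s) → ℝ} (hτ : ∀ i : Fin L, 0 < τ (Fin.castAdd s i))
    (k : Fin (L + s)) : 0 < blockScale b τ k :=
  Finset.prod_pos fun i _ => Real.rpow_pos_of_pos (hτ i) _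

theorem blockScale_castAdd (h : IsLevelMatrix A b) (τ : Fin (L + s) → ℝ) (k : Fin L) :
    blockScale b τ (Fin.castAdd s k) = τ (Fin.castAdd s k) := by
  rw [blockScale, Finset.prod_eq_single k]
  · simp [b_castAdd h]
  · intro i _ hi; simp [b_castAdd h, hi]
  · simp

theorem prod_rhoPerm_rpow (h : IsLevelMatrix A b) {θ : Equiv.Perm (Fin (L + r))}
    (hθ : Admissible A θ) {w τ : Fin (L + s) → ℝ} (hτ : ∀ i : Fin L, 0 < τ (Fin.castAdd s i))
    (k : Fin (L + s)) : ∏ j, rhoPerm A w θ τ j ^ (A j k : ℝ) = blockScale b τ k := by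
  have h1 := congrArg Real.exp (sum_mul_log_rhoPerm (w := w) h hθ hτ k)
  rw [Real.exp_sum, Real.exp_sum] at h1
  rw [blockScale]
  convert h1 using 1
  · refine Finset.prod_congr rfl fun j _ => ?_
    rw [Real.rpow_def_of_pos (rhoPerm_pos h hθ hτ j), mul_comm]
  · refine Finset.prod_congr rfl fun j _ => ?_
    rw [Real.rpow_def_of_pos (hτ j), mul_comm]

theorem monEval_psi (h : IsLevelMatrix A b) {τ : Fin (L + s) → ℝ}
    (hτ : ∀ i : Fin L, 0 < τ (Fin.castAdd s i)) (k : Fin s) :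
    monEval (psi A k).1 τ = τ (Fin.natAdd L k) / blockScale b τ (Fin.natAdd L k) := by
  have hne : ∀ (i : Fin L) (k : Fin s), Fin.natAdd L k ≠ Fin.castAdd s i := fun i k h' => by
    have := congrArg Fin.val h'; simp at this; omega
  have h1 : ∀ k' : Fin s, (psi A k).1 (Fin.natAdd L k') = if k' = k then 1 else 0 := by
    intro k'
    rw [psi_eq h]
    simp [tauE, Prod.fst_sum, Pi.single_apply, hne]
  have h2 : ∀ i : Fin L, (psi A k).1 (Fin.castAdd s i) = -b i (Fin.natAdd L k) := by
    intro i
    rw [psi_eq h]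
    simp [tauE, Prod.fst_sum, Pi.single_apply, (hne _ _).symm]
  rw [monEval, Fin.prod_univ_add, Finset.prod_eq_single (a := k) (s := Finset.univ), mul_comm,
    div_eq_mul_inv, blockScale, ← Finset.prod_inv_distrib]
  · congr 1
    · simp [h1]
    · refine Finset.prod_congr rfl fun i _ => ?_
      rw [h2]; push_cast
      exact Real.rpow_neg (hτ i).le _
  · intro k' _ hk'; simp [h1, hk']
  · simp

namespace IsMulticoneSetting

/-- The blocks of a point of a multicone are bounded by `R_k`, and comparable to `R_k` if
`ζ⁽ᵏ⁾ ≠ 0`. -/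
theorem exists_blockNorms_le (hs : IsMulticoneSetting A b blk p H) (S : Multicone blk p H) :
    ∃ B : ℝ, 1 ≤ B ∧ ∀ z ∈ S.carrier, ∀ k,
      blockNorms blk z k ≤ B * blockScale b (blockNorms blk z) k ∧
      (blockPart blk p k.succ ≠ 0 →
        blockScale b (blockNorms blk z) k ≤ B * blockNorms blk z k) := by
  have hone : ∀ k, ∃ B : ℝ, 1 ≤ B ∧ ∀ z ∈ S.carrier,
      blockNorms blk z k ≤ B * blockScale b (blockNorms blk z) k ∧
      (blockPart blk p k.succ ≠ 0 →
        blockScale b (blockNorms blk z) k ≤ B * blockNorms blk z k) := by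
    intro k
    refine Fin.addCases (fun i => ?_) (fun k => ?_) k
    · refine ⟨1, le_rfl, fun z hz => ?_⟩
      rw [blockScale_castAdd hs.level, one_mul]
      exact ⟨le_rfl, fun _ => le_rfl⟩
    · have hpsi : mkPair (psi A k) (Real.toNNReal ((psi A k).eval (blockNorms blk p) fun _ => 1)) ∈
          genG A (blockNorms blk p) := Or.inl (Or.inl (Or.inr ⟨k, rfl⟩))
      have hmem1 : mkPair (psi A k) (Real.toNNReal ((psi A k).eval (blockNorms blk p) fun _ => 1)) ∈
          semiG A (blockNorms blk p) := ⟨Submonoid.subset_closure hpsi, psi_snd hs.level k⟩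
      obtain ⟨B, hB, hzB⟩ := hs.exists_monEval_le S hmem1
      have hle : ∀ z ∈ S.carrier, blockNorms blk z (Fin.natAdd L k) ≤
          B * blockScale b (blockNorms blk z) (Fin.natAdd L k) := by
        intro z hz
        have h1 : monEval (psi A k).1 (blockNorms blk z) ≤ B := hzB z hz
        rw [monEval_psi hs.level (hs.lead_pos hz)] at h1
        exact (div_le_iff₀ (blockScale_pos (hs.lead_pos hz) _)).1 h1
      by_cases hk : blockPart blk p (Fin.natAdd L k).succ = 0
      · exact ⟨B, hB, fun z hz => ⟨hle z hz, fun h' => absurd hk h'⟩⟩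
      · have hpos : 0 < (psi A k).eval (blockNorms blk p) fun _ => 1 := by
          have hlead : ∀ i : Fin L, 0 < blockNorms blk p (Fin.castAdd s i) := fun i =>
            norm_pos_iff.2 (hs.lead i)
          rw [Expo.eval_one, monEval_psi hs.level hlead]
          exact div_pos (norm_pos_iff.2 hk) (blockScale_pos hlead _)
        have hmem2 : (mkPair (psi A k) (Real.toNNReal
            ((psi A k).eval (blockNorms blk p) fun _ => 1)))⁻¹ ∈ semiG A (blockNorms blk p) := by
          refine ⟨Submonoid.subset_closure (Or.inr ⟨_, Or.inl (Or.inr ⟨k, rfl⟩), ?_, rfl⟩), ?_⟩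
          · exact (Real.toNNReal_pos.2 hpos).ne'
          · change (-(psi A k)).2 = 0
            rw [Prod.snd_neg, psi_snd hs.level, neg_zero]
        obtain ⟨B', hB', hzB'⟩ := hs.exists_monEval_le S hmem2
        refine ⟨max B B', le_max_of_le_left hB, fun z hz => ⟨(hle z hz).trans ?_, fun _ => ?_⟩⟩
        · exact mul_le_mul_of_nonneg_right (le_max_left _ _)
            (blockScale_pos (hs.lead_pos hz) _).le
        · have h1 : monEval (-(psi A k).1) (blockNorms blk z) ≤ B' := hzB' z hz
          have h2 : monEval (-(psi A k).1) (blockNorms blk z) =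
              (monEval (psi A k).1 (blockNorms blk z))⁻¹ := by
            simp only [monEval, ← Finset.prod_inv_distrib]
            refine Finset.prod_congr rfl fun k _ => ?_
            rw [Pi.neg_apply, Rat.cast_neg, Real.rpow_neg (blockNorms_nonneg blk z k)]
          rw [h2, monEval_psi hs.level (hs.lead_pos hz), inv_div,
            div_le_iff₀ (blockNorms_pos hz hk)] at h1
          exact h1.trans (mul_le_mul_of_nonneg_right (le_max_right _ _)
            (blockNorms_nonneg blk z _))
  choose B hB hzB using hone
  refine ⟨1 + ∑ k, B k, by
    have := Finset.sum_nonneg (s := Finset.univ) fun k _ => zero_le_one.trans (hB k)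
    linarith, fun z hz k => ?_⟩
  have hle : B k ≤ 1 + ∑ k, B k := by
    have := Finset.single_le_sum (s := Finset.univ) (fun k _ => zero_le_one.trans (hB k))
      (Finset.mem_univ k)
    linarith
  refine ⟨(hzB k z hz).1.trans ?_, fun hk => ((hzB k z hz).2 hk).trans ?_⟩
  · exact mul_le_mul_of_nonneg_right hle (blockScale_pos (hs.lead_pos hz) _).le
  · exact mul_le_mul_of_nonneg_right hle (blockNorms_nonneg blk z _)

end IsMulticoneSetting

end Setting

/-! ### Cones and properly contained multicones -/

section Cones
variable {E : Type*} [NormedAddCommGroup E] [NormedSpace ℝ E]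

theorem exists_pos_on_cone {V : Set E} (ho : IsOpen V) (hc : Convex ℝ V) (h0 : 0 ∉ V) :
    ∃ u : E →L[ℝ] ℝ, ∀ x ∈ V, 0 < u x := by
  obtain ⟨u, hu⟩ := geometric_hahn_banach_point_open hc ho h0
  exact ⟨u, fun x hx => by simpa using hu x hx⟩

/-- A compact convex set in a hyperplane section of an open convex cone is contained in an open
convex cone which is properly contained in the given cone: the cone over a thickening. -/
theorem exists_cone_between {V : Set E} (ho : IsOpen V) (hcone : ∀ t : ℝ, 0 < t → ∀ x ∈ V, t • x ∈ V)
    {u : E →L[ℝ] ℝ} {K : Set E} (hK : IsCompact K) (hKc : Convex ℝ K)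
    (hKV : K ⊆ V) (hKu : ∀ x ∈ K, u x = 1) :
    ∃ W : Set E, IsOpen W ∧ Convex ℝ W ∧ (∀ t : ℝ, 0 < t → ∀ x ∈ W, t • x ∈ W) ∧ 0 ∉ W ∧ K ⊆ W ∧
      closure W \ {0} ⊆ V := by
  obtain ⟨δ, hδ, hδV⟩ := hK.exists_cthickening_subset_open ho hKV
  set T := Metric.thickening δ K
  have hT : IsOpen T := Metric.isOpen_thickening
  have hTc : Convex ℝ T := hKc.thickening δ
  obtain ⟨M, hM⟩ := hK.isBounded.thickening (δ := δ) |>.exists_norm_le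
  refine ⟨{x | 0 < u x ∧ (u x)⁻¹ • x ∈ T}, ?_, ?_, ?_, ?_, ?_, ?_⟩
  · have h1 : ContinuousOn (fun x => (u x)⁻¹ • x) {x | 0 < u x} := by
      refine ContinuousOn.smul (ContinuousOn.inv₀ u.continuous.continuousOn ?_) continuousOn_id
      exact fun x hx => (ne_of_gt hx)
    exact h1.isOpen_inter_preimage (isOpen_lt continuous_const u.continuous) hT
  · rintro x ⟨hx, hxT⟩ y ⟨hy, hyT⟩ a c ha hc' hac
    have hpos : 0 < u (a • x + c • y) := by
      simp only [map_add, map_smul, smul_eq_mul]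
      rcases ha.eq_or_lt with h | h
      · have : c = 1 := by linarith
        simp [← h, this, hy]
      · have := mul_pos h hx
        have := mul_nonneg hc' hy.le
        linarith
    refine ⟨hpos, ?_⟩
    have hsum : u (a • x + c • y) = a * u x + c * u y := by simp
    have := hTc hxT hyT (a := a * u x / u (a • x + c • y)) (b := c * u y / u (a • x + c • y))
      (div_nonneg (mul_nonneg ha hx.le) hpos.le) (div_nonneg (mul_nonneg hc' hy.le) hpos.le) (by
        rw [← add_div, ← hsum, div_self hpos.ne'])
    convert! this using 1
    rw [smul_add, smul_smul, smul_smul, smul_smul, smul_smul]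
    congr 2
    · field_simp
    · field_simp
  · rintro t ht x ⟨hx, hxT⟩
    have : u (t • x) = t * u x := by simp
    refine ⟨by rw [this]; exact mul_pos ht hx, ?_⟩
    rw [this, smul_smul]
    convert hxT using 2
    field_simp
  · rintro ⟨h, -⟩; simp at h
  · intro x hx
    refine ⟨by rw [hKu x hx]; exact one_pos, ?_⟩
    rw [hKu x hx, inv_one, one_smul]
    exact Metric.self_subset_thickening hδ K hx
  · rintro x ⟨hx, hx0⟩
    have hle : ‖x‖ ≤ M * u x := by
      have hcl : IsClosed {y : E | ‖y‖ ≤ M * u y} :=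
        isClosed_le continuous_norm (continuous_const.mul u.continuous)
      refine closure_minimal ?_ hcl hx
      rintro y ⟨hy, hyT⟩
      have h1 := hM _ hyT
      rw [norm_smul, norm_inv, Real.norm_of_nonneg hy.le, inv_mul_le_iff₀ hy] at h1
      change ‖y‖ ≤ M * u y
      linarith
    have hxn : 0 < ‖x‖ := norm_pos_iff.2 hx0
    have hux : 0 < u x := by
      obtain ⟨y, hy, hyT⟩ := closure_nonempty_iff.1 ⟨x, hx⟩
      have hM0 : 0 ≤ M := (norm_nonneg _).trans (hM _ hyT)
      by_contra! hcon
      have := mul_nonpos_of_nonneg_of_nonpos hM0 hcon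
      linarith
    have hc1 : ContinuousAt (fun x => (u x)⁻¹ • x) x :=
      (u.continuous.continuousAt.inv₀ hux.ne').smul continuousAt_id
    have hcl : (u x)⁻¹ • x ∈ closure T := by
      refine closure_mono ?_ (mem_closure_image (f := fun x => (u x)⁻¹ • x) hc1 hx)
      rintro _ ⟨y, hy, rfl⟩
      exact hy.2
    have := hcone (u x) hux _ (hδV (Metric.closure_thickening_subset_cthickening δ K hcl))
    rwa [smul_smul, mul_inv_cancel₀ hux.ne', one_smul] at this

/-- The section of `closure V'` with a hyperplane `u = 1` is compact, as `u` is bounded below on the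
points of norm `1` of `closure V'`. -/
theorem exists_cone_between_closure [ProperSpace E] {V V' : Set E} (ho : IsOpen V)
    (hc : Convex ℝ V) (hcone : ∀ t : ℝ, 0 < t → ∀ x ∈ V, t • x ∈ V) (h0 : 0 ∉ V)
    (hc' : Convex ℝ V') (hcone' : ∀ t : ℝ, 0 < t → ∀ x ∈ V', t • x ∈ V')
    (hsub : closure V' \ {0} ⊆ V) :
    ∃ W : Set E, IsOpen W ∧ Convex ℝ W ∧ (∀ t : ℝ, 0 < t → ∀ x ∈ W, t • x ∈ W) ∧ 0 ∉ W ∧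
      closure V' \ {0} ⊆ W ∧ closure W \ {0} ⊆ V := by
  obtain ⟨u, hu⟩ := exists_pos_on_cone ho hc h0
  have hcl : ∀ t : ℝ, 0 < t → ∀ x ∈ closure V', t • x ∈ closure V' := by
    intro t ht x hx
    refine closure_mono ?_ (mem_closure_image (f := fun x : E => t • x)
      (by fun_prop : ContinuousAt (fun x : E => t • x) x) hx)
    rintro _ ⟨y, hy, rfl⟩
    exact hcone' t ht y hy
  have hKV : closure V' ∩ {x | u x = 1} ⊆ V := fun x hx => hsub ⟨hx.1, fun h => by
    have h2 : u x = 1 := hx.2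
    rw [Set.mem_singleton_iff.1 h] at h2
    simp at h2⟩
  have hcompact : IsCompact (closure V' ∩ {x | u x = 1}) := by
    obtain ⟨c, hc0, hcu⟩ := (((isCompact_sphere (0 : E) 1).inter_left
      (isClosed_closure (s := V'))).exists_forall_le' (f := u) u.continuous.continuousOn (a := 0)
      fun x hx => hu x (hsub ⟨hx.1, fun h => by
        have h2 := hx.2
        rw [Set.mem_singleton_iff.1 h] at h2
        simp at h2⟩))
    refine (isCompact_closedBall (0 : E) c⁻¹).of_isClosed_subset
      (isClosed_closure.inter (isClosed_eq u.continuous continuous_const)) fun x hx => ?_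
    have hx1 : u x = 1 := hx.2
    have hxn : 0 < ‖x‖ := norm_pos_iff.2 fun h => by rw [h] at hx1; simp at hx1
    have := hcu (‖x‖⁻¹ • x) ⟨hcl _ (inv_pos.2 hxn) x hx.1, by
      rw [mem_sphere_zero_iff_norm, norm_smul, norm_inv, norm_norm, inv_mul_cancel₀ hxn.ne']⟩
    rw [map_smul, hx1, smul_eq_mul, mul_one] at this
    rw [mem_closedBall_zero_iff]
    exact (le_inv_comm₀ hc0 hxn).1 this
  have hconv : Convex ℝ (closure V' ∩ {x | u x = 1}) :=
    hc'.closure.inter (convex_hyperplane u.toLinearMap.isLinear 1)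
  obtain ⟨W, h1, h2, h3, h4, h5, h6⟩ := exists_cone_between ho hcone hcompact hconv hKV
    (fun x hx => hx.2)
  refine ⟨W, h1, h2, h3, h4, fun x hx => ?_, h6⟩
  have hux := hu x (hsub hx)
  have := h3 (u x) hux _ (h5 (a := (u x)⁻¹ • x) ⟨hcl _ (inv_pos.2 hux) x hx.1, by
    simp [hux.ne']⟩)
  rwa [smul_smul, mul_inv_cancel₀ hux.ne', one_smul] at this

theorem exists_cone_between_pair {V : Set E} (ho : IsOpen V) (hc : Convex ℝ V)
    (hcone : ∀ t : ℝ, 0 < t → ∀ x ∈ V, t • x ∈ V) (h0 : 0 ∉ V) {x y : E} (hx : x ∈ V)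
    (hy : y ∈ V) :
    ∃ W : Set E, IsOpen W ∧ Convex ℝ W ∧ (∀ t : ℝ, 0 < t → ∀ x ∈ W, t • x ∈ W) ∧ 0 ∉ W ∧
      x ∈ W ∧ y ∈ W ∧ closure W \ {0} ⊆ V := by
  obtain ⟨u, hu⟩ := exists_pos_on_cone ho hc h0
  have hxu := hu x hx
  have hyu := hu y hy
  have hx' := hcone _ (inv_pos.2 hxu) x hx
  have hy' := hcone _ (inv_pos.2 hyu) y hy
  have hcompact : IsCompact (segment ℝ ((u x)⁻¹ • x) ((u y)⁻¹ • y)) := by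
    rw [segment_eq_image]
    exact isCompact_Icc.image (by fun_prop)
  have hsegu : ∀ z ∈ segment ℝ ((u x)⁻¹ • x) ((u y)⁻¹ • y), u z = 1 := by
    rintro _ ⟨a, c, -, -, hac, rfl⟩
    simp [hxu.ne', hyu.ne', hac]
  obtain ⟨W, h1, h2, h3, h4, h5, h6⟩ := exists_cone_between ho hcone hcompact (convex_segment _ _)
    (hc.segment_subset hx' hy') hsegu
  refine ⟨W, h1, h2, h3, h4, ?_, ?_, h6⟩
  · have := h3 _ hxu _ (h5 (left_mem_segment ℝ _ _))
    rwa [smul_smul, mul_inv_cancel₀ hxu.ne', one_smul] at this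
  · have := h3 _ hyu _ (h5 (right_mem_segment ℝ _ _))
    rwa [smul_smul, mul_inv_cancel₀ hyu.ne', one_smul] at this

/-- A property that holds near the diagonal points of a compact set holds uniformly. -/
theorem exists_forall_dist_lt_of_isCompact {X : Type*} [PseudoMetricSpace X] {K : Set X}
    (hK : IsCompact K) {P : X → X → Prop} (hP : ∀ x ∈ K, ∀ᶠ q : X × X in 𝓝 (x, x), P q.1 q.2) :
    ∃ δ > 0, ∀ x ∈ K, ∀ y, dist y x < δ → P x y := by
  have hdiag : IsCompact ((fun x => (x, x)) '' K) := hK.image (by fun_prop)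
  obtain ⟨δ, hδ, hsub⟩ := hdiag.exists_cthickening_subset_open
    (isOpen_interior (s := {q : X × X | P q.1 q.2})) (by
      rintro _ ⟨x, hx, rfl⟩
      exact mem_interior_iff_mem_nhds.2 (hP x hx))
  refine ⟨δ, hδ, fun x hx y hxy => ?_⟩
  have : (x, y) ∈ Metric.cthickening δ ((fun x => (x, x)) '' K) := by
    refine Metric.thickening_subset_cthickening _ _ (Metric.mem_thickening_iff.2
      ⟨(x, x), ⟨x, hx, rfl⟩, ?_⟩)
    rw [Prod.dist_eq]
    exact max_lt (by simpa using hδ) hxy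
  exact (show (x, y) ∈ {q : X × X | P q.1 q.2} from interior_subset (hsub this))

end Cones

section Between
variable {n m ℓ : ℕ} {blk : Fin n → Fin (m + 1)} {p : Fin n → ℂ} {H : Finset (Weighted m ℓ)}

theorem Multicone.ProperIn.subset {S' S : Multicone blk p H} (h : S'.ProperIn S) :
    S'.carrier ⊆ S.carrier := by
  intro z hz
  refine ⟨fun k => ?_, hz.2.1.trans h.2.1, fun q hq => ?_⟩
  · by_cases hk : blockPart blk p k.succ = 0
    · rw [S.whole k hk]; trivial
    · refine h.1 k ⟨subset_closure (hz.1 k), fun h0 => zero_notMem_cone S' hk ?_⟩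
      rw [← Set.mem_singleton_iff.1 h0]; exact hz.1 k
  · have h1 := hz.2.2 q hq
    have h2 := h.2.2 q hq
    exact ⟨by linarith, by linarith⟩

theorem Multicone.ProperIn.exists_between {S' S : Multicone blk p H} (h : S'.ProperIn S) :
    ∃ S'' : Multicone blk p H, S''.ProperIn S ∧ S'.ProperIn S'' := by
  have hV : ∀ k : Fin m, ∃ W : Set ({i // blk i = k.succ} → ℂ), (blockPart blk p k.succ ≠ 0 →
      IsOpen W ∧ Convex ℝ W ∧ (∀ t : ℝ, 0 < t → ∀ x ∈ W, t • x ∈ W) ∧ W ≠ Set.univ ∧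
      blockPart blk p k.succ ∈ W) ∧ (blockPart blk p k.succ = 0 → W = Set.univ) ∧
      closure (S'.V k) \ {0} ⊆ W ∧ closure W \ {0} ⊆ S.V k := by
    intro k
    by_cases hk : blockPart blk p k.succ = 0
    · refine ⟨Set.univ, fun h' => absurd hk h', fun _ => rfl, Set.subset_univ _, ?_⟩
      rw [S.whole k hk]; exact Set.subset_univ _
    · obtain ⟨a1, a2, a3, -, -⟩ := S.cone k hk
      obtain ⟨b1, b2, b3, -, b5⟩ := S'.cone k hk
      obtain ⟨W, w1, w2, w3, w4, w5, w6⟩ := exists_cone_between_closure a1 a2 a3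
        (zero_notMem_cone S hk) b2 b3 (h.1 k)
      refine ⟨W, fun _ => ⟨w1, w2, w3, fun hu => w4 (hu ▸ Set.mem_univ _), w5
        ⟨subset_closure b5, hk⟩⟩, fun h' => absurd h' hk, w5, w6⟩
  choose W w1 w2 w3 w4 using hV
  refine ⟨⟨W, (S'.eps0 + S.eps0) / 2, fun q => (S'.epsPlus q + S.epsPlus q) / 2,
    fun q => (S'.epsMinus q + S.epsMinus q) / 2, w1, w2, ?_, ?_, ?_⟩, ⟨w4, ?_, ?_⟩, ⟨w3, ?_, ?_⟩⟩
  · have := S.eps0_pos; have := S'.eps0_pos; linarith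
  · intro q hq; have := S.epsPlus_pos q hq; have := S'.epsPlus_pos q hq; linarith
  · intro q hq; have := S.epsMinus_pos q hq; have := S'.epsMinus_pos q hq; linarith
  · have := h.2.1; simp only; linarith
  · intro q hq; have := h.2.2 q hq; simp only; exact ⟨by linarith, by linarith⟩
  · have := h.2.1; simp only; linarith
  · intro q hq; have := h.2.2 q hq; simp only; exact ⟨by linarith, by linarith⟩

/-- The multicones that are properly contained in `S` exhaust `S`. -/
theorem Multicone.exists_properIn_mem {S : Multicone blk p H} {z : Fin n → ℂ}
    (hz : z ∈ S.carrier) : ∃ S' : Multicone blk p H, S'.ProperIn S ∧ z ∈ S'.carrier := by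
  have hV : ∀ k : Fin m, ∃ W : Set ({i // blk i = k.succ} → ℂ), (blockPart blk p k.succ ≠ 0 →
      IsOpen W ∧ Convex ℝ W ∧ (∀ t : ℝ, 0 < t → ∀ x ∈ W, t • x ∈ W) ∧ W ≠ Set.univ ∧
      blockPart blk p k.succ ∈ W) ∧ (blockPart blk p k.succ = 0 → W = Set.univ) ∧
      blockPart blk z k.succ ∈ W ∧ closure W \ {0} ⊆ S.V k := by
    intro k
    by_cases hk : blockPart blk p k.succ = 0
    · refine ⟨Set.univ, fun h' => absurd hk h', fun _ => rfl, trivial, ?_⟩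
      rw [S.whole k hk]; exact Set.subset_univ _
    · obtain ⟨a1, a2, a3, -, a5⟩ := S.cone k hk
      obtain ⟨W, w1, w2, w3, w4, w5, w6, w7⟩ := exists_cone_between_pair a1 a2 a3
        (zero_notMem_cone S hk) a5 (hz.1 k)
      exact ⟨W, fun _ => ⟨w1, w2, w3, fun hu => w4 (hu ▸ Set.mem_univ _), w5⟩,
        fun h' => absurd h' hk, w6, w7⟩
  choose W w1 w2 w3 w4 using hV
  set v : Weighted m ℓ → ℝ := fun q =>
    Expo.eval (Multiplicative.toAdd q.1) (blockNorms blk z) (fun _ => 1)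
  refine ⟨⟨W, (‖blockPart blk z 0‖ + S.eps0) / 2, fun q => (max (v q - q.2) 0 + S.epsPlus q) / 2,
    fun q => (max (q.2 - v q) 0 + S.epsMinus q) / 2, w1, w2, ?_, ?_, ?_⟩, ⟨w4, ?_, ?_⟩,
    ⟨w3, ?_, ?_⟩⟩
  · have := S.eps0_pos; have := norm_nonneg (blockPart blk z 0); linarith
  · intro q hq; have := S.epsPlus_pos q hq; have := le_max_right (v q - q.2) 0; linarith
  · intro q hq; have := S.epsMinus_pos q hq; have := le_max_right (q.2 - v q) 0; linarith
  · have := hz.2.1; simp only; linarith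
  · intro q hq
    have h1 := S.epsPlus_pos q hq
    have h2 := S.epsMinus_pos q hq
    obtain ⟨h3, h4⟩ := hz.2.2 q hq
    have h5 : max (v q - q.2) 0 < S.epsPlus q := max_lt (by linarith) h1
    have h6 : max (q.2 - v q) 0 < S.epsMinus q := max_lt (by linarith) h2
    exact ⟨by simp only; linarith, by simp only; linarith⟩
  · have := hz.2.1; simp only; linarith
  · intro q hq
    have h1 := S.epsPlus_pos q hq
    have h2 := S.epsMinus_pos q hq
    obtain ⟨h3, h4⟩ := hz.2.2 q hq
    have h5 := le_max_left (v q - q.2) 0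
    have h6 := le_max_left (q.2 - v q) 0
    change _ < v q ∧ v q < _
    change _ < v q at h3
    change v q < _ at h4
    exact ⟨by simp only; linarith, by simp only; linarith⟩

end Between

/-! ### The actions on multicones -/

section Action
variable {n m ℓ : ℕ} {A : Matrix (Fin ℓ) (Fin m) ℚ} {blk : Fin n → Fin (m + 1)}

/-- The factor `φ_k(λ)` by which the action multiplies the block `z⁽ᵏ⁾`. -/
def actionWeight (A : Matrix (Fin ℓ) (Fin m) ℚ) (lam : Fin ℓ → ℝ) (k : Fin m) : ℝ :=
  ∏ j, lam j ^ (A j k : ℝ)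

/-- The factor by which the action multiplies the coordinate `z_i`. -/
def actionScale (A : Matrix (Fin ℓ) (Fin m) ℚ) (blk : Fin n → Fin (m + 1)) (lam : Fin ℓ → ℝ)
    (i : Fin n) : ℝ := Fin.cases 1 (actionWeight A lam) (blk i)

theorem actionScale_zero {lam : Fin ℓ → ℝ} {i : Fin n} (hi : blk i = 0) :
    actionScale A blk lam i = 1 := by
  simp [actionScale, hi]

theorem actionScale_succ {lam : Fin ℓ → ℝ} {i : Fin n} {k : Fin m} (hi : blk i = k.succ) :
    actionScale A blk lam i = actionWeight A lam k := by
  simp [actionScale, hi]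

theorem mu_apply (z : Fin n → ℂ) (lam : Fin ℓ → ℝ) (i : Fin n) :
    mu A blk z lam i = (actionScale A blk lam i : ℂ) * z i := by
  rcases Fin.eq_zero_or_eq_succ (blk i) with hi | ⟨k, hi⟩
  · simp [mu, actionScale, hi]
  · simp [mu, actionScale, actionWeight, hi]

theorem actionWeight_pos {lam : Fin ℓ → ℝ} (hlam : ∀ j, 0 < lam j) (k : Fin m) :
    0 < actionWeight A lam k := Finset.prod_pos fun j _ => Real.rpow_pos_of_pos (hlam j) _

theorem actionScale_pos {lam : Fin ℓ → ℝ} (hlam : ∀ j, 0 < lam j) (i : Fin n) :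
    0 < actionScale A blk lam i := by
  rcases Fin.eq_zero_or_eq_succ (blk i) with hi | ⟨k, hi⟩
  · rw [actionScale_zero hi]; exact one_pos
  · rw [actionScale_succ hi]; exact actionWeight_pos hlam k

theorem mu_div_actionScale {lam : Fin ℓ → ℝ} (hlam : ∀ j, 0 < lam j) (z : Fin n → ℂ) :
    mu A blk (fun i => z i / (actionScale A blk lam i : ℂ)) lam = z := by
  funext i
  have : (actionScale A blk lam i : ℂ) ≠ 0 := by exact_mod_cast (actionScale_pos hlam i).ne'
  rw [mu_apply]
  field_simp

theorem blockPart_mu_succ (z : Fin n → ℂ) (lam : Fin ℓ → ℝ) (k : Fin m) :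
    blockPart blk (mu A blk z lam) k.succ = actionWeight A lam k • blockPart blk z k.succ := by
  funext i
  simp [blockPart, mu_apply, actionScale_succ i.2]

theorem blockPart_mu_zero (z : Fin n → ℂ) (lam : Fin ℓ → ℝ) :
    blockPart blk (mu A blk z lam) 0 = blockPart blk z 0 := by
  funext i
  simp [blockPart, mu_apply, actionScale_zero i.2]

theorem blockNorms_mu (z : Fin n → ℂ) {lam : Fin ℓ → ℝ} (hlam : ∀ j, 0 < lam j) (k : Fin m) :
    blockNorms blk (mu A blk z lam) k = actionWeight A lam k * blockNorms blk z k := by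
  rw [blockNorms, blockPart_mu_succ, norm_smul, Real.norm_of_nonneg (actionWeight_pos hlam k).le]
  rfl

/-- The factor by which the action multiplies the monomial `τ^e`. -/
def monFactor (A : Matrix (Fin ℓ) (Fin m) ℚ) (e : Fin m → ℚ) (lam : Fin ℓ → ℝ) : ℝ :=
  ∏ j, lam j ^ ((∑ k, A j k * e k : ℚ) : ℝ)

theorem monFactor_pos (e : Fin m → ℚ) {lam : Fin ℓ → ℝ} (hlam : ∀ j, 0 < lam j) :
    0 < monFactor A e lam := Finset.prod_pos fun j _ => Real.rpow_pos_of_pos (hlam j) _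

theorem monFactor_le (e : Fin m → ℚ) {lam : Fin ℓ → ℝ} (hlam : ∀ j, 0 < lam j) {B : ℝ}
    (hB : ∀ j, lam j ≤ B) (he : ∀ j, 0 ≤ ∑ k, A j k * e k) :
    monFactor A e lam ≤ monFactor A e (fun _ => B) := by
  refine Finset.prod_le_prod (fun j _ => Real.rpow_nonneg (hlam j).le _) fun j _ => ?_
  exact Real.rpow_le_rpow (hlam j).le (hB j) (by exact_mod_cast he j)

theorem monFactor_eq_one {e : Fin m → ℚ} (he : ∀ j, ∑ k, A j k * e k = 0) (lam : Fin ℓ → ℝ) :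
    monFactor A e lam = 1 := by
  simp [monFactor, he]

theorem continuous_monFactor {e : Fin m → ℚ} (he : ∀ j, 0 ≤ ∑ k, A j k * e k) :
    Continuous (monFactor A e) := by
  refine continuous_finsetProd _ fun j _ => ?_
  exact (Real.continuous_rpow_const (by exact_mod_cast he j)).comp (continuous_apply j)

theorem continuous_actionScale (h0 : ∀ j k, 0 ≤ A j k) (i : Fin n) :
    Continuous (fun lam => actionScale A blk lam i) := by
  rcases Fin.eq_zero_or_eq_succ (blk i) with hi | ⟨k, hi⟩
  · simp only [actionScale_zero hi]; exact continuous_const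
  · simp only [actionScale_succ hi, actionWeight]
    refine continuous_finsetProd _ fun j _ => ?_
    exact (Real.continuous_rpow_const (by exact_mod_cast h0 j k)).comp (continuous_apply j)

theorem monEval_blockNorms_mu (e : Fin m → ℚ) (z : Fin n → ℂ) {lam : Fin ℓ → ℝ}
    (hlam : ∀ j, 0 < lam j) :
    monEval e (blockNorms blk (mu A blk z lam)) = monFactor A e lam * monEval e (blockNorms blk z) := by
  rw [monFactor, ← monEval_action A e hlam, ← monEval_mul]
  · congr 1
    funext k
    exact blockNorms_mu z hlam k
  · exact fun k => (actionWeight_pos hlam k).le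
  · exact blockNorms_nonneg blk z

theorem continuous_blockPart (k : Fin (m + 1)) :
    Continuous (fun z : Fin n → ℂ => blockPart blk z k) :=
  continuous_pi fun i => continuous_apply (i : Fin n)

theorem continuous_blockNorms : Continuous (blockNorms blk : (Fin n → ℂ) → Fin m → ℝ) :=
  continuous_pi fun k => (continuous_blockPart k.succ).norm

variable {p : Fin n → ℂ} {H : Finset (Weighted m ℓ)}

/-- As the `V_k` are cones, only the monomials of `H` are affected by the actions. -/
theorem mu_mem_carrier_iff (S : Multicone blk p H) (z : Fin n → ℂ) {lam : Fin ℓ → ℝ}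
    (hlam : ∀ j, 0 < lam j) :
    mu A blk z lam ∈ S.carrier ↔ (∀ k, blockPart blk p k.succ ≠ 0 → blockPart blk z k.succ ∈ S.V k) ∧
      ‖blockPart blk z 0‖ < S.eps0 ∧ ∀ h ∈ H,
        (h.2 : ℝ) - S.epsMinus h < monFactor A (Multiplicative.toAdd h.1).1 lam *
          monEval (Multiplicative.toAdd h.1).1 (blockNorms blk z) ∧
        monFactor A (Multiplicative.toAdd h.1).1 lam *
          monEval (Multiplicative.toAdd h.1).1 (blockNorms blk z) < (h.2 : ℝ) + S.epsPlus h := by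
  refine and_congr ?_ (and_congr ?_ ?_)
  · refine forall_congr' fun k => ?_
    by_cases hk : blockPart blk p k.succ = 0
    · simp [S.whole k hk, hk]
    · obtain ⟨-, -, hc, -, -⟩ := S.cone k hk
      have hpos := actionWeight_pos (A := A) hlam k
      rw [blockPart_mu_succ]
      refine ⟨fun h _ => ?_, fun h => hc _ hpos _ (h hk)⟩
      have := hc _ (inv_pos.2 hpos) _ h
      rwa [smul_smul, inv_mul_cancel₀ hpos.ne', one_smul] at this
  · rw [blockPart_mu_zero]
  · simp only [Expo.eval_one, monEval_blockNorms_mu _ z hlam]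

theorem mu_one (z : Fin n → ℂ) : mu A blk z (fun _ => 1) = z := by
  funext i
  rcases Fin.eq_zero_or_eq_succ (blk i) with hi | ⟨k, hi⟩ <;> simp [mu, hi]

theorem mem_carrier_iff (S : Multicone blk p H) (z : Fin n → ℂ) :
    z ∈ S.carrier ↔ (∀ k, blockPart blk p k.succ ≠ 0 → blockPart blk z k.succ ∈ S.V k) ∧
      ‖blockPart blk z 0‖ < S.eps0 ∧ ∀ h ∈ H,
        (h.2 : ℝ) - S.epsMinus h < monEval (Multiplicative.toAdd h.1).1 (blockNorms blk z) ∧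
        monEval (Multiplicative.toAdd h.1).1 (blockNorms blk z) < (h.2 : ℝ) + S.epsPlus h := by
  have := mu_mem_carrier_iff (A := (0 : Matrix (Fin ℓ) (Fin m) ℚ)) S z (lam := fun _ => 1)
    (fun _ => one_pos)
  rw [mu_one] at this
  simpa [monFactor] using this

end Action

/-! ### Compactness modulo the actions -/

section Geometry
variable {n L r s : ℕ} {A : Matrix (Fin (L + r)) (Fin (L + s)) ℚ} {b : Fin L → Fin (L + s) → ℚ}
  {blk : Fin n → Fin (L + s + 1)} {p : Fin n → ℂ} {H : Finset (Weighted (L + s) (L + r))}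

namespace IsMulticoneSetting

/-- Multicones are invariant under the contracting actions. -/
theorem mu_mem_carrier (hs : IsMulticoneSetting A b blk p H) {S : Multicone blk p H}
    {z : Fin n → ℂ} (hz : z ∈ S.carrier) {lam : Fin (L + r) → ℝ} (hlam : ∀ j, 0 < lam j)
    (hlam1 : ∀ j, lam j ≤ 1) : mu A blk z lam ∈ S.carrier := by
  rw [mu_mem_carrier_iff S z hlam]
  rw [mem_carrier_iff] at hz
  refine ⟨hz.1, hz.2.1, fun h hh => ?_⟩
  obtain ⟨h1, h2⟩ := hz.2.2 h hh
  obtain ⟨w1, w2, -⟩ := hs.mem_H hh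
  by_cases hv : h.2 = 0
  · have hnn := monEval_nonneg (Multiplicative.toAdd h.1).1 (blockNorms_nonneg blk z)
    have hf0 := (monFactor_pos (A := A) (Multiplicative.toAdd h.1).1 hlam).le
    have hf1 : monFactor A (Multiplicative.toAdd h.1).1 lam ≤ 1 :=
      (monFactor_le _ hlam hlam1 w1).trans (by simp [monFactor])
    have h3 := mul_le_of_le_one_left hnn hf1
    have h4 := mul_nonneg hf0 hnn
    have := S.epsMinus_pos h hh
    rw [hv, NNReal.coe_zero]
    rw [hv, NNReal.coe_zero] at h2
    exact ⟨by linarith, by linarith⟩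
  · rw [monFactor_eq_one (w2 hv), one_mul]
    exact ⟨h1, h2⟩

end IsMulticoneSetting

/-- A compact set of representatives for the points of a multicone modulo the actions. -/
def normalizedSet (S : Multicone blk p H) (B : ℝ) : Set (Fin n → ℂ) :=
  {x | ‖blockPart blk x 0‖ ≤ S.eps0 ∧ ∀ k : Fin (L + s), blockNorms blk x k ≤ B ∧
    (blockPart blk p k.succ ≠ 0 → blockPart blk x k.succ ∈ closure (S.V k) ∧
      1 ≤ B * blockNorms blk x k)}

theorem isCompact_normalizedSet (S : Multicone blk p H) (B : ℝ) :
    IsCompact (normalizedSet S B) := by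
  refine (isCompact_closedBall (0 : Fin n → ℂ) (max S.eps0 B)).of_isClosed_subset ?_ ?_
  · have hk : ∀ k, Continuous fun x : Fin n → ℂ => blockNorms blk x k := fun k =>
      (continuous_apply k).comp continuous_blockNorms
    have heq : normalizedSet S B = {x | ‖blockPart blk x 0‖ ≤ S.eps0} ∩
        ⋂ k : Fin (L + s), ({x | blockNorms blk x k ≤ B} ∩ ⋂ _ : blockPart blk p k.succ ≠ 0,
          ((fun x => blockPart blk x k.succ) ⁻¹' closure (S.V k) ∩
            {x | 1 ≤ B * blockNorms blk x k})) := by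
      ext x; simp [normalizedSet]
    rw [heq]
    refine (isClosed_le (continuous_blockPart 0).norm continuous_const).inter
      (isClosed_iInter fun k => (isClosed_le (hk k) continuous_const).inter
        (isClosed_iInter fun _ => ?_))
    exact (isClosed_closure.preimage (continuous_blockPart k.succ)).inter
      (isClosed_le continuous_const (continuous_const.mul (hk k)))
  · intro x hx
    rw [mem_closedBall_zero_iff]
    refine (pi_norm_le_iff_of_nonneg (le_max_of_le_left S.eps0_pos.le)).2 fun i => ?_
    rcases Fin.eq_zero_or_eq_succ (blk i) with hi | ⟨k, hi⟩
    · exact ((norm_le_pi_norm (blockPart blk x 0) ⟨i, hi⟩).trans hx.1).trans (le_max_left _ _)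
    · exact ((norm_le_pi_norm (blockPart blk x k.succ) ⟨i, hi⟩).trans (hx.2 k).1).trans
        (le_max_right _ _)

theorem mem_cone_of_mem_normalizedSet {S' S : Multicone blk p H} (h : S'.ProperIn S) {B : ℝ}
    {x : Fin n → ℂ} (hx : x ∈ normalizedSet S' B) {k : Fin (L + s)}
    (hk : blockPart blk p k.succ ≠ 0) : blockPart blk x k.succ ∈ S.V k := by
  refine h.1 k ⟨((hx.2 k).2 hk).1, fun h0 => ?_⟩
  have h1 := ((hx.2 k).2 hk).2
  rw [blockNorms, Set.mem_singleton_iff.1 h0, norm_zero, mul_zero] at h1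
  linarith

theorem blockNorms_ne_zero_of_mem_normalizedSet {S : Multicone blk p H} {B : ℝ}
    {x : Fin n → ℂ} (hx : x ∈ normalizedSet S B) {k : Fin (L + s)}
    (hk : blockPart blk p k.succ ≠ 0) : blockNorms blk x k ≠ 0 := by
  intro h0
  have h1 := ((hx.2 k).2 hk).2
  rw [h0, mul_zero] at h1
  linarith

/-- The level functions belonging to the given order of the actions. -/
abbrev levelAt (A : Matrix (Fin (L + r)) (Fin (L + s)) ℚ) (blk : Fin n → Fin (L + s + 1))
    (p z : Fin n → ℂ) : Fin (L + r) → ℝ :=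
  rhoPerm A (blockNorms blk p) 1 (blockNorms blk z)

namespace IsMulticoneSetting

theorem levelAt_pos (hs : IsMulticoneSetting A b blk p H) {S : Multicone blk p H} {z : Fin n → ℂ}
    (hz : z ∈ S.carrier) (j) : 0 < levelAt A blk p z j :=
  rhoPerm_pos hs.level (admissible_one hs.level) (hs.lead_pos hz) j

theorem actionWeight_levelAt (hs : IsMulticoneSetting A b blk p H) {S : Multicone blk p H}
    {z : Fin n → ℂ} (hz : z ∈ S.carrier) (k) :
    actionWeight A (levelAt A blk p z) k = blockScale b (blockNorms blk z) k :=
  prod_rhoPerm_rpow hs.level (admissible_one hs.level) (hs.lead_pos hz) k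

/-- Every point `z` of a multicone is `μ(x, ρ_Λ(z))` with `x` in a compact set. -/
theorem exists_normalizedSet (hs : IsMulticoneSetting A b blk p H) (S : Multicone blk p H) :
    ∃ B : ℝ, 1 ≤ B ∧ ∀ z ∈ S.carrier, (∀ j, levelAt A blk p z j ≤ B) ∧
      ∃ x ∈ normalizedSet S B, mu A blk x (levelAt A blk p z) = z := by
  obtain ⟨B₁, hB₁, h1⟩ := hs.exists_blockNorms_le S
  obtain ⟨B₂, hB₂, h2⟩ := hs.exists_rhoPerm_le_const S (admissible_one hs.level)
  refine ⟨max B₁ B₂, le_max_of_le_left hB₁, fun z hz =>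
    ⟨fun j => (h2 z hz j).trans (le_max_right _ _), _, ?_,
      mu_div_actionScale (hs.levelAt_pos hz) z⟩⟩
  set x : Fin n → ℂ := fun i => z i / (actionScale A blk (levelAt A blk p z) i : ℂ) with hx
  have hmu : mu A blk x (levelAt A blk p z) = z := mu_div_actionScale (hs.levelAt_pos hz) z
  have hpos := hs.levelAt_pos hz
  have hnorm : ∀ k, blockNorms blk z k =
      blockScale b (blockNorms blk z) k * blockNorms blk x k := by
    intro k
    rw [← hs.actionWeight_levelAt hz, ← blockNorms_mu x hpos, hmu]
  have hmem := hz
  rw [← hmu, mu_mem_carrier_iff S x hpos] at hmem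
  refine ⟨hmem.2.1.le, fun k => ⟨?_, fun hk => ⟨subset_closure (hmem.1 k hk), ?_⟩⟩⟩
  · have h3 := (h1 z hz k).1
    have hR := blockScale_pos (b := b) (hs.lead_pos hz) k
    rw [hnorm, mul_comm B₁] at h3
    exact (le_of_mul_le_mul_left h3 hR).trans (le_max_left _ _)
  · have h3 := (h1 z hz k).2 hk
    have hR := blockScale_pos (b := b) (hs.lead_pos hz) k
    rw [hnorm] at h3
    have h4 : blockScale b (blockNorms blk z) k * 1 ≤
        blockScale b (blockNorms blk z) k * (B₁ * blockNorms blk x k) := by linarith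
    exact (le_of_mul_le_mul_left h4 hR).trans
      (mul_le_mul_of_nonneg_right (le_max_left _ _) (blockNorms_nonneg blk x k))

/-- If `S'` is properly contained in `S`, then the polydiscs about the points of `S'` whose radii
are proportional to the `R_k` are contained in `S`. -/
theorem exists_polydisc_subset (hs : IsMulticoneSetting A b blk p H) {S' S : Multicone blk p H}
    (h : S'.ProperIn S) :
    ∃ c : ℝ, 0 < c ∧ c ≤ 1 / 2 ∧ ∀ z ∈ S'.carrier, ∀ w : Fin n → ℂ,
      (∀ i, ‖w i - z i‖ ≤ c * actionScale A blk (levelAt A blk p z) i) → w ∈ S.carrier := by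
  obtain ⟨B, hB, hnorm⟩ := hs.exists_normalizedSet S'
  set e : Weighted (L + s) (L + r) → Fin (L + s) → ℚ := fun q => (Multiplicative.toAdd q.1).1
  set gap : Weighted (L + s) (L + r) → ℝ := fun q =>
    min (S.epsMinus q - S'.epsMinus q) (S.epsPlus q - S'.epsPlus q)
  have hgap : ∀ q ∈ H, 0 < gap q := fun q hq =>
    lt_min (sub_pos.2 (h.2.2 q hq).1) (sub_pos.2 (h.2.2 q hq).2)
  obtain ⟨δ, hδ, hdist⟩ := exists_forall_dist_lt_of_isCompact (isCompact_normalizedSet S' B)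
    (P := fun x y => (∀ k : Fin (L + s), blockPart blk p k.succ ≠ 0 → blockPart blk y k.succ ∈ S.V k) ∧
      ∀ q ∈ H, monFactor A (e q) (fun _ => B) *
        |monEval (e q) (blockNorms blk y) - monEval (e q) (blockNorms blk x)| < gap q) (by
    intro x hx
    refine Filter.Eventually.and ?_ ?_
    · rw [Filter.eventually_all]
      intro k
      by_cases hk : blockPart blk p k.succ = 0
      · exact Filter.Eventually.of_forall fun _ h' => absurd hk h'
      · have h1 : ∀ᶠ q : (Fin n → ℂ) × (Fin n → ℂ) in 𝓝 (x, x), blockPart blk q.2 k.succ ∈ S.V k :=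
          ((continuous_blockPart k.succ).comp continuous_snd).continuousAt.eventually
            ((S.cone k hk).1.mem_nhds (mem_cone_of_mem_normalizedSet h hx hk))
        filter_upwards [h1] with q hq _ using hq
    · rw [Filter.eventually_all_finset]
      intro q hq
      have hcont : ContinuousAt (fun z => monEval (e q) (blockNorms blk z)) x := by
        refine ContinuousAt.comp (g := monEval (e q)) (f := blockNorms blk)
          (continuousAt_monEval _ fun k => ?_) continuous_blockNorms.continuousAt
        by_cases hk : blockPart blk p k.succ = 0
        · exact Or.inr ((hs.mem_H hq).2.2 k hk)
        · exact Or.inl (blockNorms_ne_zero_of_mem_normalizedSet hx hk)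
      have h1 : Tendsto (fun y : (Fin n → ℂ) × (Fin n → ℂ) => monFactor A (e q) (fun _ => B) *
        |monEval (e q) (blockNorms blk y.2) - monEval (e q) (blockNorms blk y.1)|) (𝓝 (x, x))
          (𝓝 (monFactor A (e q) (fun _ => B) *
        |monEval (e q) (blockNorms blk x) - monEval (e q) (blockNorms blk x)|)) :=
        tendsto_const_nhds.mul ((hcont.tendsto.comp (continuous_snd.tendsto (x, x))).sub
          (hcont.tendsto.comp (continuous_fst.tendsto (x, x)))).abs
      rw [sub_self, abs_zero, mul_zero] at h1
      exact h1.eventually_lt_const (hgap q hq))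
  have hε : 0 < S.eps0 - S'.eps0 := sub_pos.2 h.2.1
  refine ⟨min (1 / 2) (min (δ / 2) (S.eps0 - S'.eps0)), lt_min (by norm_num) (lt_min (by linarith) hε),
    min_le_left _ _, fun z hz w hw => ?_⟩
  set c := min (1 / 2) (min (δ / 2) (S.eps0 - S'.eps0))
  have hc0 : 0 < c := lt_min (by norm_num) (lt_min (by linarith) hε)
  have hcδ : c ≤ δ / 2 := (min_le_right _ _).trans (min_le_left _ _)
  have hcε : c ≤ S.eps0 - S'.eps0 := (min_le_right _ _).trans (min_le_right _ _)
  obtain ⟨hlB, x, hx, hmu⟩ := hnorm z hz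
  set lam := levelAt A blk p z
  have hpos : ∀ j, 0 < lam j := hs.levelAt_pos hz
  set y : Fin n → ℂ := fun i => w i / (actionScale A blk lam i : ℂ) with hy
  have hmuy : mu A blk y lam = w := mu_div_actionScale hpos w
  have hxy : ∀ i, ‖y i - x i‖ ≤ c := by
    intro i
    have h1 := hw i
    have hsc := actionScale_pos (A := A) (blk := blk) hpos i
    rw [← hmuy, ← hmu, mu_apply, mu_apply, ← mul_sub, norm_mul, Complex.norm_real,
      Real.norm_of_nonneg hsc.le, mul_comm c] at h1
    exact le_of_mul_le_mul_left h1 hsc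
  have hd : dist y x < δ := by
    refine lt_of_le_of_lt ((dist_pi_le_iff hc0.le).2 fun i => ?_) (by linarith : c < δ)
    rw [dist_eq_norm]; exact hxy i
  obtain ⟨d1, d2⟩ := hdist x hx y hd
  have hzS := hz
  rw [← hmu, mu_mem_carrier_iff S' x hpos] at hzS
  rw [← hmuy, mu_mem_carrier_iff S y hpos]
  refine ⟨d1, ?_, fun q hq => ?_⟩
  · have h1 : ‖blockPart blk y 0 - blockPart blk x 0‖ ≤ c :=
      (pi_norm_le_iff_of_nonneg hc0.le).2 fun i => hxy i
    have h2 := norm_le_norm_add_norm_sub' (blockPart blk y 0) (blockPart blk x 0)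
    linarith [hzS.2.1]
  · have h1 := d2 q hq
    have h2 := hzS.2.2 q hq
    have hle := monFactor_le (e q) hpos hlB (hs.mem_H hq).1
    have hf0 := monFactor_pos (A := A) (e q) hpos
    have h3 : |monFactor A (e q) lam * monEval (e q) (blockNorms blk y) -
        monFactor A (e q) lam * monEval (e q) (blockNorms blk x)| < gap q := by
      rw [← mul_sub, abs_mul, abs_of_pos hf0]
      exact (mul_le_mul_of_nonneg_right hle (abs_nonneg _)).trans_lt h1
    have h4 := abs_lt.1 h3
    have h5 := min_le_left (S.epsMinus q - S'.epsMinus q) (S.epsPlus q - S'.epsPlus q)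
    have h6 := min_le_right (S.epsMinus q - S'.epsMinus q) (S.epsPlus q - S'.epsPlus q)
    change -gap q < _ ∧ _ < gap q at h4
    change gap q ≤ _ at h5
    change gap q ≤ _ at h6
    obtain ⟨h7, h8⟩ := h2
    change _ < monFactor A (e q) lam * monEval (e q) (blockNorms blk x) at h7
    change monFactor A (e q) lam * monEval (e q) (blockNorms blk x) < _ at h8
    change _ < monFactor A (e q) lam * monEval (e q) (blockNorms blk y) ∧
      monFactor A (e q) lam * monEval (e q) (blockNorms blk y) < _
    exact ⟨by linarith, by linarith⟩

theorem isOpen_carrier (hs : IsMulticoneSetting A b blk p H) (S : Multicone blk p H) :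
    IsOpen S.carrier := by
  rw [isOpen_iff_mem_nhds]
  intro z hz
  obtain ⟨S', hS', hz'⟩ := Multicone.exists_properIn_mem hz
  obtain ⟨c, hc, -, hsub⟩ := hs.exists_polydisc_subset hS'
  have h1 : ∀ᶠ w in 𝓝 z, ∀ i, ‖w i - z i‖ ≤ c * actionScale A blk (levelAt A blk p z) i := by
    rw [Filter.eventually_all]
    intro i
    have hcont : Tendsto (fun w : Fin n → ℂ => ‖w i - z i‖) (𝓝 z) (𝓝 ‖z i - z i‖) :=
      (((continuous_apply i).sub continuous_const).norm).tendsto z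
    rw [sub_self, norm_zero] at hcont
    filter_upwards [hcont.eventually_lt_const
      (mul_pos hc (actionScale_pos (hs.levelAt_pos hz) i))] with w hw using hw.le
  filter_upwards [h1] with w hw using hsub z hz' w hw

/-- In the polydiscs of radius at most `1/2` the first `L` blocks have comparable norms. -/
theorem abs_log_sub_log_le (hs : IsMulticoneSetting A b blk p H) {S : Multicone blk p H}
    {z w : Fin n → ℂ} (hz : z ∈ S.carrier) {c : ℝ} (hc : c ≤ 1 / 2)
    (hw : ∀ i, ‖w i - z i‖ ≤ c * actionScale A blk (levelAt A blk p z) i) (k : Fin L) :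
    0 < blockNorms blk w (Fin.castAdd s k) ∧
    |Real.log (blockNorms blk w (Fin.castAdd s k)) - Real.log (blockNorms blk z (Fin.castAdd s k))|
      ≤ 1 := by
  set k' := Fin.castAdd s k
  have hτ : 0 < blockNorms blk z k' := hs.lead_pos hz k
  have hsc : actionWeight A (levelAt A blk p z) k' = blockNorms blk z k' := by
    rw [hs.actionWeight_levelAt hz, blockScale_castAdd hs.level]
  have hdiff : ‖blockPart blk w k'.succ - blockPart blk z k'.succ‖ ≤ 1 / 2 * blockNorms blk z k' := by
    refine (pi_norm_le_iff_of_nonneg (by positivity)).2 fun i => ?_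
    have := hw i
    rw [actionScale_succ i.2, hsc] at this
    exact this.trans (mul_le_mul_of_nonneg_right hc hτ.le)
  have h1 : |blockNorms blk w k' - blockNorms blk z k'| ≤ 1 / 2 * blockNorms blk z k' :=
    (abs_norm_sub_norm_le _ _).trans hdiff
  obtain ⟨h2, h3⟩ := abs_le.1 h1
  have hτw : 0 < blockNorms blk w k' := by linarith
  refine ⟨hτw, ?_⟩
  rw [← Real.log_div hτw.ne' hτ.ne', abs_le]
  have hq1 : 1 / 2 ≤ blockNorms blk w k' / blockNorms blk z k' := by
    rw [le_div_iff₀ hτ]; linarith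
  have hq2 : blockNorms blk w k' / blockNorms blk z k' ≤ 2 := by
    rw [div_le_iff₀ hτ]; linarith
  have hl2 : Real.log 2 ≤ 1 := by linarith [Real.log_two_lt_d9]
  constructor
  · have := Real.log_le_log (by norm_num) hq1
    rw [one_div, Real.log_inv] at this
    linarith
  · exact (Real.log_le_log (by positivity) hq2).trans hl2

end IsMulticoneSetting
end Geometry

/-! ### Projections and boundary points of multicones -/

section Projections
variable {n m ℓ : ℕ} {A : Matrix (Fin ℓ) (Fin m) ℚ} {blk : Fin n → Fin (m + 1)}

theorem proj_empty (z : Fin n → ℂ) : proj A blk ∅ z = z := by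
  funext i; simp [proj, InK]

theorem InK.mono {J R : Finset (Fin ℓ)} (h : J ⊆ R) {i : Fin n} (hi : InK A blk J i) :
    InK A blk R i := by
  obtain ⟨k, hk, j, hj, hne⟩ := hi
  exact ⟨k, hk, j, h hj, hne⟩

theorem proj_proj_of_subset {J R : Finset (Fin ℓ)} (h : J ⊆ R) (z : Fin n → ℂ) :
    proj A blk J (proj A blk R z) = proj A blk R z := by
  funext i
  by_cases hi : InK A blk J i
  · simp [proj, hi, hi.mono h]
  · simp [proj, hi]

theorem continuous_proj (J : Finset (Fin ℓ)) : Continuous (proj A blk J) := by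
  refine continuous_pi fun i => ?_
  by_cases hi : InK A blk J i
  · simp only [proj, hi, if_true]; exact continuous_const
  · simp only [proj, hi, if_false]; exact continuous_apply i

theorem proj_mu (J : Finset (Fin ℓ)) (z : Fin n → ℂ) (lam : Fin ℓ → ℝ) :
    proj A blk J (mu A blk z lam) = mu A blk (proj A blk J z) lam := by
  funext i
  by_cases hi : InK A blk J i <;> simp [proj, mu_apply, hi]

theorem actionScale_congr {J : Finset (Fin ℓ)} {i : Fin n} (hi : ¬ InK A blk J i)
    {lam lam' : Fin ℓ → ℝ} (h : ∀ j ∉ J, lam j = lam' j) :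
    actionScale A blk lam i = actionScale A blk lam' i := by
  rcases Fin.eq_zero_or_eq_succ (blk i) with h0 | ⟨k, hk⟩
  · rw [actionScale_zero h0, actionScale_zero h0]
  · rw [actionScale_succ hk, actionScale_succ hk]
    refine Finset.prod_congr rfl fun j _ => ?_
    by_cases hj : j ∈ J
    · have : A j k = 0 := by
        by_contra hne
        exact hi ⟨k, hk, j, hj, hne⟩
      simp [this]
    · rw [h j hj]

/-- The action with `λ_j = 0` for `j ∈ J` includes the projection `π_J`. -/
theorem proj_mu_eq {J : Finset (Fin ℓ)} {lam lam' : Fin ℓ → ℝ} (h : ∀ j ∉ J, lam j = lam' j)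
    (h0 : ∀ j ∈ J, lam' j = 0) (z : Fin n → ℂ) :
    proj A blk J (mu A blk z lam) = mu A blk z lam' := by
  funext i
  by_cases hi : InK A blk J i
  · obtain ⟨k, hk, j, hj, hne⟩ := id hi
    have : actionScale A blk lam' i = 0 := by
      rw [actionScale_succ hk]
      refine Finset.prod_eq_zero (Finset.mem_univ j) ?_
      rw [h0 j hj, Real.zero_rpow (by exact_mod_cast hne)]
    simp [proj, hi, mu_apply, this]
  · simp [proj, hi, mu_apply, actionScale_congr hi h]

theorem tendsto_mu {ι : Type*} {u : Filter ι} (h0 : ∀ j k, 0 ≤ A j k) {x : ι → Fin n → ℂ}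
    {x₀ : Fin n → ℂ} (hx : Tendsto x u (𝓝 x₀)) {lam : ι → Fin ℓ → ℝ} {lam₀ : Fin ℓ → ℝ}
    (hlam : Tendsto lam u (𝓝 lam₀)) :
    Tendsto (fun a => mu A blk (x a) (lam a)) u (𝓝 (mu A blk x₀ lam₀)) := by
  refine tendsto_pi_nhds.2 fun i => ?_
  simp only [mu_apply]
  exact ((Complex.continuous_ofReal.tendsto _).comp
    (((continuous_actionScale h0 i).tendsto lam₀).comp hlam)).mul (tendsto_pi_nhds.1 hx i)

theorem muSingle_eq_mu (q : Fin ℓ) (z : Fin n → ℂ) (t : ℝ) :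
    muSingle A blk q z t = mu A blk z (Function.update (fun _ => 1) q t) := by
  funext i
  rcases Fin.eq_zero_or_eq_succ (blk i) with hi | ⟨k, hi⟩
  · simp [muSingle, mu, hi]
  · have : ∏ j, (Function.update (fun _ => (1 : ℝ)) q t j) ^ (A j k : ℝ) = t ^ (A q k : ℝ) := by
      rw [Finset.prod_eq_single q]
      · simp
      · intro j _ hj; simp [hj]
      · simp
    simp only [muSingle, mu, hi, Fin.cases_succ, this]

/-- The action `μ_q` fixes `π_J(z)` if `π_J(z) ∈ Z_q`. -/
theorem proj_muSingle {J : Finset (Fin ℓ)} {q : Fin ℓ} {z : Fin n → ℂ}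
    (h : proj A blk {q} (proj A blk J z) = proj A blk J z) (t : ℝ) :
    proj A blk J (muSingle A blk q z t) = proj A blk J z := by
  rw [muSingle_eq_mu, proj_mu]
  funext i
  rw [mu_apply]
  by_cases hi : InK A blk {q} i
  · have := congrFun h i
    have h0 : proj A blk {q} (proj A blk J z) i = 0 := by simp [proj, hi]
    rw [← this, h0, mul_zero]
  · rw [actionScale_congr hi (lam' := fun _ => 1)]
    · have : actionScale A blk (fun _ => (1 : ℝ)) i = 1 := by
        rcases Fin.eq_zero_or_eq_succ (blk i) with h0 | ⟨k, hk⟩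
        · exact actionScale_zero h0
        · rw [actionScale_succ hk]; simp [actionWeight]
      rw [this, Complex.ofReal_one, one_mul]
    · intro j hj
      rw [Function.update_of_ne]
      simpa using hj

end Projections

section Boundary
variable {n L r s : ℕ} {A : Matrix (Fin (L + r)) (Fin (L + s)) ℚ} {b : Fin L → Fin (L + s) → ℚ}
  {blk : Fin n → Fin (L + s + 1)} {p : Fin n → ℂ} {H : Finset (Weighted (L + s) (L + r))}

namespace IsMulticoneSetting

theorem muSingle_mem_carrier (hs : IsMulticoneSetting A b blk p H) {S : Multicone blk p H}
    {z : Fin n → ℂ} (hz : z ∈ S.carrier) (q : Fin (L + r)) {t : ℝ} (h0 : 0 < t) (h1 : t ≤ 1) :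
    muSingle A blk q z t ∈ S.carrier := by
  rw [muSingle_eq_mu]
  refine hs.mu_mem_carrier hz (fun j => ?_) fun j => ?_ <;>
    rcases eq_or_ne j q with rfl | hj <;> simp [*]

/-- `π_R(z)` is the limit of the points `μ(z, λ)` with `λ_j → 0` for `j ∈ R`. -/
theorem proj_mem_closure_proj (hs : IsMulticoneSetting A b blk p H) {S : Multicone blk p H}
    {J R : Finset (Fin (L + r))} (hJR : J ⊆ R) {z : Fin n → ℂ} (hz : z ∈ S.carrier) :
    proj A blk R z ∈ closure (proj A blk J '' S.carrier) := by
  classical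
  set lam : ℝ → Fin (L + r) → ℝ := fun t j => if j ∈ R then t else 1
  have hlam : Tendsto lam (𝓝[>] 0) (𝓝 (lam 0)) := by
    refine Tendsto.mono_left ?_ nhdsWithin_le_nhds
    refine tendsto_pi_nhds.2 fun j => ?_
    by_cases hj : j ∈ R
    · simp only [lam, hj, if_true]; exact tendsto_id
    · simp only [lam, hj, if_false]; exact tendsto_const_nhds
  have h1 := tendsto_mu (blk := blk) hs.level.nonneg (tendsto_const_nhds (x := z)) hlam
  have h2 : mu A blk z (lam 0) = proj A blk R z := by
    rw [← proj_mu_eq (J := R) (lam := fun _ => 1) (lam' := lam 0), mu_one]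
    · intro j hj; simp [lam, hj]
    · intro j hj; simp [lam, hj]
  rw [h2] at h1
  have h3 := ((continuous_proj (A := A) (blk := blk) J).tendsto _).comp h1
  rw [proj_proj_of_subset hJR] at h3
  refine mem_closure_of_tendsto h3 ?_
  have h4 : ∀ᶠ t : ℝ in 𝓝[>] 0, t ≤ 1 :=
    nhdsWithin_le_nhds (eventually_le_nhds one_pos)
  filter_upwards [self_mem_nhdsWithin, h4] with t ht0 ht1
  have ht0' : (0 : ℝ) < t := ht0
  refine ⟨_, hs.mu_mem_carrier hz (fun j => ?_) (fun j => ?_), rfl⟩ <;>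
    by_cases hj : j ∈ R <;> simp [lam, hj, ht0', ht1]

theorem proj_mem_closure (hs : IsMulticoneSetting A b blk p H) {S : Multicone blk p H}
    (R : Finset (Fin (L + r))) {z : Fin n → ℂ} (hz : z ∈ S.carrier) :
    proj A blk R z ∈ closure S.carrier := by
  have := hs.proj_mem_closure_proj (Finset.empty_subset R) hz
  have h1 : proj A blk ∅ = id := funext proj_empty
  rwa [h1, Set.image_id] at this

/-- Limits of points of a properly contained multicone `S'` belong to a set `S_J` such that the
level functions with index in `J` tend to zero. -/
theorem exists_proj_eq_of_tendsto (hs : IsMulticoneSetting A b blk p H) {S' S : Multicone blk p H}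
    (h : S'.ProperIn S) {U : Ultrafilter (Fin n → ℂ)} {z₀ : Fin n → ℂ} (hU : (U : Filter _) ≤ 𝓝 z₀)
    (hS : S'.carrier ∈ U) :
    ∃ J : Finset (Fin (L + r)), (∀ j ∈ J, Tendsto (fun z => levelAt A blk p z j) U (𝓝 0)) ∧
      ∃ z₁ ∈ S.carrier, proj A blk J z₁ = z₀ := by
  classical
  obtain ⟨B, hB, hnorm⟩ := hs.exists_normalizedSet S'
  have hx : ∀ z, ∃ x, z ∈ S'.carrier →
      x ∈ normalizedSet S' B ∧ mu A blk x (levelAt A blk p z) = z := by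
    intro z
    by_cases hz : z ∈ S'.carrier
    · obtain ⟨x, hx⟩ := (hnorm z hz).2
      exact ⟨x, fun _ => hx⟩
    · exact ⟨0, fun h' => absurd h' hz⟩
  choose x hx using hx
  obtain ⟨x₀, hx₀, hxU⟩ := (isCompact_normalizedSet S' B).ultrafilter_le_nhds' (U.map x)
    (Ultrafilter.mem_map.2 (by filter_upwards [hS] with z hz using (hx z hz).1))
  obtain ⟨ρ, hρ, hρU⟩ := (isCompact_Icc (a := (0 : Fin (L + r) → ℝ)) (b := fun _ => B)
    ).ultrafilter_le_nhds' (U.map (levelAt A blk p)) (Ultrafilter.mem_map.2 (by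
      filter_upwards [hS] with z hz
      exact ⟨fun j => (hs.levelAt_pos hz j).le, (hnorm z hz).1⟩))
  have hxt : Tendsto x U (𝓝 x₀) := hxU
  have hρt : Tendsto (levelAt A blk p) U (𝓝 ρ) := hρU
  have hz₀ : mu A blk x₀ ρ = z₀ := by
    refine tendsto_nhds_unique (tendsto_mu hs.level.nonneg hxt hρt)
      (Tendsto.congr' ?_ (tendsto_id'.2 hU))
    filter_upwards [hS] with z hz using (hx z hz).2.symm
  -- `z₀ = μ(x₀, ρ)`; a small `t > 0` in place of the zeros of `ρ` gives a point of `S` over `z₀`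
  set lam : ℝ → Fin (L + r) → ℝ := fun t j => if ρ j = 0 then t else ρ j with hlamdef
  have hlam0 : lam 0 = ρ := by
    funext j
    by_cases hj : ρ j = 0 <;> simp [lam, hj]
  have hlam : Tendsto lam (𝓝[>] 0) (𝓝 ρ) := by
    refine Tendsto.mono_left ?_ nhdsWithin_le_nhds
    refine tendsto_pi_nhds.2 fun j => ?_
    by_cases hj : ρ j = 0
    · simp only [lam, hj, if_true]; exact tendsto_id
    · simp only [lam, hj, if_false]; exact tendsto_const_nhds
  have hev : ∀ᶠ t : ℝ in 𝓝[>] 0, ∀ q ∈ H,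
      (q.2 : ℝ) - S.epsMinus q < monFactor A (Multiplicative.toAdd q.1).1 (lam t) *
          monEval (Multiplicative.toAdd q.1).1 (blockNorms blk x₀) ∧
        monFactor A (Multiplicative.toAdd q.1).1 (lam t) *
          monEval (Multiplicative.toAdd q.1).1 (blockNorms blk x₀) < (q.2 : ℝ) + S.epsPlus q := by
    rw [Filter.eventually_all_finset]
    intro q hq
    set e := (Multiplicative.toAdd q.1).1
    have hcf : Continuous (monFactor A e) := continuous_monFactor (hs.mem_H hq).1
    have hcm : ContinuousAt (fun z => monEval e (blockNorms blk z)) x₀ := by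
      refine ContinuousAt.comp (g := monEval e) (f := blockNorms blk)
        (continuousAt_monEval _ fun k => ?_) continuous_blockNorms.continuousAt
      by_cases hk : blockPart blk p k.succ = 0
      · exact Or.inr ((hs.mem_H hq).2.2 k hk)
      · exact Or.inl (blockNorms_ne_zero_of_mem_normalizedSet hx₀ hk)
    have h1 : Tendsto (fun z => monFactor A e (levelAt A blk p z) *
        monEval e (blockNorms blk (x z))) U (𝓝 (monFactor A e ρ * monEval e (blockNorms blk x₀))) :=
      ((hcf.tendsto ρ).comp hρt).mul (hcm.tendsto.comp hxt)
    have h2 : ∀ᶠ z in (U : Filter (Fin n → ℂ)), (q.2 : ℝ) - S'.epsMinus q <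
        monFactor A e (levelAt A blk p z) * monEval e (blockNorms blk (x z)) ∧
        monFactor A e (levelAt A blk p z) * monEval e (blockNorms blk (x z)) <
          q.2 + S'.epsPlus q := by
      filter_upwards [hS] with z hz
      have h3 := hz
      rw [← (hx z hz).2, mu_mem_carrier_iff S' (x z) (hs.levelAt_pos hz)] at h3
      exact h3.2.2 q hq
    have h3 := ge_of_tendsto h1 (h2.mono fun z hz => hz.1.le)
    have h4 := le_of_tendsto h1 (h2.mono fun z hz => hz.2.le)
    obtain ⟨h5, h6⟩ := h.2.2 q hq
    have h7 : Tendsto (fun t => monFactor A e (lam t) * monEval e (blockNorms blk x₀)) (𝓝[>] 0)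
        (𝓝 (monFactor A e ρ * monEval e (blockNorms blk x₀))) :=
      ((hcf.tendsto ρ).comp hlam).mul tendsto_const_nhds
    exact (h7.eventually_const_lt (by linarith)).and (h7.eventually_lt_const (by linarith))
  obtain ⟨t, ht, ht0⟩ := (hev.and self_mem_nhdsWithin).exists
  have ht0' : (0 : ℝ) < t := ht0
  refine ⟨Finset.univ.filter fun j => ρ j = 0, fun j hj => ?_, mu A blk x₀ (lam t), ?_, ?_⟩
  · have := tendsto_pi_nhds.1 hρt j
    rwa [(Finset.mem_filter.1 hj).2] at this
  · rw [mu_mem_carrier_iff S x₀]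
    · refine ⟨fun k hk => mem_cone_of_mem_normalizedSet h hx₀ hk, hx₀.1.trans_lt h.2.1, ht⟩
    · intro j
      by_cases hj : ρ j = 0
      · simp [lam, hj, ht0']
      · simp only [lam, hj, if_false]
        exact lt_of_le_of_ne (hρ.1 j) (Ne.symm hj)
  · rw [proj_mu_eq (lam' := ρ), hz₀]
    · intro j hj
      have : ρ j ≠ 0 := fun h' => hj (by simp [h'])
      simp [lam, this]
    · intro j hj; exact (Finset.mem_filter.1 hj).2

end IsMulticoneSetting
end Boundary

/-! ### Weights of multi-indices -/

section MultiIndex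
variable {n m ℓ : ℕ} {A : Matrix (Fin ℓ) (Fin m) ℚ} {blk : Fin n → Fin (m + 1)}

/-- The weight `∑_k a_{jk} |α⁽ᵏ⁾|` of a multi-index with respect to the action `μ_j`. -/
def indexWeight (A : Matrix (Fin ℓ) (Fin m) ℚ) (blk : Fin n → Fin (m + 1)) (j : Fin ℓ)
    (α : Fin n → ℕ) : ℚ := ∑ k, A j k * (blockLen blk α k.succ : ℚ)

theorem blockLen_norPart {J : Finset (Fin ℓ)} {j : Fin ℓ} (hj : j ∈ J) {k : Fin m}
    (hk : A j k ≠ 0) (α : Fin n → ℕ) :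
    blockLen blk (norPart A blk J α) k.succ = blockLen blk α k.succ := by
  refine Finset.sum_congr rfl fun i hi => ?_
  have : InK A blk J i := ⟨k, (Finset.mem_filter.1 hi).2, j, hj, hk⟩
  simp [norPart, this]

theorem indexWeight_norPart {J : Finset (Fin ℓ)} {j : Fin ℓ} (hj : j ∈ J) (α : Fin n → ℕ) :
    indexWeight A blk j (norPart A blk J α) = indexWeight A blk j α := by
  refine Finset.sum_congr rfl fun k _ => ?_
  by_cases hk : A j k = 0
  · simp [hk]
  · rw [blockLen_norPart hj hk]

/-- If `β` exceeds `α` in a coordinate of a block `k` with `a_{jk} ≠ 0`, then the weight exceeds by at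
least `a_{jk}`. -/
theorem indexWeight_add_le (h0 : ∀ j k, 0 ≤ A j k) {J : Finset (Fin ℓ)} {j : Fin ℓ} (hj : j ∈ J)
    {α β : Fin n → ℕ} (hle : ∀ i, InK A blk J i → α i ≤ β i) {i : Fin n} {k : Fin m}
    (hi : blk i = k.succ) (hk : A j k ≠ 0) (hlt : α i < β i) :
    indexWeight A blk j α + A j k ≤ indexWeight A blk j β := by
  classical
  have hmono : ∀ k', A j k' ≠ 0 → ∀ i ∈ Finset.univ.filter (fun i => blk i = k'.succ), α i ≤ β i :=
    fun k' hk' i hi => hle i ⟨k', (Finset.mem_filter.1 hi).2, j, hj, hk'⟩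
  have hstrict : blockLen blk α k.succ + 1 ≤ blockLen blk β k.succ :=
    Finset.sum_lt_sum (hmono k hk) ⟨i, by simp [hi], hlt⟩
  have h1 : indexWeight A blk j α + A j k =
      ∑ k', A j k' * ((blockLen blk α k'.succ : ℚ) + if k' = k then 1 else 0) := by
    simp [indexWeight, mul_add, Finset.sum_add_distrib]
  rw [h1]
  refine Finset.sum_le_sum fun k' _ => ?_
  by_cases hk' : A j k' = 0
  · simp [hk']
  refine mul_le_mul_of_nonneg_left ?_ (h0 j k')
  by_cases he : k' = k
  · subst he; rw [if_pos rfl]; exact_mod_cast hstrict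
  · rw [if_neg he, add_zero]
    exact_mod_cast (Finset.sum_le_sum (hmono k' hk') : blockLen blk α k'.succ ≤ blockLen blk β k'.succ)

theorem finite_indexSet (h0 : ∀ j k, 0 ≤ A j k) (σ : ℚ) (J : Finset (Fin ℓ)) (N : Fin ℓ → ℕ) :
    (indexSet A blk σ J N).Finite := by
  have hbd : ∀ i, ∃ M : ℕ, ∀ α ∈ indexSet A blk σ J N, α i ≤ M := by
    intro i
    by_cases hi : InK A blk J i
    · obtain ⟨k, hk, j, hj, hne⟩ := hi
      obtain ⟨M, hM⟩ := exists_nat_ge ((N j : ℚ) / σ / A j k)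
      refine ⟨M, fun α hα => ?_⟩
      have hpos : 0 < A j k := lt_of_le_of_ne (h0 j k) (Ne.symm hne)
      have h1 : (α i : ℚ) ≤ blockLen blk α k.succ := by
        have : α i ≤ blockLen blk α k.succ :=
          Finset.single_le_sum (f := α) (fun _ _ => Nat.zero_le _) (by simp [hk])
        exact_mod_cast this
      have h2 : A j k * (blockLen blk α k.succ : ℚ) ≤ ∑ k, A j k * (blockLen blk α k.succ : ℚ) :=
        Finset.single_le_sum (f := fun k => A j k * (blockLen blk α k.succ : ℚ))
          (fun k _ => mul_nonneg (h0 j k) (Nat.cast_nonneg _)) (Finset.mem_univ k)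
      have h3 : (α i : ℚ) ≤ (N j : ℚ) / σ / A j k := by
        rw [le_div_iff₀ hpos]
        have := mul_le_mul_of_nonneg_left h1 hpos.le
        linarith [hα.2 j hj]
      exact_mod_cast h3.trans hM
    · exact ⟨0, fun α hα => (hα.1 i hi).le⟩
  choose M hM using hbd
  exact (Set.finite_Icc 0 M).subset fun α hα => ⟨fun _ => Nat.zero_le _, fun i => hM i α hα⟩

variable {σ : ℚ}

/-- For `n_j = σ ∑_k a_{jk} |α⁽ᵏ⁾| + 1_{J₀}(j)` the only term of `T_J^{<N}` with a non-zero derivative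
`∂^α` is the one whose index is the part of `α` in the blocks of `K_J`, and this term occurs if and
only if `J ⊆ J₀`. -/
theorem sum_iterPDeriv_coeffMonomial (h0 : ∀ j k, 0 ≤ A j k) (hσ : IsScale A σ)
    {J J₀ : Finset (Fin ℓ)} {N : Fin ℓ → ℕ} {α : Fin n → ℕ}
    (hN : ∀ j, (N j : ℚ) / σ = indexWeight A blk j α + (if j ∈ J₀ then 1 else 0) / σ)
    (Φ : (Fin n → ℕ) → (Fin n → ℂ) → ℂ) (z : Fin n → ℂ) :
    ∑ β ∈ (finite_indexSet (blk := blk) h0 σ J N).toFinset,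
      iterPDeriv α (coeffMonomial A blk J (Φ β) β) z =
      if J ⊆ J₀ then iterPDeriv (tanPart A blk J α) (Φ (norPart A blk J α)) (proj A blk J z)
        else 0 := by
  classical
  obtain ⟨hσ0, e, he, -⟩ := hσ
  have hzero : ∀ β ∈ (finite_indexSet (blk := blk) h0 σ J N).toFinset, β ≠ norPart A blk J α →
      iterPDeriv α (coeffMonomial A blk J (Φ β) β) z = 0 := by
    intro β hβ hne
    have hβ' := (Set.Finite.mem_toFinset _).1 hβ
    by_cases hlt : ∃ i, InK A blk J i ∧ β i < α i
    · obtain ⟨i, hi, hlt⟩ := hlt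
      exact iterPDeriv_coeffMonomial_eq_zero _ hβ'.1 hi hlt z
    · exfalso
      push Not at hlt
      have : ∃ i, InK A blk J i ∧ α i < β i := by
        by_contra! hcon
        refine hne (funext fun i => ?_)
        by_cases hi : InK A blk J i
        · simp [norPart, hi, le_antisymm (hcon i hi) (hlt i hi)]
        · simp [norPart, hi, hβ'.1 i hi]
      obtain ⟨i, ⟨k, hk, j, hj, hjk⟩, hi⟩ := this
      have h1 := indexWeight_add_le h0 hj hlt hk hjk hi
      have h2 : indexWeight A blk j β < (N j : ℚ) / σ := hβ'.2 j hj
      rw [hN j] at h2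
      -- the gap between different weights is at least `1 / σ`
      have h3 : 1 ≤ e j k := by
        rw [Nat.one_le_iff_ne_zero]
        intro h'
        have := he j k
        rw [h', Nat.cast_zero] at this
        exact mul_ne_zero hσ0.ne' hjk this.symm
      have h4 : 1 / σ ≤ A j k := by
        rw [div_le_iff₀ hσ0, mul_comm, ← he j k]
        exact_mod_cast h3
      have h5 : (if j ∈ J₀ then 1 else 0) / σ ≤ 1 / σ := by
        refine div_le_div_of_nonneg_right ?_ hσ0.le
        split_ifs <;> norm_num
      linarith
  have hmem : norPart A blk J α ∈ (finite_indexSet (blk := blk) h0 σ J N).toFinset ↔ J ⊆ J₀ := by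
    rw [Set.Finite.mem_toFinset]
    refine ⟨fun h j hj => ?_, fun h => ⟨normal_norPart α, fun j hj => ?_⟩⟩
    · have h1 : indexWeight A blk j (norPart A blk J α) < (N j : ℚ) / σ := h.2 j hj
      rw [indexWeight_norPart hj, hN j] at h1
      by_contra hcon
      simp [hcon] at h1
    · change indexWeight A blk j (norPart A blk J α) < _
      rw [indexWeight_norPart hj, hN j, if_pos (h hj)]
      have : 0 < 1 / σ := by positivity
      linarith
  by_cases hJ : J ⊆ J₀
  · rw [if_pos hJ, Finset.sum_eq_single_of_mem _ (hmem.2 hJ) hzero,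
      iterPDeriv_coeffMonomial_norPart]
  · rw [if_neg hJ]
    exact Finset.sum_eq_zero fun β hβ => hzero β hβ fun h' => hJ (hmem.1 (h' ▸ hβ))

end MultiIndex

/-! ### Derivatives of the remainder -/

section Jet
variable {n m ℓ : ℕ} {A : Matrix (Fin ℓ) (Fin m) ℚ} {blk : Fin n → Fin (m + 1)}
  {p : Fin n → ℂ} {H : Finset (Weighted m ℓ)} {S : Multicone blk p H}
  {F : CoeffFamily n ℓ} {f : (Fin n → ℂ) → ℂ}

/-- The expected value of `∂^α f` on `Z_J`, as a function on `X` that is constant along the fibres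
of `π_J`: the derivative in the directions of `Z_J` of the coefficient belonging to the part of `α`
in the normal directions. For `J = ∅` it is `∂^α f`. -/
def jet (A : Matrix (Fin ℓ) (Fin m) ℚ) (blk : Fin n → Fin (m + 1)) (f : (Fin n → ℂ) → ℂ)
    (F : CoeffFamily n ℓ) (J : Finset (Fin ℓ)) (α : Fin n → ℕ) (z : Fin n → ℂ) : ℂ :=
  iterPDeriv (tanPart A blk J α) (if J = ∅ then f else F J (norPart A blk J α)) (proj A blk J z)

theorem jet_empty (α : Fin n → ℕ) (z : Fin n → ℂ) : jet A blk f F ∅ α z = iterPDeriv α f z := by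
  have : tanPart A blk ∅ α = α := by funext i; simp [tanPart, InK]
  simp [jet, this, proj_empty]

theorem jet_of_nonempty {J : Finset (Fin ℓ)} (hJ : J.Nonempty) (α : Fin n → ℕ) (z : Fin n → ℂ) :
    jet A blk f F J α z =
      iterPDeriv (tanPart A blk J α) (F J (norPart A blk J α)) (proj A blk J z) := by
  simp [jet, hJ.ne_empty]

theorem jet_add {J : Finset (Fin ℓ)} (hJ : J.Nonempty) {α β : Fin n → ℕ}
    (hα : Normal A blk J α) (hβ : Tangential A blk J β) (z : Fin n → ℂ) :
    jet A blk f F J (α + β) z = iterPDeriv β (F J α) (proj A blk J z) := by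
  rw [jet_of_nonempty hJ, tanPart_add hα hβ, norPart_add hα hβ]

theorem jet_congr {J : Finset (Fin ℓ)} {z z' : Fin n → ℂ} (h : proj A blk J z = proj A blk J z')
    (α : Fin n → ℕ) : jet A blk f F J α z = jet A blk f F J α z' := by
  rw [jet, jet, h]

theorem differentiable_proj (J : Finset (Fin ℓ)) : Differentiable ℂ (proj A blk J) := by
  refine differentiable_pi.2 fun i => ?_
  by_cases hi : InK A blk J i
  · simp only [proj, hi, if_true]; exact differentiable_const _
  · simp only [proj, hi, if_false]; exact differentiable_apply i

theorem differentiableOn_comp_proj (hF : IsTotalFamily A S F) {J : Finset (Fin ℓ)}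
    (hJ : J.Nonempty) {β : Fin n → ℕ} (hβ : Normal A blk J β) :
    DifferentiableOn ℂ (fun z => F J β (proj A blk J z)) S.carrier :=
  (hF J hJ β hβ).comp (differentiable_proj J).differentiableOn (Set.mapsTo_image _ _)

theorem differentiableOn_coeffMonomial (hF : IsTotalFamily A S F) {J : Finset (Fin ℓ)}
    (hJ : J.Nonempty) {β : Fin n → ℕ} (hβ : Normal A blk J β) :
    DifferentiableOn ℂ (coeffMonomial A blk J (F J β) β) S.carrier := by
  have h1 : DifferentiableOn ℂ (fun z => F J β (proj A blk J z) / ((∏ i, (β i).factorial : ℕ) : ℂ))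
      S.carrier := by
    simp only [div_eq_mul_inv]
    exact (differentiableOn_comp_proj hF hJ hβ).mul_const _
  refine h1.mul (Differentiable.differentiableOn ?_)
  refine Finset.univ.induction_on (motive := fun s : Finset (Fin n) =>
    Differentiable ℂ fun z : Fin n → ℂ => ∏ i ∈ s, z i ^ β i) ?_ fun i s hi ih => ?_
  · simp
  · simp only [Finset.prod_insert hi]
    exact ((differentiable_apply i).pow _).mul ih

theorem differentiableOn_jet (hS : IsOpen S.carrier) (hF : IsTotalFamily A S F)
    (hf : DifferentiableOn ℂ f S.carrier) (J : Finset (Fin ℓ)) (α : Fin n → ℕ) :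
    DifferentiableOn ℂ (jet A blk f F J α) S.carrier := by
  rcases J.eq_empty_or_nonempty with rfl | hJ
  · have : jet A blk f F ∅ α = iterPDeriv α f := funext (jet_empty α)
    rw [this]
    exact differentiableOn_listPDeriv hS hf _ α
  · have : jet A blk f F J α = listPDeriv (List.finRange n) (tanPart A blk J α)
        (fun z => F J (norPart A blk J α) (proj A blk J z)) := by
      rw [listPDeriv_comp_proj _ (tangential_tanPart α)]
      funext z
      rw [jet_of_nonempty hJ]
      rfl
    rw [this]
    exact differentiableOn_listPDeriv hS (differentiableOn_comp_proj hF hJ (normal_norPart α)) _ _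

theorem sub_app_eq (h0 : ∀ j k, 0 ≤ A j k) (σ : ℚ) (N : Fin ℓ → ℕ) (z : Fin n → ℂ) :
    f z - app A blk σ F N z = f z + ∑ x ∈ (Finset.univ.filter fun J : Finset (Fin ℓ) =>
      J.Nonempty).sigma (fun J => (finite_indexSet (blk := blk) h0 σ J N).toFinset),
      (-1) ^ x.1.card * coeffMonomial A blk x.1 (F x.1 x.2) x.2 z := by
  rw [sub_eq_add_neg, app, Finset.sum_sigma, ← Finset.sum_neg_distrib]
  congr 1
  refine Finset.sum_congr (by ext; simp) fun J _ => ?_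
  rw [taylorPart, finsum_mem_eq_finite_toFinset_sum _ (finite_indexSet (blk := blk) h0 σ J N),
    pow_succ, mul_neg_one, neg_mul, neg_neg, Finset.mul_sum]
  rfl

theorem iterPDeriv_sub_app (h0 : ∀ j k, 0 ≤ A j k) {σ : ℚ} (hσ : IsScale A σ)
    (hS : IsOpen S.carrier) (hF : IsTotalFamily A S F) (hf : DifferentiableOn ℂ f S.carrier)
    {J₀ : Finset (Fin ℓ)} {N : Fin ℓ → ℕ} {α : Fin n → ℕ}
    (hN : ∀ j, (N j : ℚ) / σ = indexWeight A blk j α + (if j ∈ J₀ then 1 else 0) / σ) :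
    DifferentiableOn ℂ (fun z => f z - app A blk σ F N z) S.carrier ∧
    ∀ z ∈ S.carrier, iterPDeriv α (fun z => f z - app A blk σ F N z) z =
      ∑ J ∈ J₀.powerset, (-1) ^ J.card * jet A blk f F J α z := by
  classical
  have hdiff : ∀ x ∈ (Finset.univ.filter fun J : Finset (Fin ℓ) =>
      J.Nonempty).sigma (fun J => (finite_indexSet (blk := blk) h0 σ J N).toFinset),
      DifferentiableOn ℂ (coeffMonomial A blk x.1 (F x.1 x.2) x.2) S.carrier := by
    intro x hx
    rw [Finset.mem_sigma] at hx
    exact differentiableOn_coeffMonomial hF (Finset.mem_filter.1 hx.1).2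
      ((Set.Finite.mem_toFinset _).1 hx.2).1
  simp only [sub_app_eq h0 σ N]
  refine ⟨hf.add (DifferentiableOn.fun_sum fun x hx => (hdiff x hx).const_mul _), fun z hz => ?_⟩
  rw [iterPDeriv_add_sum _ (fun x => (-1) ^ x.1.card) hS hf hdiff α hz]
  beta_reduce
  rw [Finset.sum_sigma]
  have h1 : ∀ J ∈ Finset.univ.filter (fun J : Finset (Fin ℓ) => J.Nonempty),
      ∑ β ∈ (finite_indexSet (blk := blk) h0 σ J N).toFinset,
        (-1 : ℂ) ^ J.card * iterPDeriv α (coeffMonomial A blk J (F J β) β) z =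
      if J ⊆ J₀ then (-1) ^ J.card * jet A blk f F J α z else 0 := by
    intro J hJ
    rw [← Finset.mul_sum, sum_iterPDeriv_coeffMonomial h0 hσ hN (F J),
      jet_of_nonempty (Finset.mem_filter.1 hJ).2, mul_ite, mul_zero]
  rw [Finset.sum_congr rfl h1, ← Finset.sum_filter, Finset.filter_filter]
  have h2 : J₀.powerset = insert ∅ (Finset.univ.filter fun J : Finset (Fin ℓ) =>
      J.Nonempty ∧ J ⊆ J₀) := by
    ext J
    rcases J.eq_empty_or_nonempty with rfl | hJ
    · simp
    · simp [hJ, hJ.ne_empty]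
  rw [h2, Finset.sum_insert (by simp), Finset.card_empty, pow_zero, one_mul, jet_empty]

end Jet

/-! ### Estimates of the derivatives -/

/-- If the alternating sums of `g` over the subsets of `J` are known to be small, then so are the
differences `g(J) - g(J ∪ {q})`: these differences have the alternating sums of `g` over the
subsets of `J ∪ {q}` containing `q` as their own alternating sums. -/
theorem exists_norm_sub_insert_le {ι X : Type*} [DecidableEq ι] {T : Set X}
    {g : Finset ι → X → ℂ} {q : ι} {δ : X → ℝ} (hδ : ∀ x ∈ T, 0 ≤ δ x)
    (h : ∀ J : Finset ι, ∃ C : ℝ, ∀ x ∈ T,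
      ‖∑ J' ∈ (insert q J).powerset, (-1) ^ J'.card * g J' x‖ ≤ C * δ x)
    (J : Finset ι) : ∃ C : ℝ, 0 ≤ C ∧ ∀ x ∈ T, ‖g J x - g (insert q J) x‖ ≤ C * δ x := by
  by_cases hq : q ∈ J
  · exact ⟨0, le_rfl, fun x hx => by simp [Finset.insert_eq_of_mem hq]⟩
  induction J using Finset.strongInduction with
  | H J ih =>
    have ih' : ∀ J', ∃ C : ℝ, 0 ≤ C ∧
        (J' ⊂ J → ∀ x ∈ T, ‖g J' x - g (insert q J') x‖ ≤ C * δ x) := by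
      intro J'
      by_cases hJ' : J' ⊂ J
      · obtain ⟨C, hC, h1⟩ := ih J' hJ' fun h' => hq (hJ'.subset h')
        exact ⟨C, hC, fun _ => h1⟩
      · exact ⟨0, le_rfl, fun h' => absurd h' hJ'⟩
    choose C hC0 hC using ih'
    obtain ⟨C₀, hC₀⟩ := h J
    refine ⟨max C₀ 0 + ∑ J' ∈ J.ssubsets, C J',
      add_nonneg (le_max_right _ _) (Finset.sum_nonneg fun J' _ => hC0 J'), fun x hx => ?_⟩
    have h1 := hC₀ x hx
    have h2 : ∑ J' ∈ (insert q J).powerset, (-1 : ℂ) ^ J'.card * g J' x =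
        ∑ J' ∈ J.powerset, (-1) ^ J'.card * (g J' x - g (insert q J') x) := by
      rw [Finset.sum_powerset_insert hq, ← Finset.sum_add_distrib]
      refine Finset.sum_congr rfl fun J' hJ' => ?_
      rw [Finset.card_insert_of_notMem fun h' => hq (Finset.mem_powerset.1 hJ' h'), pow_succ]
      ring
    have h3 : J.powerset = insert J J.ssubsets := by
      rw [Finset.ssubsets, Finset.insert_erase (Finset.mem_powerset_self J)]
    rw [h2, h3, Finset.sum_insert (by simp [Finset.ssubsets])] at h1
    have h4 : ‖∑ J' ∈ J.ssubsets, (-1 : ℂ) ^ J'.card * (g J' x - g (insert q J') x)‖ ≤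
        (∑ J' ∈ J.ssubsets, C J') * δ x := by
      rw [Finset.sum_mul]
      refine (norm_sum_le _ _).trans (Finset.sum_le_sum fun J' hJ' => ?_)
      rw [norm_mul, norm_pow, norm_neg, norm_one, one_pow, one_mul]
      exact hC J' (Finset.mem_ssubsets.1 hJ') x hx
    have h5 : ‖(-1 : ℂ) ^ J.card * (g J x - g (insert q J) x)‖ = ‖g J x - g (insert q J) x‖ := by
      rw [norm_mul, norm_pow, norm_neg, norm_one, one_pow, one_mul]
    rw [← h5, add_mul]
    have h6 := norm_sub_le ((-1 : ℂ) ^ J.card * (g J x - g (insert q J) x) +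
      ∑ J' ∈ J.ssubsets, (-1 : ℂ) ^ J'.card * (g J' x - g (insert q J') x))
      (∑ J' ∈ J.ssubsets, (-1 : ℂ) ^ J'.card * (g J' x - g (insert q J') x))
    rw [add_sub_cancel_right] at h6
    have h7 := mul_le_mul_of_nonneg_right (le_max_left C₀ 0) (hδ x hx)
    linarith

section Estimates
variable {n L r s : ℕ} {A : Matrix (Fin (L + r)) (Fin (L + s)) ℚ} {b : Fin L → Fin (L + s) → ℚ}
  {blk : Fin n → Fin (L + s + 1)} {p : Fin n → ℂ} {H : Finset (Weighted (L + s) (L + r))}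
  {σ : ℚ} {S : Multicone blk p H} {F : CoeffFamily n (L + r)} {f : (Fin n → ℂ) → ℂ}

/-- A holomorphic function on a multicone which is developable to a total family. -/
structure IsExpansion (A : Matrix (Fin (L + r)) (Fin (L + s)) ℚ)
    (b : Fin L → Fin (L + s) → ℚ) (σ : ℚ) (S : Multicone blk p H)
    (F : CoeffFamily n (L + r)) (f : (Fin n → ℂ) → ℂ) : Prop where
  setting : IsMulticoneSetting A b blk p H
  scale : IsScale A σ
  total : IsTotalFamily A S F
  holo : DifferentiableOn ℂ f S.carrier
  dev : IsDevelopable A σ (rhoHat A (blockNorms blk p)) S F f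

namespace IsMulticoneSetting

/-- The monomial in the radii of the polydiscs that occurs in the Cauchy estimates is the power of
the level functions, for every admissible order, whose exponents are the weights of `α`. -/
theorem prod_actionScale_pow (hs : IsMulticoneSetting A b blk p H) {z : Fin n → ℂ}
    (hz : z ∈ S.carrier) {θ : Equiv.Perm (Fin (L + r))} (hθ : Admissible A θ) (α : Fin n → ℕ) :
    ∏ i, actionScale A blk (levelAt A blk p z) i ^ α i =
      ∏ j, rhoPerm A (blockNorms blk p) θ (blockNorms blk z) j ^ (indexWeight A blk j α : ℝ) := by
  have hpos : ∀ j, 0 < rhoPerm A (blockNorms blk p) θ (blockNorms blk z) j :=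
    rhoPerm_pos hs.level hθ (hs.lead_pos hz)
  have h1 : ∏ i, actionScale A blk (levelAt A blk p z) i ^ α i =
      ∏ k, actionWeight A (levelAt A blk p z) k ^ blockLen blk α k.succ := by
    rw [← Finset.prod_fiberwise (s := Finset.univ) (g := blk), Fin.prod_univ_succ]
    have e0 : ∏ i with blk i = 0, actionScale A blk (levelAt A blk p z) i ^ α i = 1 :=
      Finset.prod_eq_one fun i hi => by
        rw [actionScale_zero (Finset.mem_filter.1 hi).2, one_pow]
    rw [e0, one_mul]
    refine Finset.prod_congr rfl fun k _ => ?_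
    rw [blockLen, ← Finset.prod_pow_eq_pow_sum]
    refine Finset.prod_congr rfl fun i hi => ?_
    rw [actionScale_succ (Finset.mem_filter.1 hi).2]
  have h2 : ∀ k, actionWeight A (levelAt A blk p z) k ^ blockLen blk α k.succ =
      ∏ j, rhoPerm A (blockNorms blk p) θ (blockNorms blk z) j ^
        ((A j k : ℝ) * (blockLen blk α k.succ : ℝ)) := by
    intro k
    rw [hs.actionWeight_levelAt hz, ← prod_rhoPerm_rpow hs.level hθ (w := blockNorms blk p)
      (hs.lead_pos hz), ← Finset.prod_pow]
    exact Finset.prod_congr rfl fun j _ => (Real.rpow_mul_natCast (hpos j).le _ _).symm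
  rw [h1, Finset.prod_congr rfl fun k _ => h2 k, Finset.prod_comm]
  refine Finset.prod_congr rfl fun j _ => ?_
  rw [← Real.rpow_sum_of_pos (hpos j), indexWeight]
  push_cast
  rfl

end IsMulticoneSetting

namespace IsExpansion

/-- The alternating sum over the subsets of `J₀` of the expected values of `∂^α f` is the derivative
of a remainder, whose order is chosen such that the terms with `J ⊆ J₀` are the only ones that
occur; so it can be estimated by Cauchy's inequalities. -/
theorem exists_norm_sum_jet_le (h : IsExpansion A b σ S F f) {S' : Multicone blk p H}
    (hS' : S'.ProperIn S) {θ : Equiv.Perm (Fin (L + r))} (hθ : Admissible A θ)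
    (J₀ : Finset (Fin (L + r))) (α : Fin n → ℕ) :
    ∃ C : ℝ, 0 ≤ C ∧ ∀ z ∈ S'.carrier,
      ‖∑ J ∈ J₀.powerset, (-1) ^ J.card * jet A blk f F J α z‖ ≤
        C * ∏ j ∈ J₀, rhoPerm A (blockNorms blk p) θ (blockNorms blk z) j ^ (1 / σ : ℝ) := by
  classical
  have hs := h.setting
  obtain ⟨hσ0, e, he, -⟩ := id h.scale
  have hσ0' : (0 : ℝ) < σ := by exact_mod_cast hσ0
  -- `n_j = σ ∑_k a_{jk} |α⁽ᵏ⁾| + 1_{J₀}(j)`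
  set N : Fin (L + r) → ℕ := fun j =>
    ∑ k, e j k * blockLen blk α k.succ + if j ∈ J₀ then 1 else 0 with hNdef
  have hN : ∀ j, (N j : ℚ) / σ = indexWeight A blk j α + (if j ∈ J₀ then 1 else 0) / σ := by
    intro j
    have h1 : (∑ k, (e j k : ℚ) * (blockLen blk α k.succ : ℚ)) = σ * indexWeight A blk j α := by
      rw [indexWeight, Finset.mul_sum]
      exact Finset.sum_congr rfl fun k _ => by rw [he, mul_assoc]
    rw [hNdef]
    push_cast
    rw [h1, add_div, mul_div_cancel_left₀ _ hσ0.ne']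
  have hNr : ∀ j, (N j : ℝ) / (σ : ℝ) =
      (indexWeight A blk j α : ℝ) + (if j ∈ J₀ then (1 / σ : ℝ) else 0) := by
    intro j
    have := congrArg (fun x : ℚ => (x : ℝ)) (hN j)
    push_cast at this
    rw [this]
    split_ifs <;> simp
  obtain ⟨S'', hS'', hS'S''⟩ := hS'.exists_between
  obtain ⟨c, hc0, hc, hpoly⟩ := hs.exists_polydisc_subset hS'S''
  obtain ⟨C₁, hC₁⟩ := h.dev S'' hS'' N
  obtain ⟨K, hK, hKle⟩ := exists_rhoPerm_le hs.level hθ (blockNorms blk p)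
  obtain ⟨C₂, hC₂, hcauchy⟩ := exists_norm_iterPDeriv_le (n := n) α
  obtain ⟨hdiff, hjet⟩ := iterPDeriv_sub_app hs.level.nonneg h.scale (hs.isOpen_carrier S) h.total
    h.holo hN
  set Q : ℝ := max C₁ 0 * ∏ j, K ^ ((N j : ℝ) / (σ : ℝ)) with hQ
  have hQ0 : 0 ≤ Q := mul_nonneg (le_max_right _ _)
    (Finset.prod_nonneg fun j _ => Real.rpow_nonneg hK.le _)
  have hcp : 0 < ∏ i, c ^ α i := Finset.prod_pos fun i _ => pow_pos hc0 _
  refine ⟨C₂ * Q / ∏ i, c ^ α i, div_nonneg (mul_nonneg hC₂.le hQ0) hcp.le, fun z hz => ?_⟩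
  have hzS'' := hS'S''.subset hz
  have hzS := hS'.subset hz
  set ρ := rhoPerm A (blockNorms blk p) θ (blockNorms blk z)
  have hρ : ∀ j, 0 < ρ j := rhoPerm_pos hs.level hθ (hs.lead_pos hz)
  have hR : ∀ i, 0 < c * actionScale A blk (levelAt A blk p z) i := fun i =>
    mul_pos hc0 (actionScale_pos (hs.levelAt_pos hz) i)
  rw [← hjet z hzS]
  have hM : ∀ w : Fin n → ℂ,
      (∀ i, ‖w i - z i‖ ≤ c * actionScale A blk (levelAt A blk p z) i) →
      ‖f w - app A blk σ F N w‖ ≤ Q * ∏ j, ρ j ^ ((N j : ℝ) / (σ : ℝ)) := by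
    intro w hw
    have hwS := hpoly z hz w hw
    have hlog := hs.abs_log_sub_log_le hz hc hw
    refine (hC₁ w hwS).trans ?_
    have hprod : ∏ j, rhoHat A (blockNorms blk p) (blockNorms blk w) j ^ ((N j : ℝ) / (σ : ℝ)) ≤
        ∏ j, (K ^ ((N j : ℝ) / (σ : ℝ)) * ρ j ^ ((N j : ℝ) / (σ : ℝ))) := by
      refine Finset.prod_le_prod (fun j _ =>
        Real.rpow_nonneg (rhoHat_nonneg hs.level (hs.lead_pos hwS) j) _) fun j _ => ?_
      rw [← Real.mul_rpow hK.le (hρ j).le]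
      refine Real.rpow_le_rpow (rhoHat_nonneg hs.level (hs.lead_pos hwS) j) ?_
        (div_nonneg (Nat.cast_nonneg _) hσ0'.le)
      exact (rhoHat_le hs.level hθ (hs.lead_pos hwS) j).trans
        (hKle _ _ (hs.lead_pos hwS) (hs.lead_pos hz) (fun i => (hlog i).2) j)
    rw [Finset.prod_mul_distrib] at hprod
    have hp0 : 0 ≤ ∏ j, rhoHat A (blockNorms blk p) (blockNorms blk w) j ^ ((N j : ℝ) / (σ : ℝ)) :=
      Finset.prod_nonneg fun j _ =>
        Real.rpow_nonneg (rhoHat_nonneg hs.level (hs.lead_pos hwS) j) _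
    calc C₁ * ∏ j, rhoHat A (blockNorms blk p) (blockNorms blk w) j ^ ((N j : ℝ) / (σ : ℝ))
        ≤ max C₁ 0 * ∏ j, rhoHat A (blockNorms blk p) (blockNorms blk w) j ^
            ((N j : ℝ) / (σ : ℝ)) := mul_le_mul_of_nonneg_right (le_max_left _ _) hp0
      _ ≤ max C₁ 0 * ((∏ j, K ^ ((N j : ℝ) / (σ : ℝ))) * ∏ j, ρ j ^ ((N j : ℝ) / (σ : ℝ))) :=
          mul_le_mul_of_nonneg_left hprod (le_max_right _ _)
      _ = Q * ∏ j, ρ j ^ ((N j : ℝ) / (σ : ℝ)) := by rw [hQ, mul_assoc]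
  have hest := hcauchy (hs.isOpen_carrier S) hdiff hR
    (fun w hw => hS''.subset (hpoly z hz w hw)) hM
  refine hest.trans (le_of_eq ?_)
  have hw0 : 0 < ∏ j, ρ j ^ (indexWeight A blk j α : ℝ) :=
    Finset.prod_pos fun j _ => Real.rpow_pos_of_pos (hρ j) _
  have e1 : ∏ i, (c * actionScale A blk (levelAt A blk p z) i) ^ α i =
      (∏ i, c ^ α i) * ∏ j, ρ j ^ (indexWeight A blk j α : ℝ) := by
    rw [← hs.prod_actionScale_pow hz hθ, ← Finset.prod_mul_distrib]
    exact Finset.prod_congr rfl fun i _ => mul_pow _ _ _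
  have e2 : ∏ j, ρ j ^ ((N j : ℝ) / (σ : ℝ)) =
      (∏ j, ρ j ^ (indexWeight A blk j α : ℝ)) * ∏ j ∈ J₀, ρ j ^ (1 / σ : ℝ) := by
    have e3 : ∏ j ∈ J₀, ρ j ^ (1 / σ : ℝ) = ∏ j, ρ j ^ (if j ∈ J₀ then (1 / σ : ℝ) else 0) := by
      rw [← Finset.prod_subset (Finset.subset_univ J₀)]
      · exact Finset.prod_congr rfl fun j hj => by rw [if_pos hj]
      · intro j _ hj; rw [if_neg hj, Real.rpow_zero]
    rw [e3, ← Finset.prod_mul_distrib]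
    exact Finset.prod_congr rfl fun j _ => by rw [hNr, Real.rpow_add (hρ j)]
  rw [e1, e2]
  field_simp

/-- The expected values of `∂^α f` on `Z_J` and on `Z_J ∩ Z_q` differ by a positive power of the
level function of `q`. -/
theorem exists_norm_jet_sub_le (h : IsExpansion A b σ S F f) {S' : Multicone blk p H}
    (hS' : S'.ProperIn S) {θ : Equiv.Perm (Fin (L + r))} (hθ : Admissible A θ)
    (J : Finset (Fin (L + r))) (q : Fin (L + r)) (α : Fin n → ℕ) :
    ∃ C : ℝ, 0 ≤ C ∧ ∀ z ∈ S'.carrier, ‖jet A blk f F J α z - jet A blk f F (insert q J) α z‖ ≤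
      C * rhoPerm A (blockNorms blk p) θ (blockNorms blk z) q ^ (1 / σ : ℝ) := by
  have hs := h.setting
  have hpos : ∀ z ∈ S'.carrier, ∀ j, 0 < rhoPerm A (blockNorms blk p) θ (blockNorms blk z) j :=
    fun z hz => rhoPerm_pos hs.level hθ (hs.lead_pos hz)
  have hσ0 : (0 : ℝ) < σ := by exact_mod_cast h.scale.1
  refine exists_norm_sub_insert_le (g := fun J z => jet A blk f F J α z)
    (δ := fun z => rhoPerm A (blockNorms blk p) θ (blockNorms blk z) q ^ (1 / σ : ℝ))
    (fun z hz => Real.rpow_nonneg (hpos z hz q).le _) (fun J => ?_) J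
  obtain ⟨C, hC, hCz⟩ := h.exists_norm_sum_jet_le hS' hθ (insert q J) α
  obtain ⟨B, hB, hBz⟩ := hs.exists_rhoPerm_le_const S' hθ
  refine ⟨C * ∏ j ∈ (insert q J).erase q, B ^ (1 / σ : ℝ), fun z hz => (hCz z hz).trans ?_⟩
  rw [← Finset.mul_prod_erase _ _ (Finset.mem_insert_self q J), mul_assoc]
  refine mul_le_mul_of_nonneg_left ?_ hC
  rw [mul_comm]
  refine mul_le_mul_of_nonneg_right (Finset.prod_le_prod
    (fun j _ => Real.rpow_nonneg (hpos z hz j).le _) fun j _ => ?_)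
    (Real.rpow_nonneg (hpos z hz q).le _)
  exact Real.rpow_le_rpow (hpos z hz j).le (hBz z hz j) (by positivity)

theorem exists_norm_jet_le (h : IsExpansion A b σ S F f) {S' : Multicone blk p H}
    (hS' : S'.ProperIn S) (J : Finset (Fin (L + r))) (α : Fin n → ℕ) :
    ∃ C : ℝ, ∀ z ∈ S'.carrier, ‖jet A blk f F J α z‖ ≤ C := by
  have hs := h.setting
  have hθ := admissible_one hs.level
  have hσ0 : (0 : ℝ) < σ := by exact_mod_cast h.scale.1
  induction J using Finset.induction_on with
  | empty =>
    obtain ⟨C, -, hCz⟩ := h.exists_norm_sum_jet_le hS' hθ ∅ α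
    exact ⟨C, fun z hz => by simpa using hCz z hz⟩
  | insert q J _ ih =>
    obtain ⟨C, hC⟩ := ih
    obtain ⟨C', hC', hC'z⟩ := h.exists_norm_jet_sub_le hS' hθ J q α
    obtain ⟨B, hB, hBz⟩ := hs.exists_rhoPerm_le_const S' hθ
    refine ⟨C + C' * B ^ (1 / σ : ℝ), fun z hz => ?_⟩
    have h1 := norm_sub_le (jet A blk f F J α z)
      (jet A blk f F J α z - jet A blk f F (insert q J) α z)
    rw [sub_sub_cancel] at h1
    have h2 := (hC'z z hz).trans (mul_le_mul_of_nonneg_left (Real.rpow_le_rpow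
      (rhoPerm_pos hs.level hθ (hs.lead_pos hz) q).le (hBz z hz q)
      (by positivity : (0 : ℝ) ≤ 1 / σ)) hC')
    linarith [hC z hz]

end IsExpansion
end Estimates

/-! ### Boundary values of the derivatives -/

section Lattice
variable {n m ℓ : ℕ} {A : Matrix (Fin ℓ) (Fin m) ℚ} {blk : Fin n → Fin (m + 1)}

theorem proj_proj_of_superset {J R : Finset (Fin ℓ)} (h : J ⊆ R) (z : Fin n → ℂ) :
    proj A blk R (proj A blk J z) = proj A blk R z := by
  funext i
  by_cases hi : InK A blk R i
  · simp [proj, hi]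
  · have : ¬ InK A blk J i := fun h' => hi (h'.mono h)
    simp [proj, hi, this]

theorem proj_eq_self {K : Finset (Fin ℓ)} {z : Fin n → ℂ}
    (h : ∀ q ∈ K, proj A blk {q} z = z) : proj A blk K z = z := by
  funext i
  by_cases hi : InK A blk K i
  · obtain ⟨k, hk, q, hq, hne⟩ := id hi
    have hi' : InK A blk {q} i := ⟨k, hk, q, Finset.mem_singleton_self q, hne⟩
    rw [← congrFun (h q hq) i]
    simp [proj, hi, hi']
  · simp [proj, hi]

open Classical in
/-- The largest index set `J` with `z ∈ Z_J`. -/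
def maxIndex (A : Matrix (Fin ℓ) (Fin m) ℚ) (blk : Fin n → Fin (m + 1)) (z : Fin n → ℂ) :
    Finset (Fin ℓ) := Finset.univ.filter fun q => proj A blk {q} z = z

theorem subset_maxIndex_proj (J : Finset (Fin ℓ)) (z : Fin n → ℂ) :
    J ⊆ maxIndex A blk (proj A blk J z) := fun q hq =>
  Finset.mem_filter.2 ⟨Finset.mem_univ q,
    proj_proj_of_subset (Finset.singleton_subset_iff.2 hq) z⟩

/-- The boundary value of `∂^α f` at a point `z`, expressed by the coefficient belonging to the
smallest of the spaces `Z_J` that contain `z`. -/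
def boundaryJet (A : Matrix (Fin ℓ) (Fin m) ℚ) (blk : Fin n → Fin (m + 1)) (f : (Fin n → ℂ) → ℂ)
    (F : CoeffFamily n ℓ) (α : Fin n → ℕ) (z : Fin n → ℂ) : ℂ :=
  jet A blk f F (maxIndex A blk z) α z

theorem iterPDeriv_zero (g : (Fin n → ℂ) → ℂ) : iterPDeriv 0 g = g := by
  have : ∀ l : List (Fin n), listPDeriv l 0 g = g := by
    intro l
    induction l with
    | nil => rfl
    | cons i l ih => rw [listPDeriv_cons, ih]; rfl
  exact this _

theorem jet_normal {f : (Fin n → ℂ) → ℂ} {F : CoeffFamily n ℓ} {J : Finset (Fin ℓ)}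
    (hJ : J.Nonempty) {α : Fin n → ℕ} (hα : Normal A blk J α) (z : Fin n → ℂ) :
    jet A blk f F J α z = F J α (proj A blk J z) := by
  have := jet_add (f := f) (F := F) hJ hα (β := 0) (fun _ _ => rfl) z
  rwa [add_zero, iterPDeriv_zero] at this

end Lattice

section Final
variable {n L r s : ℕ} {A : Matrix (Fin (L + r)) (Fin (L + s)) ℚ} {b : Fin L → Fin (L + s) → ℚ}
  {blk : Fin n → Fin (L + s + 1)} {p : Fin n → ℂ} {H : Finset (Weighted (L + s) (L + r))}
  {σ : ℚ} {S : Multicone blk p H} {F : CoeffFamily n (L + r)} {f : (Fin n → ℂ) → ℂ}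

theorem blockNorms_muSingle (q : Fin (L + r)) (z : Fin n → ℂ) {t : ℝ} (ht : 0 < t)
    (k : Fin (L + s)) : blockNorms blk (muSingle A blk q z t) k =
      t ^ (A q k : ℝ) * blockNorms blk z k := by
  rw [muSingle_eq_mu, blockNorms_mu]
  · congr 1
    rw [actionWeight, Finset.prod_eq_single q]
    · simp
    · intro j _ hj; simp [hj]
    · simp
  · intro j
    rcases eq_or_ne j q with rfl | hj <;> simp [*]

namespace IsMulticoneSetting

/-- For every `q` there is an admissible order of the actions whose level function of index `q` is
at least homogeneous of degree one under `μ_q`. -/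
theorem exists_rhoPerm_muSingle_le (hs : IsMulticoneSetting A b blk p H) (q : Fin (L + r)) :
    ∃ θ : Equiv.Perm (Fin (L + r)), Admissible A θ ∧ ∀ S : Multicone blk p H, ∀ z ∈ S.carrier,
      ∀ t : ℝ, 0 < t → t ≤ 1 →
        rhoPerm A (blockNorms blk p) θ (blockNorms blk (muSingle A blk q z t)) q ≤
          t * rhoPerm A (blockNorms blk p) θ (blockNorms blk z) q := by
  obtain ⟨θ, hθ, hscale⟩ := exists_admissible_scale hs.level (blockNorms blk p) q
  refine ⟨θ, hθ, fun S z hz t h0 h1 => hscale _ _ t h0 h1 (hs.lead_pos hz)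
    (hs.lead_pos (hs.muSingle_mem_carrier hz q h0 h1)) fun k => ?_⟩
  exact blockNorms_muSingle q z h0 _

theorem tendsto_rhoHat_muSingle (hs : IsMulticoneSetting A b blk p H) (q : Fin (L + r))
    {z : Fin n → ℂ} (hz : z ∈ S.carrier) :
    Tendsto (fun t : ℝ => rhoHat A (blockNorms blk p) (blockNorms blk (muSingle A blk q z t)) q)
      (𝓝[>] 0) (𝓝 0) := by
  obtain ⟨θ, hθ, hscale⟩ := hs.exists_rhoPerm_muSingle_le q
  have h1 : ∀ᶠ t : ℝ in 𝓝[>] 0, 0 < t ∧ t ≤ 1 :=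
    Filter.Eventually.and self_mem_nhdsWithin (nhdsWithin_le_nhds (eventually_le_nhds one_pos))
  have h2 : Tendsto (fun t : ℝ => t * rhoPerm A (blockNorms blk p) θ (blockNorms blk z) q)
      (𝓝[>] 0) (𝓝 0) := by
    have : Tendsto (fun t : ℝ => t * rhoPerm A (blockNorms blk p) θ (blockNorms blk z) q)
      (𝓝 0) (𝓝 (0 * rhoPerm A (blockNorms blk p) θ (blockNorms blk z) q)) :=
      tendsto_id.mul tendsto_const_nhds
    rw [zero_mul] at this
    exact this.mono_left nhdsWithin_le_nhds
  refine tendsto_of_tendsto_of_tendsto_of_le_of_le' tendsto_const_nhds h2 ?_ ?_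
  · filter_upwards [h1] with t ht
    exact rhoHat_nonneg hs.level (hs.lead_pos (hs.muSingle_mem_carrier hz q ht.1 ht.2)) q
  · filter_upwards [h1] with t ht
    exact (rhoHat_le hs.level hθ
      (hs.lead_pos (hs.muSingle_mem_carrier hz q ht.1 ht.2)) q).trans (hscale S z hz t ht.1 ht.2)

end IsMulticoneSetting

namespace IsExpansion

/-- If `π_J(z) ∈ Z_q`, then the action `μ_q` fixes `π_J(z)`, and the difference of the expected
values, which it does not change, is arbitrarily small. -/
theorem jet_insert (h : IsExpansion A b σ S F f) {z : Fin n → ℂ} (hz : z ∈ S.carrier)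
    {J : Finset (Fin (L + r))} {q : Fin (L + r)}
    (hq : proj A blk {q} (proj A blk J z) = proj A blk J z) (α : Fin n → ℕ) :
    jet A blk f F J α z = jet A blk f F (insert q J) α z := by
  have hs := h.setting
  obtain ⟨S', hS', hz'⟩ := Multicone.exists_properIn_mem hz
  obtain ⟨θ, hθ, hscale⟩ := hs.exists_rhoPerm_muSingle_le q
  obtain ⟨C, hC, hle⟩ := h.exists_norm_jet_sub_le hS' hθ J q α
  have hσ0 : (0 : ℝ) < 1 / σ := one_div_pos.2 (by exact_mod_cast h.scale.1)
  set ρ := rhoPerm A (blockNorms blk p) θ (blockNorms blk z) q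
  have h1 : ∀ᶠ t : ℝ in 𝓝[>] 0, 0 < t ∧ t ≤ 1 :=
    Filter.Eventually.and self_mem_nhdsWithin (nhdsWithin_le_nhds (eventually_le_nhds one_pos))
  have h2 : Tendsto (fun t : ℝ => C * (t * ρ) ^ (1 / σ : ℝ)) (𝓝[>] 0) (𝓝 0) := by
    have hcont : Continuous (fun t : ℝ => C * (t * ρ) ^ (1 / σ : ℝ)) :=
      continuous_const.mul ((Real.continuous_rpow_const hσ0.le).comp
        (continuous_id.mul continuous_const))
    have := hcont.tendsto 0
    rw [zero_mul, Real.zero_rpow hσ0.ne', mul_zero] at this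
    exact this.mono_left nhdsWithin_le_nhds
  have hq' : proj A blk {q} (proj A blk (insert q J) z) = proj A blk (insert q J) z :=
    proj_proj_of_subset (Finset.singleton_subset_iff.2 (Finset.mem_insert_self q J)) z
  have h3 : ‖jet A blk f F J α z - jet A blk f F (insert q J) α z‖ ≤ 0 := by
    refine ge_of_tendsto h2 ?_
    filter_upwards [h1] with t ht
    have hmem := hs.muSingle_mem_carrier hz' q ht.1 ht.2
    have h4 := hle _ hmem
    rw [jet_congr (proj_muSingle hq t), jet_congr (proj_muSingle hq' t)] at h4
    refine h4.trans (mul_le_mul_of_nonneg_left (Real.rpow_le_rpow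
      (rhoPerm_pos hs.level hθ (hs.lead_pos hmem) q).le (hscale S' z hz' t ht.1 ht.2) hσ0.le) hC)
  exact sub_eq_zero.1 (norm_le_zero_iff.1 h3)

theorem jet_eq_of_subset (h : IsExpansion A b σ S F f) {z : Fin n → ℂ} (hz : z ∈ S.carrier)
    {J K : Finset (Fin (L + r))} (hJK : J ⊆ K)
    (hK : ∀ q ∈ K, proj A blk {q} (proj A blk J z) = proj A blk J z) (α : Fin n → ℕ) :
    jet A blk f F J α z = jet A blk f F K α z := by
  have key : ∀ T : Finset (Fin (L + r)), T ⊆ K →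
      jet A blk f F J α z = jet A blk f F (T ∪ J) α z := by
    intro T
    induction T using Finset.induction_on with
    | empty => intro _; rw [Finset.empty_union]
    | insert q T _ ih =>
      intro hT
      obtain ⟨hq, hTK⟩ := Finset.insert_subset_iff.1 hT
      rw [ih hTK, Finset.insert_union]
      refine h.jet_insert hz ?_ α
      have h1 : proj A blk (T ∪ J) z = proj A blk J z := by
        rw [← proj_proj_of_superset (Finset.subset_union_right (s₁ := T))]
        refine proj_eq_self fun q' hq' => ?_
        rcases Finset.mem_union.1 hq' with h' | h'
        · exact hK q' (hTK h')
        · exact hK q' (hJK h')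
      rw [h1]
      exact hK q hq
  rw [key K subset_rfl, Finset.union_eq_left.2 hJK]

theorem boundaryJet_proj (h : IsExpansion A b σ S F f) {z : Fin n → ℂ} (hz : z ∈ S.carrier)
    (J : Finset (Fin (L + r))) (α : Fin n → ℕ) :
    boundaryJet A blk f F α (proj A blk J z) = jet A blk f F J α z := by
  have hsub := subset_maxIndex_proj (A := A) (blk := blk) J z
  rw [h.jet_eq_of_subset hz hsub fun q hq => (Finset.mem_filter.1 hq).2, boundaryJet]
  exact jet_congr (proj_proj_of_superset hsub z) α

/-- The derivatives of `f` have boundary values on the closures of the multicones that are properly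
contained in `S`. -/
theorem tendsto_iterPDeriv (h : IsExpansion A b σ S F f) {S' : Multicone blk p H}
    (hS' : S'.ProperIn S) (z₀ : Fin n → ℂ) (α : Fin n → ℕ) :
    Tendsto (iterPDeriv α f) (𝓝[S'.carrier] z₀) (𝓝 (boundaryJet A blk f F α z₀)) := by
  classical
  have hs := h.setting
  have hθ := admissible_one hs.level
  have hσ0 : (0 : ℝ) < 1 / σ := one_div_pos.2 (by exact_mod_cast h.scale.1)
  rw [tendsto_iff_ultrafilter]
  intro U hU
  have hmem : S'.carrier ∈ U := hU self_mem_nhdsWithin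
  have hU₀ : (U : Filter (Fin n → ℂ)) ≤ 𝓝 z₀ := hU.trans nhdsWithin_le_nhds
  obtain ⟨J, hJ, z₁, hz₁, hproj⟩ := hs.exists_proj_eq_of_tendsto hS' hU₀ hmem
  have hval : boundaryJet A blk f F α z₀ = jet A blk f F J α z₁ := by
    rw [← hproj, h.boundaryJet_proj hz₁]
  have hdiff : ∀ T ⊆ J, Tendsto (fun z => iterPDeriv α f z - jet A blk f F T α z) U (𝓝 0) := by
    intro T
    induction T using Finset.induction_on with
    | empty =>
      intro _
      simp only [jet_empty, sub_self]
      exact tendsto_const_nhds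
    | insert q T _ ih =>
      intro hT
      obtain ⟨hq, hTJ⟩ := Finset.insert_subset_iff.1 hT
      obtain ⟨C, hC, hle⟩ := h.exists_norm_jet_sub_le hS' hθ T q α
      have h1 : Tendsto (fun z => C * levelAt A blk p z q ^ (1 / σ : ℝ)) U (𝓝 0) := by
        have := ((Real.continuous_rpow_const hσ0.le).tendsto 0).comp (hJ q hq)
        rw [Real.zero_rpow hσ0.ne'] at this
        simpa using this.const_mul C
      have h2 : Tendsto (fun z => jet A blk f F T α z - jet A blk f F (insert q T) α z) U (𝓝 0) :=
        squeeze_zero_norm' (by filter_upwards [hmem] with z hz using hle z hz) h1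
      have h3 := (ih hTJ).add h2
      simpa using h3
  -- `z` is moved in the fibre of `π_J` in order to be close to `z₁`
  have hcont : Tendsto (fun z => jet A blk f F J α z) U (𝓝 (jet A blk f F J α z₁)) := by
    have h1 : Tendsto (fun z => z₁ + (proj A blk J z - proj A blk J z₁)) U (𝓝 z₁) := by
      have h2 := ((continuous_proj (A := A) (blk := blk) J).tendsto z₀).comp hU₀
      have h3 : proj A blk J z₀ = proj A blk J z₁ := by
        rw [← hproj, proj_proj_of_subset subset_rfl]
      rw [h3] at h2
      have h4 := (h2.sub_const (proj A blk J z₁)).const_add z₁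
      simpa using h4
    have h5 : ContinuousAt (jet A blk f F J α) z₁ :=
      ((differentiableOn_jet (hs.isOpen_carrier S) h.total h.holo J α).differentiableAt
        ((hs.isOpen_carrier S).mem_nhds hz₁)).continuousAt
    refine (h5.tendsto.comp h1).congr fun z => jet_congr ?_ α
    funext i
    by_cases hi : InK A blk J i <;> simp [proj, hi]
  rw [hval]
  have := (hdiff J subset_rfl).add hcont
  simpa using this

theorem continuousOn_boundaryJet (h : IsExpansion A b σ S F f) {S' : Multicone blk p H}
    (hS' : S'.ProperIn S) (α : Fin n → ℕ) :
    ContinuousOn (boundaryJet A blk f F α) (closure S'.carrier) := by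
  refine (continuousOn_extendFrom (f := iterPDeriv α f) subset_rfl fun z _ =>
    ⟨_, h.tendsto_iterPDeriv hS' z α⟩).congr fun z hz => ?_
  exact (extendFrom_eq hz (h.tendsto_iterPDeriv hS' z α)).symm

theorem isTaylorCoeff (h : IsExpansion A b σ S F f) {J : Finset (Fin (L + r))} (hJ : J.Nonempty)
    {α : Fin n → ℕ} (hα : Normal A blk J α) : IsTaylorCoeff A S f F J α := by
  intro S' hS'
  refine ⟨?_, boundaryJet A blk f F α, h.continuousOn_boundaryJet hS' α, fun z hz => ?_, ?_⟩
  · rintro _ ⟨z, hz, rfl⟩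
    exact h.setting.proj_mem_closure J hz
  · have := h.boundaryJet_proj (hS'.subset hz) ∅ α
    rwa [proj_empty, jet_empty] at this
  · rintro _ ⟨z, hz, rfl⟩
    rw [h.boundaryJet_proj (hS'.subset hz), jet_normal hJ hα]

theorem eqOn_coeff (h : IsExpansion A b σ S F f) {F' : CoeffFamily n (L + r)}
    (h' : IsExpansion A b σ S F' f) {J : Finset (Fin (L + r))} (hJ : J.Nonempty)
    {α : Fin n → ℕ} (hα : Normal A blk J α) :
    Set.EqOn (F' J α) (F J α) (proj A blk J '' S.carrier) := by
  rintro _ ⟨z, hz, rfl⟩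
  obtain ⟨S', hS', hz'⟩ := Multicone.exists_properIn_mem hz
  rw [← jet_normal (f := f) (F := F') hJ hα, ← jet_normal (f := f) (F := F) hJ hα, ← h.boundaryJet_proj hz,
    ← h'.boundaryJet_proj hz]
  have := mem_closure_iff_nhdsWithin_neBot.1 (h.setting.proj_mem_closure J hz')
  exact tendsto_nhds_unique (h'.tendsto_iterPDeriv hS' _ α) (h.tendsto_iterPDeriv hS' _ α)

theorem isConsistent (h : IsExpansion A b σ S F f) : IsConsistent A S F := by
  refine ⟨fun J hJ α hα β hβ S' hS' => ?_, fun J R hJ hJR α hα β hβ hR S' hS' => ⟨?_, ?_⟩⟩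
  · obtain ⟨C, hC⟩ := h.exists_norm_jet_le hS' J (α + β)
    refine ⟨C, ?_⟩
    rintro _ ⟨z, hz, rfl⟩
    rw [← jet_add (f := f) hJ hα hβ]
    exact hC z hz
  · rintro _ ⟨z, hz, rfl⟩
    exact h.setting.proj_mem_closure_proj hJR hz
  · refine ⟨boundaryJet A blk f F (α + β), (h.continuousOn_boundaryJet hS' _).mono ?_, ?_, ?_⟩
    · refine closure_minimal ?_ isClosed_closure
      rintro _ ⟨z, hz, rfl⟩
      exact h.setting.proj_mem_closure J hz
    · rintro _ ⟨z, hz, rfl⟩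
      rw [h.boundaryJet_proj (hS'.subset hz), jet_add hJ hα hβ]
    · rintro _ ⟨z, hz, rfl⟩
      rw [h.boundaryJet_proj (hS'.subset hz), jet_normal (hJ.mono hJR) hR]

end IsExpansion
end Final

end MultiAsymp

end

open MultiAsymp in
theorem theorem3p47 {n L r s : ℕ} (blk : Fin n → Fin (L + s + 1))
    (A : Matrix (Fin (L + r)) (Fin (L + s)) ℚ)
    (hA_nonneg : ∀ j k, 0 ≤ A j k) (hA_row : ∀ j, ∃ k, A j k ≠ 0)
    (hA_rank : A.rank = L) (hA_lead : (leading A).det ≠ 0)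
    (σ : ℚ) (hσ : IsScale A σ)
    (p : Fin n → ℂ) (hp_zero : blockPart blk p 0 = 0)
    (hp_col : ∀ k, (∀ j, A j k = 0) → blockPart blk p k.succ = 0)
    (hp_fix : ¬ IsFixedPt A blk p)
    (hp_lead : ∀ k : Fin L, blockPart blk p (Fin.castAdd s k).succ ≠ 0)
    (H : Finset (Weighted (L + s) (L + r))) (hH_tau : ∀ h ∈ H, lamExp h = 0)
    (hH : EquivSemigroup (Submonoid.closure (H : Set (Weighted (L + s) (L + r))) : Set _)
      (semiG A (blockNorms blk p)))
    (S : Multicone blk p H)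
    (F : CoeffFamily n (L + r)) (hF : IsTotalFamily A S F)
    (f : (Fin n → ℂ) → ℂ) (hf : DifferentiableOn ℂ f S.carrier)
    (hdev : IsDevelopable A σ (rhoHat A (blockNorms blk p)) S F f) :
    (∀ j, ∀ z ∈ S.carrier,
      Filter.Tendsto
        (fun t : ℝ => rhoHat A (blockNorms blk p) (blockNorms blk (muSingle A blk j z t)) j)
        (nhdsWithin 0 (Set.Ioi 0)) (nhds 0)) ∧
    (∀ J : Finset (Fin (L + r)), J.Nonempty → ∀ α, Normal A blk J α →
      IsTaylorCoeff A S f F J α) ∧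
    (∀ F' : CoeffFamily n (L + r), IsTotalFamily A S F' →
      IsDevelopable A σ (rhoHat A (blockNorms blk p)) S F' f →
      ∀ J : Finset (Fin (L + r)), J.Nonempty → ∀ α, Normal A blk J α →
        Set.EqOn (F' J α) (F J α) (proj A blk J '' S.carrier)) ∧
    IsConsistent A S F := by
  obtain ⟨b, hb⟩ := exists_isLevelMatrix hA_nonneg hA_row hA_rank hA_lead
  have hs : IsMulticoneSetting A b blk p H := ⟨hb, hp_lead, hH_tau, hH⟩
  have h : IsExpansion A b σ S F f := ⟨hs, hσ, hF, hf, hdev⟩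
  exact ⟨fun j z hz => hs.tendsto_rhoHat_muSingle j hz, fun J hJ α hα => h.isTaylorCoeff hJ hα,
    fun F' hF' hdev' J hJ α hα => h.eqOn_coeff ⟨hs, hσ, hF', hf, hdev'⟩ hJ hα, h.isConsistent⟩
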